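/- Let $d,D\ge 0$ be integers, $T>0$, and let $f\in C^2(\mathbb{R}^d,\mathbb{R}^d)$, $g\in C^2(\mathbb{R}^d,\mathbb{R}^{d\times D})$ and $x_0\in\mathbb{R}^d$ be the coefficients and the initial value of the SDE $dx(t)=f(x(t))\,dt+g(x(t))\,dw(t)$, $x(0)=x_0$, where $w$ is a $D$-dimensional Brownian motion, with respect to some filtration on a probability space, whose components have correlation matrix $\Omega$ (that is, $w$ has almost surely continuous paths, $w(0)=0$ almost surely, and $w(t)-w(s)$ is independent of $\mathcal{F}_s$ with law $N(0,(t-s)\,\Omega)$ for $s\le t$; $\Omega$ is positive semidefinite with unit diagonal). Put $$h_{ijk}(x)=\tfrac12\sum_{l=1}^d g_{lk}(x)\,\frac{\partial g_{ij}}{\partial x_l}(x).$$ Assume that there is a constant $L$ such that for all $x\in\mathbb{R}^d$ and all indices $i$, $j$, $k$, $l$, $m$ (with $1\le i,l,m\le d$ and $1\le j,k\le D$) $$\Big|\frac{\partial f_i}{\partial x_l}(x)\Big|\le L,\quad \Big|\frac{\partial g_{ij}}{\partial x_l}(x)\Big|\le L,\quad \Big|\frac{\partial h_{ijk}}{\partial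 x_l}(x)\Big|\le L,\quad \Big|\frac{\partial^2 f_i}{\partial x_m\partial x_l}(x)\Big|\le L,\quad \Big|\frac{\partial^2 g_{ij}}{\partial x_m\partial x_l}(x)\Big|\le L .$$ For $\delta\ge 0$, $x\in\mathbb{R}^d$, $v\in\mathbb{R}^D$ let $\Phi_\delta(x,v)\in\mathbb{R}^d$ be the truncated Milstein step $$\Phi_\delta(x,v)_i=x_i+f_i(x)\,\delta+\sum_{j=1}^D g_{ij}(x)\,v_j+\sum_{j,k=1}^D h_{ijk}(x)\,(v_jv_k-\Omega_{jk}\,\delta).$$ For an integer $N\ge1$ let $\Delta t=T/N$, $t_n=n\Delta t$, $t_{n+1/2}=(n+\frac12)\Delta t$, $\delta w_n=w(t_{n+1/2})-w(t_n)$, $\delta w_{n+1/2}=w(t_{n+1})-w(t_{n+1/2})$ and $\Delta w_n=w(t_{n+1})-w(t_n)$. Define the coarse path $X^c$, the fine path $X^f$ and the antithetic path $X^a$ by $X^c_0=X^f_0=X^a_0=x_0$ and, for $0\le n<N$, $$X^c_{n+1}=\Phi_{\Delta t}(X^c_n,\Delta w_n),\qquad X^f_{n+1}=\Phi_{\Delta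 t/2}\big(\Phi_{\Delta t/2}(X^f_n,\delta w_n),\,\delta w_{n+1/2}\big),\qquad X^a_{n+1}=\Phi_{\Delta t/2}\big(\Phi_{\Delta t/2}(X^a_n,\delta w_{n+1/2}),\,\delta w_n\big),$$ and let $\overline{X}^f_n=\frac12(X^f_n+X^a_n)$. Then for every real $p\ge2$ there is a constant $K_p$, independent of $N$ and $\Delta t$, such that for all $N\ge1$ $$\mathbb{E}\Big[\max_{0\le n\le N}\|\overline{X}^f_n-X^c_n\|^p\Big]\le K_p\,\Delta t^p,$$ where $\|\cdot\|$ is the Euclidean norm and the random variable on the left is integrable. Moreover, $K_p$ can be chosen to depend only on $p$, $T$, $L$, $d$, $D$ and a number $R$ with $\|x_0\|\le R$, $\|f(0)\|\le R$ and $|g_{ij}(0)|\le R$ for all $i,j$; in particular not on $f$, $g$, $x_0$, $\Omega$, the probability space or $w$ otherwise. -/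

import Mathlib

open MeasureTheory ProbabilityTheory
open scoped NNReal

noncomputable section

namespace AntitheticMilstein

/-- The partial derivative `∂φ/∂x_l` at `x` of a scalar function `φ` on `ℝ^d`. -/
def partialDeriv {d : ℕ} (l : Fin d) (φ : EuclideanSpace ℝ (Fin d) → ℝ)
    (x : EuclideanSpace ℝ (Fin d)) : ℝ :=
  fderiv ℝ φ x (EuclideanSpace.single l 1)

/-- The Milstein tensor `h_{ijk}(x) = (1/2) ∑_l g_{lk}(x) ∂g_{ij}/∂x_l (x)`. -/
def milsteinTensor {d D : ℕ} (g : EuclideanSpace ℝ (Fin d) → Matrix (Fin d) (Fin D) ℝ)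
    (i : Fin d) (j k : Fin D) (x : EuclideanSpace ℝ (Fin d)) : ℝ :=
  (1 / 2) * ∑ l : Fin d, g x l k * partialDeriv l (fun y => g y i j) x

/-- The drift `f` and the diffusion matrix `g` are `C²`, and `L` bounds all first order partial
derivatives of `f`, `g` and the Milstein tensor `h`, and all second order partial derivatives of
`f` and `g`. -/
structure BoundedDerivatives {d D : ℕ} (L : ℝ)
    (f : EuclideanSpace ℝ (Fin d) → EuclideanSpace ℝ (Fin d))
    (g : EuclideanSpace ℝ (Fin d) → Matrix (Fin d) (Fin D) ℝ) : Prop where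
  contDiff_f : ContDiff ℝ 2 f
  contDiff_g : ∀ i j, ContDiff ℝ 2 (fun x => g x i j)
  deriv_f : ∀ i l x, |partialDeriv l (fun y => f y i) x| ≤ L
  deriv_g : ∀ i j l x, |partialDeriv l (fun y => g y i j) x| ≤ L
  deriv_h : ∀ i j k l x, |partialDeriv l (milsteinTensor g i j k) x| ≤ L
  deriv2_f : ∀ i k l x, |partialDeriv k (partialDeriv l (fun y => f y i)) x| ≤ L
  deriv2_g : ∀ i j k l x, |partialDeriv k (partialDeriv l (fun y => g y i j)) x| ≤ L

/-- A correlation matrix: symmetric, positive semidefinite, with unit diagonal. -/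
structure IsCorrelationMatrix {D : ℕ} (C : Matrix (Fin D) (Fin D) ℝ) : Prop where
  posSemidef : C.PosSemidef
  diag : ∀ j, C j j = 1

/-- `w` is a `D`-dimensional Brownian motion with correlation matrix `C`, relative to the
filtration `ℱ`. The case `C = 1` is standard Brownian motion with independent components. -/
structure IsBrownianMotion {S : Type*} {mS : MeasurableSpace S} {D : ℕ}
    (w : ℝ≥0 → S → EuclideanSpace ℝ (Fin D)) (C : Matrix (Fin D) (Fin D) ℝ)
    (ℱ : Filtration ℝ≥0 mS) (P : Measure S) : Prop where
  adapted : ∀ t, Measurable[ℱ t] (w t)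
  zero : ∀ᵐ s ∂P, w 0 s = 0
  continuous : ∀ᵐ s ∂P, Continuous fun t => w t s
  indep : ∀ t u, t ≤ u →
    Indep (MeasurableSpace.comap (fun s => w u s - w t s) inferInstance) (ℱ t) P
  law : ∀ t u, t ≤ u →
    HasLaw (fun s => w u s - w t s) (multivariateGaussian 0 (((u - t : ℝ≥0) : ℝ) • C)) P

/-- One step of the truncated Milstein scheme (Lévy areas dropped), from the state `x`, with time
step `δ` and Brownian increment `v` over that step. -/
def milsteinStep {d D : ℕ} (f : EuclideanSpace ℝ (Fin d) → EuclideanSpace ℝ (Fin d))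
    (g : EuclideanSpace ℝ (Fin d) → Matrix (Fin d) (Fin D) ℝ) (C : Matrix (Fin D) (Fin D) ℝ)
    (δ : ℝ) (x : EuclideanSpace ℝ (Fin d)) (v : EuclideanSpace ℝ (Fin D)) :
    EuclideanSpace ℝ (Fin d) :=
  WithLp.toLp 2 fun i =>
    x i + f x i * δ + ∑ j, g x i j * v j
      + ∑ j, ∑ k, milsteinTensor g i j k x * (v j * v k - C j k * δ)

/-- The increment `W((m+1)δ) - W(mδ)` of a path `W` over the `m`-th interval of length `δ`. -/
def increment {D : ℕ} (W : ℝ≥0 → EuclideanSpace ℝ (Fin D)) (δ : ℝ≥0) (m : ℕ) :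
    EuclideanSpace ℝ (Fin D) :=
  W ((m + 1) * δ) - W (m * δ)

/-- The coarse path `X^c_n`, with time step `Δt`, driven by the path `W`. -/
def coarsePath {d D : ℕ} (f : EuclideanSpace ℝ (Fin d) → EuclideanSpace ℝ (Fin d))
    (g : EuclideanSpace ℝ (Fin d) → Matrix (Fin d) (Fin D) ℝ) (C : Matrix (Fin D) (Fin D) ℝ)
    (x₀ : EuclideanSpace ℝ (Fin d)) (Δt : ℝ≥0) (W : ℝ≥0 → EuclideanSpace ℝ (Fin D)) :
    ℕ → EuclideanSpace ℝ (Fin d)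
  | 0 => x₀
  | n + 1 => milsteinStep f g C Δt (coarsePath f g C x₀ Δt W n) (increment W Δt n)

/-- The fine path `X^f_n` at the coarse times `nΔt`: each coarse step consists of two truncated
Milstein steps of size `Δt/2`, the first using the Brownian increment `δw_n` over the first half of
the coarse step, the second using the increment `δw_{n+1/2}` over the second half. -/
def finePath {d D : ℕ} (f : EuclideanSpace ℝ (Fin d) → EuclideanSpace ℝ (Fin d))
    (g : EuclideanSpace ℝ (Fin d) → Matrix (Fin d) (Fin D) ℝ) (C : Matrix (Fin D) (Fin D) ℝ)
    (x₀ : EuclideanSpace ℝ (Fin d)) (Δt : ℝ≥0) (W : ℝ≥0 → EuclideanSpace ℝ (Fin D)) :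
    ℕ → EuclideanSpace ℝ (Fin d)
  | 0 => x₀
  | n + 1 =>
    milsteinStep f g C (Δt / 2)
      (milsteinStep f g C (Δt / 2) (finePath f g C x₀ Δt W n) (increment W (Δt / 2) (2 * n)))
      (increment W (Δt / 2) (2 * n + 1))

/-- The antithetic path `X^a_n` at the coarse times `nΔt`: as the fine path, but with the increments
`δw_n` and `δw_{n+1/2}` over the two halves of each coarse step swapped. -/
def antitheticPath {d D : ℕ} (f : EuclideanSpace ℝ (Fin d) → EuclideanSpace ℝ (Fin d))
    (g : EuclideanSpace ℝ (Fin d) → Matrix (Fin d) (Fin D) ℝ) (C : Matrix (Fin D) (Fin D) ℝ)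
    (x₀ : EuclideanSpace ℝ (Fin d)) (Δt : ℝ≥0) (W : ℝ≥0 → EuclideanSpace ℝ (Fin D)) :
    ℕ → EuclideanSpace ℝ (Fin d)
  | 0 => x₀
  | n + 1 =>
    milsteinStep f g C (Δt / 2)
      (milsteinStep f g C (Δt / 2) (antitheticPath f g C x₀ Δt W n)
        (increment W (Δt / 2) (2 * n + 1)))
      (increment W (Δt / 2) (2 * n))

/-- The average `(X^f_n + X^a_n) / 2` of the fine and antithetic paths. -/
def averagePath {d D : ℕ} (f : EuclideanSpace ℝ (Fin d) → EuclideanSpace ℝ (Fin d))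
    (g : EuclideanSpace ℝ (Fin d) → Matrix (Fin d) (Fin D) ℝ) (C : Matrix (Fin D) (Fin D) ℝ)
    (x₀ : EuclideanSpace ℝ (Fin d)) (Δt : ℝ≥0) (W : ℝ≥0 → EuclideanSpace ℝ (Fin D)) (n : ℕ) :
    EuclideanSpace ℝ (Fin d) :=
  (1 / 2 : ℝ) • (finePath f g C x₀ Δt W n + antitheticPath f g C x₀ Δt W n)

/-- The maximal `p`-th power error `max_{0 ≤ n ≤ N} ‖(X^f_n + X^a_n)/2 - X^c_n‖^p` over `N` coarse
steps of size `Δt`, for the driving path `W`. -/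
def maxError {d D : ℕ} (f : EuclideanSpace ℝ (Fin d) → EuclideanSpace ℝ (Fin d))
    (g : EuclideanSpace ℝ (Fin d) → Matrix (Fin d) (Fin D) ℝ) (C : Matrix (Fin D) (Fin D) ℝ)
    (x₀ : EuclideanSpace ℝ (Fin d)) (Δt : ℝ≥0) (N : ℕ) (p : ℝ)
    (W : ℝ≥0 → EuclideanSpace ℝ (Fin D)) : ℝ :=
  (Finset.range (N + 1)).sup' Finset.nonempty_range_add_one fun n =>
    ‖averagePath f g C x₀ Δt W n - coarsePath f g C x₀ Δt W n‖ ^ p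

end AntitheticMilstein

end

/-!
The scheme sees the Brownian motion only through the increments `a n`, `b n` over the two halves
of the coarse steps. All that is used of them is recorded in the structure `Model`: they are
independent of the past and of each other, centred, with covariance `(h / 2) C`, and their absolute
moments of order `q` are at most a constant times `r ^ q`, where `h` is the coarse step and
`r = √h`. The bounds in the argument are uniform over all models with the same `d`, `D`, `T`, `L`,
`R`; `IsBigO k Z` says that for each `q` the `q`-th absolute moment of `Z M n` is at most a constant
times `r ^ (k q)`, with a constant that depends only on these data. Since uniform moments of every
order are available, the orders simply add under multiplication.

*Stability.* If a process changes in each step by `U + V`, where `V` is centred given the past, then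
the even moments satisfy a discrete Grönwall inequality, to which `U` contributes at the rate of the
step `r ^ 2` and `V`, because it is centred, at the rate `r`. Hence `isBigO_norm_of_step`: if the
increments are Lipschitz in the process up to a drift perturbation `O(r ^ (k + 2))` and a centred
perturbation `O(r ^ (k + 1))`, and the process starts from `0`, it is `O(r ^ k)`.

*The pair.* A Taylor expansion of the two half steps about `X = fine n` (`fine_succ_apply`) writes the
fine path over a coarse step as the coarse Milstein step from `X`, plus a term `exchange`,
`∑ j k, h_{ijk}(X) (b_j a_k - a_j b_k)`, plus a centred remainder `O(r ^ 3)` and a remainder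
`O(r ^ 4)`. The truncated Lévy area makes `exchange` only `O(r ^ 2)`, so that the fine and the
antithetic path, which is the fine path with `a` and `b` swapped, differ by `O(r)` and no better.
But `exchange` is antisymmetric in `a` and `b`; in the average of the two paths there survives only
the difference of its values at the two paths, which is centred and `O(r ^ 2 * r) = O(r ^ 3)`. The
average of `f` over the two paths differs from `f` at their average by the second order Taylor
remainder, `O(r ^ 2)`, times the step; likewise for `g`, while `h_{ijk}`, which is only Lipschitz,
gains `O(r)` and is multiplied by products of two increments, `O(r ^ 2)`. All perturbations in
the recursion for the error of the average are thus drifts `O(r ^ 4)` and centred terms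
`O(r ^ 3)`, and stability gives `O(r ^ 2) = O(h)` (`isBigO_norm_err`).

*The maximum.* The same moment inequality, started at an arbitrary time, bounds the `2q`-th moments of
increments of the error over `m` steps by a constant times `h ^ (2q) (m / N) ^ q`. A dyadic chaining
argument (`exists_integrable_envelope`) turns this into a bound for the maximum, in place of a
martingale maximal inequality. Brownian increments form a model (`IsBrownianMotion.model`), and a
general exponent `p ≥ 2` reduces to an even integer one by `rpow_le_rpow_mul_one_add`.
-/

noncomputable section

universe u

namespace AntitheticMilstein

/-! ### Random variables with finite moments, and conditionally centred ones -/

section Moments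

variable {S : Type*} {m m' m₁ mS : MeasurableSpace S} {P : Measure S}

/-- A measurable real random variable all of whose absolute moments are finite. These form an
algebra, so that no integrability exponents have to be tracked. -/
structure HasMoments (P : Measure S) (Z : S → ℝ) : Prop where
  measurable : Measurable Z
  integrable_pow : ∀ q : ℕ, Integrable (fun s => |Z s| ^ q) P

lemma abs_add_pow_le (x y : ℝ) (q : ℕ) : |x + y| ^ q ≤ 2 ^ q * (|x| ^ q + |y| ^ q) := by
  calc |x + y| ^ q ≤ (|x| + |y|) ^ q := by gcongr; exact abs_add_le x y
    _ ≤ 2 ^ (q - 1) * (|x| ^ q + |y| ^ q) := add_pow_le (abs_nonneg x) (abs_nonneg y) q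
    _ ≤ 2 ^ q * (|x| ^ q + |y| ^ q) := by
        gcongr
        · norm_num
        · omega

lemma abs_mul_pow_le (x y : ℝ) (q : ℕ) : |x * y| ^ q ≤ |x| ^ (2 * q) + |y| ^ (2 * q) := by
  rw [abs_mul, mul_pow, pow_mul', pow_mul']
  nlinarith [sq_nonneg (|x| ^ q - |y| ^ q), sq_nonneg (|x| ^ q), sq_nonneg (|y| ^ q)]

lemma sum_abs_pow_le {ι : Type*} (s : Finset ι) (x : ι → ℝ) (q : ℕ) :
    (∑ i ∈ s, |x i|) ^ (q + 1) ≤ ((s.card : ℝ) + 1) ^ q * ∑ i ∈ s, |x i| ^ (q + 1) := by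
  rcases s.eq_empty_or_nonempty with rfl | hs
  · simp
  have hc : (0 : ℝ) < s.card := by exact_mod_cast hs.card_pos
  have h := pow_sum_div_card_le_sum_pow (s := s) (f := fun i => |x i|)
    (fun i _ => abs_nonneg _) q
  rw [div_le_iff₀ (by positivity)] at h
  calc _ ≤ _ := h
    _ ≤ (∑ i ∈ s, |x i| ^ (q + 1)) * (s.card + 1) ^ q := by gcongr; linarith
    _ = _ := mul_comm _ _

namespace HasMoments

variable {Z W : S → ℝ}

lemma integrable [IsProbabilityMeasure P] (hZ : HasMoments P Z) : Integrable Z P := by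
  have h := hZ.integrable_pow 1
  simp only [pow_one] at h
  exact (integrable_norm_iff hZ.measurable.aestronglyMeasurable).1 h

lemma of_le (hZ : Measurable Z) (hW : HasMoments P W) (h : ∀ s, |Z s| ≤ |W s|) :
    HasMoments P Z := by
  refine ⟨hZ, fun q => (hW.integrable_pow q).mono' ?_ ?_⟩
  · exact (hZ.abs.pow_const q).aestronglyMeasurable
  · refine .of_forall fun s => ?_
    rw [Real.norm_eq_abs, abs_of_nonneg (by positivity)]
    exact pow_le_pow_left₀ (abs_nonneg _) (h s) q

lemma const [IsProbabilityMeasure P] (c : ℝ) : HasMoments P (fun _ => c) :=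
  ⟨measurable_const, fun _ => integrable_const _⟩

lemma add (hZ : HasMoments P Z) (hW : HasMoments P W) : HasMoments P (fun s => Z s + W s) := by
  refine ⟨hZ.measurable.add hW.measurable, fun q =>
    (((hZ.integrable_pow q).add (hW.integrable_pow q)).const_mul (2 ^ q)).mono' ?_ ?_⟩
  · exact ((hZ.measurable.add hW.measurable).abs.pow_const q).aestronglyMeasurable
  · refine .of_forall fun s => ?_
    rw [Real.norm_eq_abs, abs_of_nonneg (by positivity)]
    exact abs_add_pow_le _ _ q

lemma mul (hZ : HasMoments P Z) (hW : HasMoments P W) : HasMoments P (fun s => Z s * W s) := by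
  refine ⟨hZ.measurable.mul hW.measurable, fun q =>
    ((hZ.integrable_pow (2 * q)).add (hW.integrable_pow (2 * q))).mono' ?_ ?_⟩
  · exact ((hZ.measurable.mul hW.measurable).abs.pow_const q).aestronglyMeasurable
  · refine .of_forall fun s => ?_
    rw [Real.norm_eq_abs, abs_of_nonneg (by positivity)]
    exact abs_mul_pow_le _ _ q

lemma const_mul [IsProbabilityMeasure P] (c : ℝ) (hZ : HasMoments P Z) :
    HasMoments P (fun s => c * Z s) :=
  (const c).mul hZ

lemma neg (hZ : HasMoments P Z) : HasMoments P (fun s => - Z s) :=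
  of_le hZ.measurable.neg hZ fun s => by simp

lemma sub (hZ : HasMoments P Z) (hW : HasMoments P W) : HasMoments P (fun s => Z s - W s) := by
  simpa only [sub_eq_add_neg] using hZ.add hW.neg

lemma abs (hZ : HasMoments P Z) : HasMoments P (fun s => |Z s|) :=
  of_le hZ.measurable.abs hZ fun s => by simp

lemma sum [IsProbabilityMeasure P] {ι : Type*} {s : Finset ι} {Z : ι → S → ℝ}
    (hZ : ∀ i ∈ s, HasMoments P (Z i)) : HasMoments P (fun ω => ∑ i ∈ s, Z i ω) := by
  classical
  induction s using Finset.induction_on with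
  | empty => simpa using const (P := P) 0
  | insert i s hi ih =>
    simp only [Finset.sum_insert hi]
    exact (hZ i (by simp)).add (ih fun j hj => hZ j (by simp [hj]))

lemma pow [IsProbabilityMeasure P] (hZ : HasMoments P Z) (k : ℕ) :
    HasMoments P (fun s => Z s ^ k) := by
  induction k with
  | zero => simpa using const (P := P) 1
  | succ k ih => simpa only [pow_succ] using ih.mul hZ

end HasMoments

/-- `V` has conditional expectation zero given the σ-algebra `m`, expressed by its orthogonality to
all `m`-measurable random variables with finite moments. -/
structure Centered (m : MeasurableSpace S) {mS : MeasurableSpace S} (P : Measure S)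
    (V : S → ℝ) : Prop where
  moments : HasMoments P V
  orthogonal : ∀ ψ : S → ℝ, Measurable[m] ψ → HasMoments P ψ → ∫ s, ψ s * V s ∂P = 0

namespace Centered

variable {V W : S → ℝ}

lemma mono (hV : Centered m' P V) (h : m ≤ m') : Centered m P V :=
  ⟨hV.moments, fun ψ hψ => hV.orthogonal ψ (hψ.mono h le_rfl)⟩

/-- Known factors can be taken out of a conditional expectation. -/
lemma mul_left {φ : S → ℝ} (hV : Centered m P V) (hφ : Measurable[m] φ) (hφm : HasMoments P φ) :
    Centered m P (fun s => φ s * V s) := by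
  refine ⟨hφm.mul hV.moments, fun ψ hψ hm => ?_⟩
  simpa only [mul_assoc] using hV.orthogonal (fun s => ψ s * φ s) (hψ.mul hφ) (hm.mul hφm)

lemma of_indep (h : Indep m₁ m P) (hV : HasMoments P V) (hV₁ : Measurable[m₁] V) (h0 : ∫ s, V s ∂P = 0) : Centered m P V := by
  refine ⟨hV, fun ψ hψ hψm => ?_⟩
  have hi : IndepFun ψ V P := by
    rw [IndepFun_iff_Indep]
    exact indep_of_indep_of_le h.symm hψ.comap_le hV₁.comap_le
  rw [hi.integral_fun_mul_eq_mul_integral hψm.measurable.aestronglyMeasurable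
    hV.measurable.aestronglyMeasurable, h0, mul_zero]

variable [IsProbabilityMeasure P]

lemma add (hV : Centered m P V) (hW : Centered m P W) : Centered m P (fun s => V s + W s) := by
  refine ⟨hV.moments.add hW.moments, fun ψ hψ hm => ?_⟩
  simp only [mul_add]
  rw [integral_add (hm.mul hV.moments).integrable (hm.mul hW.moments).integrable,
    hV.orthogonal ψ hψ hm, hW.orthogonal ψ hψ hm, add_zero]

lemma zero : Centered m P (fun _ => 0) := ⟨HasMoments.const 0, fun _ _ _ => by simp⟩

lemma const_mul (c : ℝ) (hV : Centered m P V) : Centered m P (fun s => c * V s) :=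
  hV.mul_left measurable_const (HasMoments.const c)

lemma neg (hV : Centered m P V) : Centered m P (fun s => - V s) := by
  simpa using hV.const_mul (-1)

lemma sub (hV : Centered m P V) (hW : Centered m P W) : Centered m P (fun s => V s - W s) := by
  simpa only [sub_eq_add_neg] using hV.add hW.neg

lemma sum {ι : Type*} {t : Finset ι} {V : ι → S → ℝ} (hV : ∀ i ∈ t, Centered m P (V i)) :
    Centered m P (fun s => ∑ i ∈ t, V i s) := by
  classical
  induction t using Finset.induction_on with
  | empty => simpa using zero (P := P) (m := m)
  | insert i t hi ih =>
    simp only [Finset.sum_insert hi]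
    exact (hV i (by simp)).add (ih fun j hj => hV j (by simp [hj]))

end Centered

end Moments

/-! ### The one-step moment inequality and the discrete Grönwall inequality -/

/-- The second order remainder of `(z + t ω) ^ (m + 1)` in `t ∈ [0, 1]`. -/
lemma abs_add_pow_sub_le (z ω t : ℝ) (ht0 : 0 ≤ t) (ht1 : t ≤ 1) (m : ℕ) :
    |(z + t * ω) ^ (m + 1) - z ^ (m + 1) - (m + 1) * z ^ m * (t * ω)|
      ≤ t ^ 2 * ((m + 1) ^ 2 * (|z| + |ω|) ^ (m + 1)) := by
  induction m with
  | zero =>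
    have : (z + t * ω) ^ (0 + 1) - z ^ (0 + 1) - ((0 : ℕ) + 1) * z ^ 0 * (t * ω) = 0 := by
      push_cast; ring
    rw [this, abs_zero]
    positivity
  | succ m ih =>
    set E := (z + t * ω) ^ (m + 1) - z ^ (m + 1) - (m + 1) * z ^ m * (t * ω) with hE
    set A := |z| + |ω| with hA
    have hA0 : 0 ≤ A := by positivity
    have hz : |z| ≤ A := by simp [hA]
    have hω : |ω| ≤ A := by simp [hA]
    have hzω : |z + t * ω| ≤ A := by
      calc |z + t * ω| ≤ |z| + |t * ω| := abs_add_le _ _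
        _ = |z| + t * |ω| := by rw [abs_mul, abs_of_nonneg ht0]
        _ ≤ |z| + 1 * |ω| := by gcongr
        _ = A := by rw [one_mul]
    have key : (z + t * ω) ^ (m + 1 + 1) - z ^ (m + 1 + 1)
          - ((m + 1 : ℕ) + 1) * z ^ (m + 1) * (t * ω)
        = (z + t * ω) * E + t ^ 2 * ((m + 1) * z ^ m * ω ^ 2) := by
      rw [hE]; push_cast; ring
    rw [key]
    calc |(z + t * ω) * E + t ^ 2 * ((m + 1) * z ^ m * ω ^ 2)|
        ≤ |z + t * ω| * |E| + t ^ 2 * ((m + 1) * |z| ^ m * |ω| ^ 2) := by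
          refine (abs_add_le _ _).trans (le_of_eq ?_)
          rw [abs_mul, abs_mul, abs_mul, abs_mul, abs_pow, abs_pow, abs_pow,
            abs_of_nonneg ht0, abs_of_nonneg (by positivity : (0 : ℝ) ≤ (m : ℝ) + 1)]
      _ ≤ A * (t ^ 2 * ((m + 1) ^ 2 * A ^ (m + 1))) + t ^ 2 * ((m + 1) * A ^ m * A ^ 2) := by
          gcongr
      _ = t ^ 2 * (((m + 1) ^ 2 + (m + 1)) * A ^ (m + 1 + 1)) := by ring
      _ ≤ t ^ 2 * (((m + 1 : ℕ) + 1) ^ 2 * A ^ (m + 1 + 1)) := by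
          gcongr
          push_cast
          nlinarith [(Nat.cast_nonneg m : (0 : ℝ) ≤ m)]

lemma sum_three_pow_le {a b c : ℝ} (ha : 0 ≤ a) (hb : 0 ≤ b) (hc : 0 ≤ c) (q : ℕ) :
    (a + b + c) ^ q ≤ 3 ^ q * (a ^ q + b ^ q + c ^ q) := by
  have hm : a + b + c ≤ 3 * max a (max b c) := by
    have h1 := le_max_left a (max b c)
    have h2 := le_max_right a (max b c)
    have h3 := le_max_left b c
    have h4 := le_max_right b c
    linarith
  calc (a + b + c) ^ q ≤ (3 * max a (max b c)) ^ q := by gcongr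
    _ = 3 ^ q * (max a (max b c)) ^ q := mul_pow _ _ _
    _ ≤ 3 ^ q * (a ^ q + b ^ q + c ^ q) := by
        gcongr
        have ha' := pow_nonneg ha q
        have hb' := pow_nonneg hb q
        have hc' := pow_nonneg hc q
        rcases max_choice a (max b c) with h | h <;> rw [h]
        · linarith
        · rcases max_choice b c with h | h <;> rw [h] <;> linarith

/-- The constant in the one-step moment inequality. -/
def stepConst (m : ℕ) : ℝ := ((m + 1) ^ 2 + (m + 1)) * 3 ^ (m + 1)

lemma stepConst_nonneg (m : ℕ) : 0 ≤ stepConst m := by unfold stepConst; positivity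

/-- Growth of a power under a drift of size `t²` and a fluctuation of size `t`: apart from the term
that is linear in the fluctuation, the growth is of size `t²`. -/
lemma add_pow_step_le (z υ ν t : ℝ) (ht0 : 0 ≤ t) (ht1 : t ≤ 1) (m : ℕ) :
    (z + t ^ 2 * υ + t * ν) ^ (m + 1) ≤ z ^ (m + 1) + (m + 1) * t * (z ^ m * ν)
      + stepConst m * t ^ 2 * (|z| ^ (m + 1) + |υ| ^ (m + 1) + |ν| ^ (m + 1)) := by
  have h := (abs_le.1 (abs_add_pow_sub_le z (t * υ + ν) t ht0 ht1 m)).2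
  have e : z + t * (t * υ + ν) = z + t ^ 2 * υ + t * ν := by ring
  rw [e] at h
  set B := |z| + |υ| + |ν| with hB
  have hB0 : 0 ≤ B := by positivity
  have h1 : |z| + |t * υ + ν| ≤ B := by
    have := abs_add_le (t * υ) ν
    rw [abs_mul, abs_of_nonneg ht0] at this
    have h' : t * |υ| ≤ 1 * |υ| := by gcongr
    linarith
  have h2 : (|z| + |t * υ + ν|) ^ (m + 1) ≤ B ^ (m + 1) := by gcongr
  have h3 : z ^ m * υ ≤ B ^ (m + 1) := by
    refine (le_abs_self _).trans ?_
    rw [abs_mul, abs_pow, pow_succ]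
    gcongr
    · rw [hB]; linarith [abs_nonneg υ, abs_nonneg ν]
    · rw [hB]; linarith [abs_nonneg z, abs_nonneg ν]
  have h4 : B ^ (m + 1) ≤ 3 ^ (m + 1) * (|z| ^ (m + 1) + |υ| ^ (m + 1) + |ν| ^ (m + 1)) :=
    sum_three_pow_le (abs_nonneg z) (abs_nonneg υ) (abs_nonneg ν) _
  have h5 : t ^ 2 * ((m + 1) ^ 2 * (|z| + |t * υ + ν|) ^ (m + 1))
      ≤ t ^ 2 * ((m + 1) ^ 2 * B ^ (m + 1)) := by gcongr
  have h6 : ((m + 1) * t ^ 2) * (z ^ m * υ) ≤ ((m + 1) * t ^ 2) * B ^ (m + 1) := by gcongr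
  have h7 : (((m + 1) ^ 2 + (m + 1)) * t ^ 2) * B ^ (m + 1) ≤ (((m + 1) ^ 2 + (m + 1)) * t ^ 2) *
      (3 ^ (m + 1) * (|z| ^ (m + 1) + |υ| ^ (m + 1) + |ν| ^ (m + 1))) := by gcongr
  unfold stepConst
  linarith

section Expectation

variable {S : Type*} {m mS : MeasurableSpace S} {P : Measure S} [IsProbabilityMeasure P]

/-- In expectation the centred fluctuation contributes only to second order. -/
lemma integral_add_pow_step_le {Z U V : S → ℝ} {t : ℝ} (ht0 : 0 ≤ t) (ht1 : t ≤ 1) {p : ℕ}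
    (hp : Even p) (hp0 : p ≠ 0) (hZ : HasMoments P Z) (hZm : Measurable[m] Z)
    (hU : HasMoments P U) (hV : Centered m P V) :
    ∫ s, |Z s + t ^ 2 * U s + t * V s| ^ p ∂P ≤ ∫ s, |Z s| ^ p ∂P
      + stepConst (p - 1) * t ^ 2 * (∫ s, |Z s| ^ p ∂P + ∫ s, |U s| ^ p ∂P
        + ∫ s, |V s| ^ p ∂P) := by
  obtain ⟨k, rfl⟩ := Nat.exists_eq_succ_of_ne_zero hp0
  simp only [Nat.succ_eq_add_one, Nat.add_sub_cancel] at *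
  have hZV : Integrable (fun s => Z s ^ k * V s) P := ((hZ.pow k).mul hV.moments).integrable
  have i1 := hZ.integrable_pow (k + 1)
  have i2 := hU.integrable_pow (k + 1)
  have i3 := hV.moments.integrable_pow (k + 1)
  have h0 : ∫ s, Z s ^ k * V s ∂P = 0 := hV.orthogonal _ (hZm.pow_const k) (hZ.pow k)
  have j1 : Integrable (fun s => |Z s| ^ (k + 1) + (k + 1) * t * (Z s ^ k * V s)) P :=
    i1.add (hZV.const_mul _)
  have j3 : Integrable (fun s => |Z s| ^ (k + 1) + |U s| ^ (k + 1)) P := i1.add i2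
  have j2 : Integrable (fun s => stepConst k * t ^ 2 *
      ((|Z s| ^ (k + 1) + |U s| ^ (k + 1)) + |V s| ^ (k + 1))) P := (j3.add i3).const_mul _
  calc ∫ s, |Z s + t ^ 2 * U s + t * V s| ^ (k + 1) ∂P
      ≤ ∫ s, ((|Z s| ^ (k + 1) + (k + 1) * t * (Z s ^ k * V s))
        + stepConst k * t ^ 2 * ((|Z s| ^ (k + 1) + |U s| ^ (k + 1)) + |V s| ^ (k + 1))) ∂P := by
        refine integral_mono
          (((hZ.add (hU.const_mul (t ^ 2))).add (hV.moments.const_mul t)).integrable_pow _)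
          (j1.add j2) fun s => ?_
        have := add_pow_step_le (Z s) (U s) (V s) t ht0 ht1 k
        simp only [hp.pow_abs] at this ⊢
        exact this
    _ = _ := by
        rw [integral_add j1 j2, integral_add i1 (hZV.const_mul _), integral_const_mul, h0,
          integral_const_mul, integral_add j3 i3, integral_add i1 i2]
        ring

end Expectation

lemma discrete_gronwall_of_le {e : ℕ → ℝ} {κ ε B : ℝ} {N : ℕ} (hκ : 0 ≤ κ) (hε : 0 ≤ ε)
    (hB : 0 ≤ B) (he0 : 0 ≤ e 0) (h : ∀ n < N, e (n + 1) ≤ e n + κ * ε * e n + ε * B) (n : ℕ)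
    (hn : n ≤ N) : e n ≤ Real.exp (κ * ε * n) * (e 0 + n * ε * B) := by
  induction n with
  | zero => simp
  | succ n ih =>
    have ih := ih (by omega)
    have h1 : 1 + κ * ε ≤ Real.exp (κ * ε) := by linarith [Real.add_one_le_exp (κ * ε)]
    have h2 : (1 : ℝ) ≤ Real.exp (κ * ε * (n + 1)) := Real.one_le_exp (by positivity)
    calc e (n + 1) ≤ (1 + κ * ε) * e n + ε * B := by linarith [h n (by omega)]
      _ ≤ (1 + κ * ε) * (Real.exp (κ * ε * n) * (e 0 + n * ε * B)) + ε * B := by gcongr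
      _ ≤ Real.exp (κ * ε) * (Real.exp (κ * ε * n) * (e 0 + n * ε * B))
          + Real.exp (κ * ε * (n + 1)) * (ε * B) := by
          refine add_le_add (by gcongr) ?_
          exact le_mul_of_one_le_left (by positivity) h2
      _ = Real.exp (κ * ε * (n + 1 : ℕ)) * (e 0 + (n + 1 : ℕ) * ε * B) := by
          have : Real.exp (κ * ε * (n + 1)) = Real.exp (κ * ε) * Real.exp (κ * ε * n) := by
            rw [← Real.exp_add]; ring_nf
          push_cast
          rw [this]
          ring

/-! ### Maximal inequality by dyadic chaining -/

/-- Dyadic chaining: if the increments over the dyadic intervals of length `2 ^ j` in `[0, 2 ^ k]`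
are at most `M ρ ^ (j - k)`, then so is, up to a geometric series, the whole sequence. -/
lemma abs_le_of_dyadic_increments {ρ M : ℝ} (hρ : 0 < ρ) (k : ℕ) : ∀ (X : ℕ → ℝ), X 0 = 0 →
    (∀ j ≤ k, ∀ i < 2 ^ (k - j), ρ ^ (k - j) * |X ((i + 1) * 2 ^ j) - X (i * 2 ^ j)| ≤ M) →
    ∀ n ≤ 2 ^ k, |X n| ≤ M * ∑ l ∈ Finset.range (k + 1), ρ⁻¹ ^ l := by
  induction k with
  | zero =>
    intro X h0 h n hn
    have h1 := h 0 le_rfl 0 (by simp)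
    have : n = 0 ∨ n = 1 := by simp at hn; omega
    simp [h0] at h1 ⊢
    rcases this with rfl | rfl
    · rw [h0, abs_zero]; exact (abs_nonneg _).trans h1
    · exact h1
  | succ k ih =>
    intro X h0 h n hn
    have hM : 0 ≤ M := le_trans (by positivity) (h 0 (by omega) 0 (by positivity))
    have hX' := ih (fun i => X (2 * i)) (by simpa using h0) (fun j hj i hi => by
      have := h (j + 1) (by omega) i (by simpa using hi)
      have e : k + 1 - (j + 1) = k - j := by omega
      rw [e] at this
      convert this using 5 <;> ring)
    rw [Finset.sum_range_succ, mul_add]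
    rcases Nat.even_or_odd' n with ⟨i, rfl | rfl⟩
    · have := hX' i (by rw [pow_succ] at hn; omega)
      exact this.trans (le_add_of_nonneg_right (by positivity))
    · have h1 := hX' i (by rw [pow_succ] at hn; omega)
      have h2 := h 0 (by omega) (2 * i) (by rw [pow_succ] at *; simp; rw [pow_succ]; omega)
      simp only [Nat.sub_zero, pow_zero, mul_one] at h2
      have h3 : |X (2 * i + 1) - X (2 * i)| ≤ M * ρ⁻¹ ^ (k + 1) := by
        rw [inv_pow, ← div_eq_mul_inv, le_div_iff₀ (by positivity)]
        linarith
      have h4 : |X (2 * i + 1)| ≤ |X (2 * i)| + |X (2 * i + 1) - X (2 * i)| := by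
        have := abs_add_le (X (2 * i)) (X (2 * i + 1) - X (2 * i))
        simpa using this
      linarith

lemma sum_range_pow_le {x : ℝ} (hx0 : 0 ≤ x) (hx1 : x < 1) (n : ℕ) :
    ∑ l ∈ Finset.range n, x ^ l ≤ (1 - x)⁻¹ := by
  have h := mul_neg_geom_sum x n
  have h1 : 0 < 1 - x := by linarith
  rw [← mul_le_mul_iff_right₀ h1, h, mul_inv_cancel₀ h1.ne']
  linarith [pow_nonneg hx0 n]

/-- The constant in the maximal inequality. -/
def chainConst (p : ℕ) : ℝ := 32 * (p + 1) ^ p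

lemma chainConst_nonneg (p : ℕ) : 0 ≤ chainConst p := by unfold chainConst; positivity

/-- A sequence of random variables whose increments over `[m, n]` have `p`-th moment at most
`B ((n - m) / N) ^ 3` has a maximum over `[0, N]` with `p`-th moment at most a multiple of `B`. The
exponent `3 > 1` makes the sum over the dyadic levels converge. -/
theorem exists_integrable_envelope {S : Type*} {mS : MeasurableSpace S} {P : Measure S}
    [IsProbabilityMeasure P] {p N : ℕ} (hp : p ≠ 0) (hN : 1 ≤ N) {X : ℕ → S → ℝ} {B : ℝ}
    (hX : ∀ n ≤ N, HasMoments P (X n)) (h0 : ∀ s, X 0 s = 0) (hB : 0 ≤ B)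
    (hinc : ∀ m n, m ≤ n → n ≤ N →
      ∫ s, |X n s - X m s| ^ p ∂P ≤ B * (((n : ℝ) - m) / N) ^ 3) :
    ∃ Q : S → ℝ, Integrable Q P ∧ (∀ s, ∀ n ≤ N, |X n s| ^ p ≤ Q s) ∧
      ∫ s, Q s ∂P ≤ chainConst p * B := by
  have hN0 : (0 : ℝ) < N := by exact_mod_cast hN
  have hp0 : (0 : ℝ) < p := by exact_mod_cast Nat.pos_of_ne_zero hp
  set k := Nat.clog 2 N with hk
  have hk1 : N ≤ 2 ^ k := Nat.le_pow_clog (by norm_num) N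
  have hk2 : 2 ^ k ≤ 2 * N := by
    rcases Nat.lt_or_ge 1 N with h | h
    · have h1 := Nat.pow_pred_clog_lt_self (b := 2) (by norm_num) h
      have h2 : 0 < Nat.clog 2 N := Nat.clog_pos (by norm_num) h
      rw [← hk] at h1 h2
      obtain ⟨l, hl⟩ := Nat.exists_eq_succ_of_ne_zero h2.ne'
      rw [hl] at h1 ⊢
      simp only [Nat.pred_succ] at h1
      rw [Nat.pow_succ]
      omega
    · have : N = 1 := by omega
      rw [hk, this]
      simp
  -- The sequence is stopped at `N`, so that it is defined on the dyadic grid of `[0, 2 ^ k]`.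
  set Y : ℕ → S → ℝ := fun n => X (min n N) with hY
  have hYm : ∀ n, HasMoments P (Y n) := fun n => hX _ (min_le_right _ _)
  have hYinc : ∀ m n, m ≤ n → ∫ s, |Y n s - Y m s| ^ p ∂P ≤ B * (((n : ℝ) - m) / N) ^ 3 := by
    intro m n hmn
    refine (hinc _ _ (by omega) (min_le_right _ _)).trans ?_
    have h1 : ((min n N : ℕ) : ℝ) - (min m N : ℕ) ≤ (n : ℝ) - m := by
      have : min n N + m ≤ n + min m N := by omega
      have : ((min n N + m : ℕ) : ℝ) ≤ (n + min m N : ℕ) := by exact_mod_cast this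
      push_cast at this ⊢
      linarith
    have h2 : (0 : ℝ) ≤ ((min n N : ℕ) : ℝ) - (min m N : ℕ) := by
      rw [sub_nonneg]
      exact_mod_cast (by omega : min m N ≤ min n N)
    gcongr
  -- The ratio `ρ > 1` is so small that `ρ ^ p < 3 < 4`.
  set ρ : ℝ := 1 + 1 / p with hρ
  have hρ0 : 0 < ρ := by positivity
  have hρp : ρ ^ p ≤ 3 := by
    calc ρ ^ p ≤ (Real.exp (1 / p)) ^ p := by
          gcongr
          linarith [Real.add_one_le_exp (1 / (p : ℝ))]
      _ = Real.exp 1 := by rw [← Real.exp_nat_mul]; congr 1; field_simp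
      _ ≤ 3 := by linarith [Real.exp_one_lt_d9]
  set F : ℕ → ℕ → S → ℝ := fun j i s =>
    (ρ ^ p) ^ (k - j) * |Y ((i + 1) * 2 ^ j) s - Y (i * 2 ^ j) s| ^ p with hF
  have hF0 : ∀ j i s, 0 ≤ F j i s := fun j i s => by positivity
  have hFi : ∀ j i, Integrable (F j i) P := fun j i =>
    (((hYm _).sub (hYm _)).integrable_pow p).const_mul _
  set G : S → ℝ := fun s => ∑ j ∈ Finset.range (k + 1), ∑ i ∈ Finset.range (2 ^ (k - j)), F j i s
    with hG
  have hG0 : ∀ s, 0 ≤ G s := fun s =>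
    Finset.sum_nonneg fun j _ => Finset.sum_nonneg fun i _ => hF0 j i s
  have hGi : Integrable G P :=
    integrable_finsetSum _ fun j _ => integrable_finsetSum _ fun i _ => hFi j i
  refine ⟨fun s => (p + 1) ^ p * G s, hGi.const_mul _, fun s n hn => ?_, ?_⟩
  · set M : ℝ := G s ^ ((p : ℝ)⁻¹) with hM
    have hM0 : 0 ≤ M := Real.rpow_nonneg (hG0 s) _
    have hMp : M ^ p = G s := Real.rpow_inv_natCast_pow (hG0 s) hp
    have h1 := abs_le_of_dyadic_increments (M := M) hρ0 k (fun n => Y n s) (by simp [hY, h0])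
      (fun j hj i hi => by
        refine le_of_pow_le_pow_left₀ hp hM0 ?_
        rw [hMp, mul_pow, ← pow_mul, mul_comm (k - j) p, pow_mul]
        calc F j i s ≤ ∑ i ∈ Finset.range (2 ^ (k - j)), F j i s :=
              Finset.single_le_sum (f := fun i => F j i s) (fun i _ => hF0 j i s)
                (Finset.mem_range.2 hi)
          _ ≤ G s := Finset.single_le_sum
                (f := fun j => ∑ i ∈ Finset.range (2 ^ (k - j)), F j i s)
                (fun j _ => Finset.sum_nonneg fun i _ => hF0 j i s)
                (Finset.mem_range.2 (by omega))) n (hn.trans hk1)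
    have h2 : ∑ l ∈ Finset.range (k + 1), ρ⁻¹ ^ l ≤ p + 1 := by
      refine (sum_range_pow_le (by positivity) (inv_lt_one_of_one_lt₀ ?_) _).trans (le_of_eq ?_)
      · rw [hρ]; linarith [show (0 : ℝ) < 1 / p by positivity]
      · rw [hρ]; field_simp; ring
    have h3 : |X n s| ≤ M * (p + 1) := by
      have : Y n s = X n s := by simp [hY, min_eq_left hn]
      rw [← this]
      exact h1.trans (by gcongr)
    calc |X n s| ^ p ≤ (M * (p + 1)) ^ p := by gcongr
      _ = (p + 1) ^ p * G s := by rw [mul_pow, hMp, mul_comm]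
  · have hterm : ∀ j ∈ Finset.range (k + 1), ∑ i ∈ Finset.range (2 ^ (k - j)), ∫ s, F j i s ∂P
        ≤ 8 * B * (3 / 4) ^ (k - j) := by
      intro j hj
      have hj : j ≤ k := by simp at hj; omega
      have hb : ∀ i ∈ Finset.range (2 ^ (k - j)), ∫ s, F j i s ∂P
          ≤ 3 ^ (k - j) * (B * (2 * (1 / 2) ^ (k - j)) ^ 3) := by
        intro i _
        rw [hF, integral_const_mul]
        have h1 := hYinc (i * 2 ^ j) ((i + 1) * 2 ^ j) (by gcongr; omega)
        have h2 : (((i + 1) * 2 ^ j : ℕ) : ℝ) - (i * 2 ^ j : ℕ) = 2 ^ j := by push_cast; ring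
        rw [h2] at h1
        have h3 : (2 : ℝ) ^ j / N ≤ 2 * (1 / 2) ^ (k - j) := by
          rw [div_le_iff₀ hN0, one_div, inv_pow]
          have h4 : (2 : ℝ) ^ j * 2 ^ (k - j) ≤ 2 * N := by
            rw [← pow_add, Nat.add_sub_cancel' hj]
            exact_mod_cast hk2
          have h5 : (0 : ℝ) < 2 ^ (k - j) := by positivity
          calc (2 : ℝ) ^ j = 2 ^ j * 2 ^ (k - j) * (2 ^ (k - j))⁻¹ := by field_simp
            _ ≤ 2 * N * (2 ^ (k - j))⁻¹ := by gcongr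
            _ = _ := by ring
        have h6 : (0 : ℝ) ≤ ∫ s, |Y ((i + 1) * 2 ^ j) s - Y (i * 2 ^ j) s| ^ p ∂P :=
          integral_nonneg fun s => by positivity
        gcongr
        exact h1.trans (by gcongr)
      refine (Finset.sum_le_card_nsmul _ _ _ hb).trans (le_of_eq ?_)
      rw [Finset.card_range, nsmul_eq_mul]
      push_cast
      have e : ((3 : ℝ) / 4) ^ (k - j)
          = 2 ^ (k - j) * (3 ^ (k - j) * ((1 / 2) ^ (k - j)) ^ 3) := by
        rw [← pow_mul, mul_comm (k - j) 3, pow_mul, ← mul_pow, ← mul_pow]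
        norm_num
      rw [e]
      ring
    rw [integral_const_mul, hG, integral_finsetSum _ fun j _ =>
      integrable_finsetSum _ fun i _ => hFi j i]
    simp_rw [integral_finsetSum _ fun i _ => hFi _ i]
    have hsum : ∑ j ∈ Finset.range (k + 1), ∑ i ∈ Finset.range (2 ^ (k - j)), ∫ s, F j i s ∂P
        ≤ 32 * B := by
      refine (Finset.sum_le_sum hterm).trans ?_
      rw [← Finset.mul_sum]
      have h1 := Finset.sum_range_reflect (fun j => ((3 : ℝ) / 4) ^ j) (k + 1)
      simp only [Nat.add_sub_cancel] at h1
      rw [h1]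
      have h2 := sum_range_pow_le (x := 3 / 4) (by norm_num) (by norm_num) (k + 1)
      calc 8 * B * _ ≤ 8 * B * (1 - 3 / 4)⁻¹ := by gcongr
        _ = 32 * B := by norm_num; ring
    calc _ ≤ ((p : ℝ) + 1) ^ p * (32 * B) := by gcongr
      _ = chainConst p * B := by unfold chainConst; ring

/-! ### Functions with bounded partial derivatives -/

section Calculus

variable {d : ℕ} {φ : EuclideanSpace ℝ (Fin d) → ℝ} {L : ℝ}

lemma euclidean_eq_sum (v : EuclideanSpace ℝ (Fin d)) :
    v = ∑ l, v l • EuclideanSpace.single l (1 : ℝ) := by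
  ext i
  simp [Finset.sum_apply, Pi.single_apply]

lemma norm_le_sum_abs (v : EuclideanSpace ℝ (Fin d)) : ‖v‖ ≤ ∑ l, |v l| := by
  calc ‖v‖ = ‖∑ l, v l • EuclideanSpace.single l (1 : ℝ)‖ := by rw [← euclidean_eq_sum]
    _ ≤ ∑ l, ‖v l • EuclideanSpace.single l (1 : ℝ)‖ := norm_sum_le _ _
    _ = ∑ l, |v l| := by simp [norm_smul]

lemma abs_apply_le_norm (v : EuclideanSpace ℝ (Fin d)) (l : Fin d) : |v l| ≤ ‖v‖ :=
  PiLp.norm_apply_le v l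

lemma clm_apply_eq_sum (A : EuclideanSpace ℝ (Fin d) →L[ℝ] ℝ) (v : EuclideanSpace ℝ (Fin d)) :
    A v = ∑ l, A (EuclideanSpace.single l 1) * v l := by
  conv_lhs => rw [euclidean_eq_sum v]
  simp [mul_comm]

lemma clm_norm_le (A : EuclideanSpace ℝ (Fin d) →L[ℝ] ℝ) (hL : 0 ≤ L)
    (h : ∀ l, |A (EuclideanSpace.single l 1)| ≤ L) : ‖A‖ ≤ d * L := by
  refine A.opNorm_le_bound (by positivity) fun v => ?_
  rw [clm_apply_eq_sum, Real.norm_eq_abs]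
  calc |∑ l, A (EuclideanSpace.single l 1) * v l|
      ≤ ∑ l, |A (EuclideanSpace.single l 1) * v l| := Finset.abs_sum_le_sum_abs _ _
    _ ≤ ∑ _l : Fin d, L * ‖v‖ := by
        refine Finset.sum_le_sum fun l _ => ?_
        rw [abs_mul]
        exact mul_le_mul (h l) (abs_apply_le_norm v l) (abs_nonneg _) hL
    _ = d * L * ‖v‖ := by simp; ring

lemma abs_sub_le_of_partialDeriv (hφ : Differentiable ℝ φ) (hL : 0 ≤ L)
    (h : ∀ l x, |partialDeriv l φ x| ≤ L) (x y : EuclideanSpace ℝ (Fin d)) :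
    |φ x - φ y| ≤ d * L * ‖x - y‖ := by
  have := convex_univ.norm_image_sub_le_of_norm_fderiv_le (f := φ) (𝕜 := ℝ) (C := d * L)
    (fun z _ => hφ z) (fun z _ => clm_norm_le _ hL fun l => h l z) (Set.mem_univ y)
    (Set.mem_univ x)
  simpa using this

lemma norm_fderiv_sub_le (hφ : ContDiff ℝ 2 φ) (hL : 0 ≤ L)
    (h : ∀ k l x, |partialDeriv k (partialDeriv l φ) x| ≤ L) (x y : EuclideanSpace ℝ (Fin d)) :
    ‖fderiv ℝ φ x - fderiv ℝ φ y‖ ≤ d ^ 2 * L * ‖x - y‖ := by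
  have hd : Differentiable ℝ (fderiv ℝ φ) :=
    (hφ.fderiv_right (m := 1) (by norm_num)).differentiable (by norm_num)
  have h1 := clm_norm_le (fderiv ℝ φ x - fderiv ℝ φ y) (L := d * L * ‖x - y‖) (by positivity)
    fun l => by
      have := abs_sub_le_of_partialDeriv (φ := partialDeriv l φ) ?_ hL (fun k => h k l) x y
      · simpa [partialDeriv] using this
      · exact hd.clm_apply (differentiable_const _)
  calc _ ≤ _ := h1
    _ = _ := by ring

lemma abs_taylor_remainder_le (hφ : ContDiff ℝ 2 φ) (hL : 0 ≤ L)
    (h : ∀ k l x, |partialDeriv k (partialDeriv l φ) x| ≤ L) (x y : EuclideanSpace ℝ (Fin d)) :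
    |φ y - φ x - ∑ l, partialDeriv l φ x * (y l - x l)| ≤ d ^ 2 * L * ‖y - x‖ ^ 2 := by
  have h1 := (convex_segment x y).norm_image_sub_le_of_norm_hasFDerivWithin_le (𝕜 := ℝ)
    (f := fun z => φ z - fderiv ℝ φ x z) (f' := fun z => fderiv ℝ φ z - fderiv ℝ φ x)
    (C := d ^ 2 * L * ‖y - x‖) (fun z _ => (((hφ.differentiable (by norm_num)) z).hasFDerivAt.sub
      (fderiv ℝ φ x).hasFDerivAt).hasFDerivWithinAt) (fun z hz => by
        refine (norm_fderiv_sub_le hφ hL h z x).trans ?_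
        have : ‖z - x‖ ≤ ‖y - x‖ := by
          obtain ⟨t, ⟨ht0, ht1⟩, rfl⟩ := (segment_eq_image' ℝ x y).subset hz
          rw [add_sub_cancel_left, norm_smul, Real.norm_of_nonneg ht0]
          exact mul_le_of_le_one_left (norm_nonneg _) ht1
        gcongr) (left_mem_segment ℝ x y) (right_mem_segment ℝ x y)
  have e : φ y - φ x - ∑ l, partialDeriv l φ x * (y l - x l)
      = φ y - fderiv ℝ φ x y - (φ x - fderiv ℝ φ x x) := by
    have := clm_apply_eq_sum (fderiv ℝ φ x) (y - x)
    rw [map_sub] at this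
    simp only [PiLp.sub_apply] at this
    unfold partialDeriv
    linarith
  rw [e]
  calc _ ≤ _ := h1
    _ = _ := by ring

/-- The error of averaging at two points, which is quadratic in their distance. -/
lemma abs_midpoint_error_le (hφ : ContDiff ℝ 2 φ) (hL : 0 ≤ L)
    (h : ∀ k l x, |partialDeriv k (partialDeriv l φ) x| ≤ L) (x y : EuclideanSpace ℝ (Fin d)) :
    |(φ x + φ y) / 2 - φ ((1 / 2 : ℝ) • (x + y))| ≤ d ^ 2 * L * ‖x - y‖ ^ 2 := by
  set z := (1 / 2 : ℝ) • (x + y) with hz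
  have h1 := abs_taylor_remainder_le hφ hL h z x
  have h2 := abs_taylor_remainder_le hφ hL h z y
  have e1 : x - z = (1 / 2 : ℝ) • (x - y) := by rw [hz]; module
  have e2 : y - z = -((1 / 2 : ℝ) • (x - y)) := by rw [hz]; module
  have n1 : ‖x - z‖ = 1 / 2 * ‖x - y‖ := by rw [e1, norm_smul]; norm_num
  have n2 : ‖y - z‖ = 1 / 2 * ‖x - y‖ := by rw [e2, norm_neg, norm_smul]; norm_num
  have hs : ∑ l, partialDeriv l φ z * (y l - z l) = - ∑ l, partialDeriv l φ z * (x l - z l) := by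
    rw [← Finset.sum_neg_distrib]
    refine Finset.sum_congr rfl fun l _ => ?_
    have : y l - z l = -(x l - z l) := by simp [hz]; ring
    rw [this]; ring
  rw [n1] at h1
  rw [n2, hs] at h2
  rw [abs_le] at h1 h2 ⊢
  have h0 : 0 ≤ d ^ 2 * L * ‖x - y‖ ^ 2 := by positivity
  constructor <;> nlinarith

end Calculus

/-- The one-step moment inequality with time step `1 / J`, for a drift increment `U` and a
fluctuation increment `V`. -/
lemma integral_abs_add_add_pow_le {S : Type*} {m mS : MeasurableSpace S} {P : Measure S}
    [IsProbabilityMeasure P] {Z U V : S → ℝ} {p J : ℕ} (hp : Even p) (hp0 : p ≠ 0) (hJ : 1 ≤ J)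
    (hZ : HasMoments P Z) (hZm : Measurable[m] Z) (hU : HasMoments P U) (hV : Centered m P V) :
    ∫ s, |Z s + U s + V s| ^ p ∂P ≤ ∫ s, |Z s| ^ p ∂P
      + stepConst (p - 1) * (1 / J) * (∫ s, |Z s| ^ p ∂P + (J : ℝ) ^ p * ∫ s, |U s| ^ p ∂P
        + √J ^ p * ∫ s, |V s| ^ p ∂P) := by
  have hJ1 : (1 : ℝ) ≤ J := by exact_mod_cast hJ
  have hJ0 : (0 : ℝ) < J := by linarith
  have hs0 : 0 < √(J : ℝ) := Real.sqrt_pos.2 hJ0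
  have hsq : √(J : ℝ) ^ 2 = J := Real.sq_sqrt hJ0.le
  have h := integral_add_pow_step_le (t := 1 / √J) (by positivity)
    (by rw [div_le_one hs0]; exact Real.one_le_sqrt.2 hJ1) hp hp0 hZ hZm (hU.const_mul (J : ℝ))
    (hV.const_mul √J)
  have e : (1 / √(J : ℝ)) ^ 2 = 1 / J := by rw [div_pow, hsq, one_pow]
  rw [e] at h
  have e1 : ∀ s, Z s + 1 / (J : ℝ) * (J * U s) + 1 / √J * (√J * V s) = Z s + U s + V s := by
    intro s; field_simp
  have e2 : ∀ s, |(J : ℝ) * U s| ^ p = (J : ℝ) ^ p * |U s| ^ p := fun s => by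
    rw [abs_mul, mul_pow, abs_of_pos hJ0]
  have e3 : ∀ s, |√(J : ℝ) * V s| ^ p = √J ^ p * |V s| ^ p := fun s => by
    rw [abs_mul, mul_pow, abs_of_pos hs0]
  simp only [e1, e2, e3, integral_const_mul] at h
  exact h

/-- Burkholder-type bound: the sum of `J` drift increments and `J` centred increments. -/
lemma integral_abs_sum_pow_le {S : Type*} {mS : MeasurableSpace S} {P : Measure S}
    [IsProbabilityMeasure P] (𝒢 : ℕ → MeasurableSpace S) {W U V : ℕ → S → ℝ} {p J : ℕ}
    (hp : Even p) (hp0 : p ≠ 0) (hJ : 1 ≤ J) {α β : ℝ} (hα : 0 ≤ α) (hβ : 0 ≤ β)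
    (hW : ∀ k < J, HasMoments P (W k)) (hWm : ∀ k < J, Measurable[𝒢 k] (W k))
    (hW0 : ∀ s, W 0 s = 0) (hstep : ∀ k < J, ∀ s, W (k + 1) s = W k s + U k s + V k s)
    (hU : ∀ k < J, HasMoments P (U k)) (hV : ∀ k < J, Centered (𝒢 k) P (V k))
    (hUα : ∀ k < J, ∫ s, |U k s| ^ p ∂P ≤ α) (hVβ : ∀ k < J, ∫ s, |V k s| ^ p ∂P ≤ β) :
    ∫ s, |W J s| ^ p ∂P
      ≤ Real.exp (stepConst (p - 1)) * stepConst (p - 1) * ((J : ℝ) ^ p * α + √J ^ p * β) := by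
  have hc := stepConst_nonneg (p - 1)
  have hJ0 : (0 : ℝ) < J := by exact_mod_cast hJ
  have h := discrete_gronwall_of_le (e := fun k => ∫ s, |W k s| ^ p ∂P) (κ := stepConst (p - 1))
    (ε := 1 / J) (B := stepConst (p - 1) * ((J : ℝ) ^ p * α + √J ^ p * β)) (N := J) hc
    (by positivity) (by positivity) (integral_nonneg fun s => by positivity) (fun k hk => by
      simp only [hstep k hk]
      refine (integral_abs_add_add_pow_le hp hp0 hJ (hW k hk) (hWm k hk) (hU k hk)
        (hV k hk)).trans ?_
      calc _ ≤ ∫ s, |W k s| ^ p ∂P + stepConst (p - 1) * (1 / J) * (∫ s, |W k s| ^ p ∂P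
            + (J : ℝ) ^ p * α + √J ^ p * β) := by
            gcongr
            · exact hUα k hk
            · exact hVβ k hk
        _ = _ := by ring) J le_rfl
  simp only [hW0, abs_zero, zero_pow hp0, integral_zero, zero_add] at h
  refine h.trans (le_of_eq ?_)
  have e : stepConst (p - 1) * (1 / J) * J = stepConst (p - 1) := by field_simp
  have e' : (J : ℝ) * (1 / J) = 1 := by field_simp
  rw [e, e']
  ring

/-! ### The discrete-time model -/

/-- The `q`-th absolute moment of the standard normal law. -/
def normalMoment (q : ℕ) : ℝ := ∫ x, |x| ^ q ∂(gaussianReal 0 1)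

/-- What the argument needs to know about the SDE and its driving noise, in discrete time: the
`n`-th of `N` coarse steps of size `h` is driven by the increments `a n` and `b n` over its two
halves, and `𝒢 n` is the information at its beginning. The structure is invariant under exchanging
`a` and `b`. It is bundled in order to express bounds that are uniform over all the data:
quantification over `Model d D T L R` leaves only the parameters `d D T L R` fixed. -/
structure Model (d D : ℕ) (T L R : ℝ) : Type (u + 1) where
  f : EuclideanSpace ℝ (Fin d) → EuclideanSpace ℝ (Fin d)
  g : EuclideanSpace ℝ (Fin d) → Matrix (Fin d) (Fin D) ℝ
  x₀ : EuclideanSpace ℝ (Fin d)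
  C : Matrix (Fin D) (Fin D) ℝ
  L_nonneg : 0 ≤ L
  R_nonneg : 0 ≤ R
  bounded : BoundedDerivatives L f g
  norm_x₀ : ‖x₀‖ ≤ R
  norm_f : ‖f 0‖ ≤ R
  abs_g : ∀ i j, |g 0 i j| ≤ R
  abs_C : ∀ j k, |C j k| ≤ 1
  S : Type u
  [mS : MeasurableSpace S]
  P : Measure S
  [prob : IsProbabilityMeasure P]
  𝒢 : ℕ → MeasurableSpace S
  𝒢_le : ∀ n, 𝒢 n ≤ mS
  𝒢_succ : ∀ n, 𝒢 n ≤ 𝒢 (n + 1)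
  N : ℕ
  one_le_N : 1 ≤ N
  h : ℝ
  h_pos : 0 < h
  N_mul_h : N * h = T
  a : ℕ → S → EuclideanSpace ℝ (Fin D)
  b : ℕ → S → EuclideanSpace ℝ (Fin D)
  measurable_a : ∀ n, Measurable[𝒢 (n + 1)] (a n)
  measurable_b : ∀ n, Measurable[𝒢 (n + 1)] (b n)
  indep_a : ∀ n, Indep (MeasurableSpace.comap (a n) inferInstance)
    (𝒢 n ⊔ MeasurableSpace.comap (b n) inferInstance) P
  indep_b : ∀ n, Indep (MeasurableSpace.comap (b n) inferInstance)
    (𝒢 n ⊔ MeasurableSpace.comap (a n) inferInstance) P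
  indep_ab : ∀ n, Indep (MeasurableSpace.comap (a n) inferInstance ⊔
    MeasurableSpace.comap (b n) inferInstance) (𝒢 n) P
  moments_a : ∀ n j, HasMoments P (fun s => a n s j)
  moments_b : ∀ n j, HasMoments P (fun s => b n s j)
  moment_a_le : ∀ n j q, ∫ s, |a n s j| ^ q ∂P ≤ normalMoment q * √h ^ q
  moment_b_le : ∀ n j q, ∫ s, |b n s j| ^ q ∂P ≤ normalMoment q * √h ^ q
  mean_a : ∀ n j, ∫ s, a n s j ∂P = 0
  mean_b : ∀ n j, ∫ s, b n s j ∂P = 0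
  cov_a : ∀ n j k, ∫ s, a n s j * a n s k ∂P = C j k * (h / 2)
  cov_b : ∀ n j k, ∫ s, b n s j * b n s k ∂P = C j k * (h / 2)

attribute [instance] Model.mS Model.prob

namespace Model

variable {d D : ℕ} {T L R : ℝ}

/-- The square root of the time step, the size of a Brownian increment. -/
def r (M : Model.{u} d D T L R) : ℝ := √M.h

lemma r_pos (M : Model.{u} d D T L R) : 0 < M.r := Real.sqrt_pos.2 M.h_pos

lemma r_sq (M : Model.{u} d D T L R) : M.r ^ 2 = M.h := Real.sq_sqrt M.h_pos.le

lemma N_pos (M : Model.{u} d D T L R) : (0 : ℝ) < M.N := by exact_mod_cast M.one_le_N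

lemma T_nonneg (M : Model.{u} d D T L R) : 0 ≤ T := by
  rw [← M.N_mul_h]; exact mul_nonneg M.N_pos.le M.h_pos.le

lemma h_le (M : Model.{u} d D T L R) : M.h ≤ T := by
  calc M.h ≤ M.N * M.h := le_mul_of_one_le_left M.h_pos.le (by exact_mod_cast M.one_le_N)
    _ = T := M.N_mul_h

lemma r_le (M : Model.{u} d D T L R) : M.r ≤ √T := Real.sqrt_le_sqrt M.h_le

lemma N_mul_r_sq (M : Model.{u} d D T L R) : M.N * M.r ^ 2 = T := by rw [M.r_sq, M.N_mul_h]

lemma sqrt_N_mul_r (M : Model.{u} d D T L R) : √M.N * M.r = √T := by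
  rw [r, ← Real.sqrt_mul M.N_pos.le, M.N_mul_h]

lemma comap_a_le (M : Model.{u} d D T L R) (n : ℕ) :
    MeasurableSpace.comap (M.a n) inferInstance ≤ M.mS :=
  ((M.measurable_a n).mono (M.𝒢_le _) le_rfl).comap_le

lemma 𝒢_mono (M : Model.{u} d D T L R) : Monotone M.𝒢 := monotone_nat_of_le_succ M.𝒢_succ

/-- The model in which the increments over the two halves of every coarse step are exchanged. -/
def swap (M : Model.{u} d D T L R) : Model.{u} d D T L R :=
  { M with
    a := M.b
    b := M.a
    measurable_a := M.measurable_b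
    measurable_b := M.measurable_a
    indep_a := M.indep_b
    indep_b := M.indep_a
    indep_ab := fun n => by rw [sup_comm]; exact M.indep_ab n
    moments_a := M.moments_b
    moments_b := M.moments_a
    moment_a_le := M.moment_b_le
    moment_b_le := M.moment_a_le
    mean_a := M.mean_b
    mean_b := M.mean_a
    cov_a := M.cov_b
    cov_b := M.cov_a }

end Model

/-! ### Uniform orders of magnitude -/

section Order

variable {d D : ℕ} {T L R : ℝ} {k l : ℕ} {Z W : ∀ M : Model.{u} d D T L R, ℕ → M.S → ℝ}

/-- `Z` is of order `r ^ k`, where `r = √h`: every `L^q` norm of `Z n` is at most a constant times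
`r ^ k`, with a constant that is the same for all models and all `n ≤ N`. -/
structure IsBigO (k : ℕ) (Z : ∀ M : Model.{u} d D T L R, ℕ → M.S → ℝ) : Prop where
  moments : ∀ M, ∀ n ≤ M.N, HasMoments M.P (Z M n)
  bound : ∀ q : ℕ, ∃ K : ℝ, 0 ≤ K ∧ ∀ M : Model.{u} d D T L R, ∀ n ≤ M.N,
    ∫ s, |Z M n s| ^ q ∂M.P ≤ K * (M.r ^ k) ^ q

namespace IsBigO

lemma of_le (hZ : ∀ M : Model.{u} d D T L R, ∀ n ≤ M.N, Measurable (Z M n)) (hW : IsBigO k W)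
    (c : ℝ) (h : ∀ (M : Model.{u} d D T L R) n s, n ≤ M.N → |Z M n s| ≤ c * |W M n s|) :
    IsBigO k Z := by
  have hc : ∀ (M : Model.{u} d D T L R) n s, n ≤ M.N → |Z M n s| ≤ |c * W M n s| :=
    fun M n s hn => (h M n s hn).trans (by rw [abs_mul]; gcongr; exact le_abs_self c)
  refine ⟨fun M n hn => .of_le (hZ M n hn) ((hW.moments M n hn).const_mul c)
    fun s => hc M n s hn, fun q => ?_⟩
  obtain ⟨K, hK, hb⟩ := hW.bound q
  refine ⟨|c| ^ q * K, by positivity, fun M n hn => ?_⟩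
  calc ∫ s, |Z M n s| ^ q ∂M.P ≤ ∫ s, |c| ^ q * |W M n s| ^ q ∂M.P := by
        refine integral_mono_of_nonneg (.of_forall fun s => by positivity)
          (((hW.moments M n hn).integrable_pow q).const_mul _) (.of_forall fun s => ?_)
        have := pow_le_pow_left₀ (abs_nonneg _) (hc M n s hn) q
        rwa [abs_mul, mul_pow] at this
    _ = |c| ^ q * ∫ s, |W M n s| ^ q ∂M.P := integral_const_mul _ _
    _ ≤ |c| ^ q * (K * (M.r ^ k) ^ q) := by gcongr; exact hb M n hn
    _ = _ := by ring

/-- A deterministic factor. -/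
lemma const (c : Model.{u} d D T L R → ℕ → ℝ) (K : ℝ)
    (hc : ∀ (M : Model.{u} d D T L R) n, n ≤ M.N → |c M n| ≤ K * M.r ^ k) :
    IsBigO k (fun M n (_ : M.S) => c M n) := by
  refine ⟨fun _ _ _ => .const _, fun q => ⟨|K| ^ q, by positivity, fun M n hn => ?_⟩⟩
  have hr := M.r_pos
  simp only [integral_const, probReal_univ, one_smul]
  rw [← mul_pow]
  gcongr
  exact (hc M n hn).trans (by gcongr; exact le_abs_self K)

lemma add (hZ : IsBigO k Z) (hW : IsBigO k W) : IsBigO k (fun M n s => Z M n s + W M n s) := by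
  refine ⟨fun M n hn => (hZ.moments M n hn).add (hW.moments M n hn), fun q => ?_⟩
  obtain ⟨K, hK, hb⟩ := hZ.bound q
  obtain ⟨K', hK', hb'⟩ := hW.bound q
  refine ⟨2 ^ q * (K + K'), by positivity, fun M n hn => ?_⟩
  have i1 := (hZ.moments M n hn).integrable_pow q
  have i2 := (hW.moments M n hn).integrable_pow q
  calc ∫ s, |Z M n s + W M n s| ^ q ∂M.P
      ≤ ∫ s, 2 ^ q * (|Z M n s| ^ q + |W M n s| ^ q) ∂M.P :=
        integral_mono_of_nonneg (.of_forall fun s => by positivity) ((i1.add i2).const_mul _)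
          (.of_forall fun s => abs_add_pow_le _ _ q)
    _ = 2 ^ q * (∫ s, |Z M n s| ^ q ∂M.P + ∫ s, |W M n s| ^ q ∂M.P) := by
        rw [integral_const_mul, integral_add i1 i2]
    _ ≤ 2 ^ q * (K * (M.r ^ k) ^ q + K' * (M.r ^ k) ^ q) := by
        gcongr
        · exact hb M n hn
        · exact hb' M n hn
    _ = _ := by ring

lemma mul (hZ : IsBigO k Z) (hW : IsBigO l W) :
    IsBigO (k + l) (fun M n s => Z M n s * W M n s) := by
  refine ⟨fun M n hn => (hZ.moments M n hn).mul (hW.moments M n hn), fun q => ?_⟩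
  obtain ⟨K, hK, hb⟩ := hZ.bound (2 * q)
  obtain ⟨K', hK', hb'⟩ := hW.bound (2 * q)
  refine ⟨K + K', by positivity, fun M n hn => ?_⟩
  have hr := M.r_pos
  have i1 := (hZ.moments M n hn).integrable_pow (2 * q)
  have i2 := (hW.moments M n hn).integrable_pow (2 * q)
  set x := (M.r ^ k) ^ q with hx
  set y := (M.r ^ l) ^ q with hy
  have hx0 : 0 < x := by positivity
  have hy0 : 0 < y := by positivity
  -- Both factors are normalised before Young's inequality is applied.
  have key : ∀ s, |Z M n s * W M n s| ^ q
      ≤ y / x * |Z M n s| ^ (2 * q) + x / y * |W M n s| ^ (2 * q) := fun s => by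
    rw [abs_mul, mul_pow, pow_mul', pow_mul']
    set A := |Z M n s| ^ q
    set B := |W M n s| ^ q
    have hA : 0 ≤ A := by positivity
    have hB : 0 ≤ B := by positivity
    have : y / x * A ^ 2 + x / y * B ^ 2 - A * B
        = ((y * A - x * B) ^ 2 + (y * A) * (x * B)) / (x * y) := by field_simp; ring
    have h2 : 0 ≤ ((y * A - x * B) ^ 2 + (y * A) * (x * B)) / (x * y) := by positivity
    linarith
  calc ∫ s, |Z M n s * W M n s| ^ q ∂M.P
      ≤ ∫ s, (y / x * |Z M n s| ^ (2 * q) + x / y * |W M n s| ^ (2 * q)) ∂M.P :=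
        integral_mono_of_nonneg (.of_forall fun s => by positivity)
          ((i1.const_mul _).add (i2.const_mul _)) (.of_forall key)
    _ = y / x * ∫ s, |Z M n s| ^ (2 * q) ∂M.P + x / y * ∫ s, |W M n s| ^ (2 * q) ∂M.P := by
        rw [integral_add (i1.const_mul _) (i2.const_mul _), integral_const_mul, integral_const_mul]
    _ ≤ y / x * (K * x ^ 2) + x / y * (K' * y ^ 2) := by
        have e1 := hb M n hn
        have e2 := hb' M n hn
        rw [pow_mul' (M.r ^ k), ← hx] at e1
        rw [pow_mul' (M.r ^ l), ← hy] at e2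
        gcongr
    _ = (K + K') * (M.r ^ (k + l)) ^ q := by
        rw [pow_add, mul_pow, ← hx, ← hy]; field_simp

lemma zero : IsBigO k (fun (M : Model.{u} d D T L R) (_ : ℕ) (_ : M.S) => (0 : ℝ)) :=
  const (fun _ _ => 0) 0 fun _ _ _ => by simp

lemma const_mul (c : ℝ) (hZ : IsBigO k Z) : IsBigO k (fun M n s => c * Z M n s) :=
  of_le (fun M n hn => (hZ.moments M n hn).measurable.const_mul c) hZ |c| fun M n s _ => by
    rw [abs_mul]

lemma neg (hZ : IsBigO k Z) : IsBigO k (fun M n s => - Z M n s) := by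
  simpa using hZ.const_mul (-1)

lemma sub (hZ : IsBigO k Z) (hW : IsBigO k W) : IsBigO k (fun M n s => Z M n s - W M n s) := by
  simpa only [sub_eq_add_neg] using hZ.add hW.neg

lemma abs (hZ : IsBigO k Z) : IsBigO k (fun M n s => |Z M n s|) :=
  of_le (fun M n hn => (hZ.moments M n hn).measurable.abs) hZ 1 fun M n s _ => by simp

lemma sum {ι : Type*} {t : Finset ι} {Z : ι → ∀ M : Model.{u} d D T L R, ℕ → M.S → ℝ}
    (hZ : ∀ i ∈ t, IsBigO k (Z i)) : IsBigO k (fun M n s => ∑ i ∈ t, Z i M n s) := by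
  classical
  induction t using Finset.induction_on with
  | empty => simpa using zero
  | insert i t hi ih =>
    simp only [Finset.sum_insert hi]
    exact (hZ i (by simp)).add (ih fun j hj => hZ j (by simp [hj]))

lemma step_pow (j : ℕ) :
    IsBigO j (fun (M : Model.{u} d D T L R) (_ : ℕ) (_ : M.S) => M.r ^ j) :=
  const (fun M _ => M.r ^ j) 1 fun M n _ => by rw [abs_of_pos (pow_pos M.r_pos j), one_mul]

lemma step : IsBigO 2 (fun (M : Model.{u} d D T L R) (_ : ℕ) (_ : M.S) => M.h) := by
  simpa only [Model.r_sq] using step_pow 2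

lemma weaken (hZ : IsBigO k Z) (hl : l ≤ k) : IsBigO l Z := by
  refine ⟨hZ.moments, fun q => ?_⟩
  obtain ⟨K, hK, hb⟩ := hZ.bound q
  refine ⟨K * (√T ^ (k - l)) ^ q, by positivity, fun M n hn => (hb M n hn).trans ?_⟩
  have hr := M.r_pos
  have : M.r ^ k ≤ √T ^ (k - l) * M.r ^ l := by
    calc M.r ^ k = M.r ^ (k - l) * M.r ^ l := by rw [← pow_add, Nat.sub_add_cancel hl]
      _ ≤ _ := by gcongr; exact M.r_le
  calc K * (M.r ^ k) ^ q ≤ K * (√T ^ (k - l) * M.r ^ l) ^ q := by gcongr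
    _ = _ := by ring

lemma swap (hZ : IsBigO k Z) : IsBigO k (fun M n (s : M.S) => Z M.swap n s) :=
  ⟨fun M n hn => hZ.moments M.swap n hn, fun q => by
    obtain ⟨K, hK, hb⟩ := hZ.bound q
    exact ⟨K, hK, fun M n hn => hb M.swap n hn⟩⟩

/-- Even moments suffice. -/
lemma of_even (hm : ∀ M : Model.{u} d D T L R, ∀ n ≤ M.N, HasMoments M.P (Z M n))
    (h : ∀ q : ℕ, ∃ K : ℝ, 0 ≤ K ∧ ∀ M : Model.{u} d D T L R, ∀ n ≤ M.N,
      ∫ s, |Z M n s| ^ (2 * (q + 1)) ∂M.P ≤ K * (M.r ^ k) ^ (2 * (q + 1))) : IsBigO k Z := by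
  refine ⟨hm, fun q => ?_⟩
  obtain ⟨K, hK, hb⟩ := h q
  refine ⟨1 + K, by positivity, fun M n hn => ?_⟩
  have hr : 0 < M.r ^ k := pow_pos M.r_pos k
  have i := (hm M n hn).integrable_pow (2 * (q + 1))
  set ρ := M.r ^ k
  have key : ∀ s, |Z M n s| ^ q ≤ ρ ^ q + ρ ^ q / ρ ^ (2 * (q + 1)) * |Z M n s| ^ (2 * (q + 1)) := by
    intro s
    have h1 : (|Z M n s| / ρ) ^ q ≤ 1 + (|Z M n s| / ρ) ^ (2 * (q + 1)) := by
      have h0 : 0 ≤ |Z M n s| / ρ := by positivity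
      rcases le_total (|Z M n s| / ρ) 1 with h | h
      · exact (pow_le_one₀ h0 h).trans (le_add_of_nonneg_right (by positivity))
      · exact (pow_le_pow_right₀ h (by omega)).trans (le_add_of_nonneg_left zero_le_one)
    rw [div_pow, div_pow, div_le_iff₀ (by positivity)] at h1
    refine h1.trans (le_of_eq ?_)
    ring
  calc ∫ s, |Z M n s| ^ q ∂M.P
      ≤ ∫ s, (ρ ^ q + ρ ^ q / ρ ^ (2 * (q + 1)) * |Z M n s| ^ (2 * (q + 1))) ∂M.P :=
        integral_mono_of_nonneg (.of_forall fun s => by positivity)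
          ((integrable_const _).add (i.const_mul _)) (.of_forall key)
    _ = ρ ^ q + ρ ^ q / ρ ^ (2 * (q + 1)) * ∫ s, |Z M n s| ^ (2 * (q + 1)) ∂M.P := by
        rw [integral_add (integrable_const _) (i.const_mul _), integral_const_mul]
        simp
    _ ≤ ρ ^ q + ρ ^ q / ρ ^ (2 * (q + 1)) * (K * ρ ^ (2 * (q + 1))) := by
        gcongr
        exact hb M n hn
    _ = (1 + K) * ρ ^ q := by field_simp

end IsBigO

end Order

/-! ### Stability of moments -/

section Stability

variable {d D : ℕ} {T L R : ℝ}

namespace Model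

lemma measurable_one_add_sum {S : Type*} {m : MeasurableSpace S}
    {a b : S → EuclideanSpace ℝ (Fin D)} (ha : Measurable a) (hb : Measurable b) (r : ℝ) :
    Measurable (fun s => 1 + ∑ j, (|a s j| + |b s j|) / r) := by
  have h : ∀ j : Fin D, Measurable (fun v : EuclideanSpace ℝ (Fin D) => v j) := fun j =>
    (EuclideanSpace.proj (𝕜 := ℝ) j).continuous.measurable
  exact measurable_const.add (Finset.measurable_fun_sum _ fun j _ =>
    (((h j).comp ha).abs.add ((h j).comp hb).abs).div_const _)

/-- The amplitude of the noise in the `n`-th coarse step in units of `r`, bounded below by `1`. -/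
def amp (M : Model.{u} d D T L R) (n : ℕ) (s : M.S) : ℝ :=
  1 + ∑ j, (|M.a n s j| + |M.b n s j|) / M.r

lemma one_le_amp (M : Model.{u} d D T L R) (n : ℕ) (s : M.S) : 1 ≤ M.amp n s := by
  have := M.r_pos
  exact le_add_of_nonneg_right (Finset.sum_nonneg fun j _ => by positivity)

lemma abs_add_abs_le (M : Model.{u} d D T L R) (n : ℕ) (s : M.S) (j : Fin D) :
    |M.a n s j| + |M.b n s j| ≤ M.r * M.amp n s := by
  have hr := M.r_pos
  have h := Finset.single_le_sum (f := fun j => (|M.a n s j| + |M.b n s j|) / M.r)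
    (fun j _ => by positivity) (Finset.mem_univ j)
  rw [div_le_iff₀ hr] at h
  unfold amp
  nlinarith

lemma abs_a_le (M : Model.{u} d D T L R) (n : ℕ) (s : M.S) (j : Fin D) :
    |M.a n s j| ≤ M.r * M.amp n s := by
  linarith [M.abs_add_abs_le n s j, abs_nonneg (M.b n s j)]

lemma abs_b_le (M : Model.{u} d D T L R) (n : ℕ) (s : M.S) (j : Fin D) :
    |M.b n s j| ≤ M.r * M.amp n s := by
  linarith [M.abs_add_abs_le n s j, abs_nonneg (M.a n s j)]

lemma measurable_amp (M : Model.{u} d D T L R) (n : ℕ) :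
    Measurable[MeasurableSpace.comap (M.a n) inferInstance ⊔
      MeasurableSpace.comap (M.b n) inferInstance] (M.amp n) :=
  measurable_one_add_sum ((comap_measurable _).mono le_sup_left le_rfl)
    ((comap_measurable _).mono le_sup_right le_rfl) M.r

lemma indepFun_amp (M : Model.{u} d D T L R) (n : ℕ) {Z : M.S → ℝ} (hZ : Measurable[M.𝒢 n] Z) :
    IndepFun (M.amp n) Z M.P := by
  rw [IndepFun_iff_Indep]
  exact indep_of_indep_of_le (M.indep_ab n) (M.measurable_amp n).comap_le hZ.comap_le

end Model

lemma isBigO_a (j : Fin D) : IsBigO 1 (fun (M : Model.{u} d D T L R) n s => M.a n s j) :=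
  ⟨fun M n _ => M.moments_a n j, fun q => ⟨normalMoment q,
    integral_nonneg fun s => by positivity, fun M n _ => by
      rw [pow_one]; exact M.moment_a_le n j q⟩⟩

lemma isBigO_b (j : Fin D) : IsBigO 1 (fun (M : Model.{u} d D T L R) n s => M.b n s j) :=
  (isBigO_a j).swap

lemma Model.moments_amp (M : Model.{u} d D T L R) (n : ℕ) : HasMoments M.P (M.amp n) := by
  refine (HasMoments.const 1).add (.sum fun j _ => ?_)
  simp only [div_eq_inv_mul]
  exact ((M.moments_a n j).abs.add (M.moments_b n j).abs).const_mul _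

lemma isBigO_amp : IsBigO 0 (fun (M : Model.{u} d D T L R) n s => M.amp n s) := by
  have h1 : IsBigO 0 (fun (M : Model.{u} d D T L R) _ (_ : M.S) => (1 : ℝ)) := by
    simpa using IsBigO.step_pow 0
  refine h1.add (.sum fun j _ => ?_)
  have h2 := (isBigO_a (d := d) (T := T) (L := L) (R := R) j).abs.add (isBigO_b.{u} j).abs
  refine ⟨fun M n hn => ?_, fun q => ?_⟩
  · simp only [div_eq_inv_mul]
    exact (h2.moments M n hn).const_mul _
  · obtain ⟨K, hK, hb⟩ := h2.bound q
    refine ⟨K, hK, fun M n hn => ?_⟩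
    have hr := M.r_pos
    have := hb M n hn
    simp only [abs_div, div_pow, integral_div, abs_of_pos hr]
    rw [div_le_iff₀ (by positivity)]
    simpa using this

lemma hasMoments_norm {S : Type*} {mS : MeasurableSpace S} {P : Measure S} [IsProbabilityMeasure P]
    {Z : S → EuclideanSpace ℝ (Fin d)} (hZ : Measurable Z)
    (h : ∀ i, HasMoments P (fun s => Z s i)) : HasMoments P (fun s => ‖Z s‖) :=
  .of_le hZ.norm (.sum fun i (_ : i ∈ Finset.univ) => (h i).abs) fun s => by
    rw [abs_of_nonneg (norm_nonneg _), abs_of_nonneg (Finset.sum_nonneg fun i _ => abs_nonneg _)]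
    exact norm_le_sum_abs _

lemma norm_pow_le (v : EuclideanSpace ℝ (Fin d)) {p : ℕ} (hp : p ≠ 0) :
    ‖v‖ ^ p ≤ ((d : ℝ) + 1) ^ (p - 1) * ∑ i, |v i| ^ p := by
  have h1 := sum_abs_pow_le Finset.univ (fun i => v i) (p - 1)
  rw [Nat.sub_add_cancel (by omega)] at h1
  refine (pow_le_pow_left₀ (norm_nonneg v) (norm_le_sum_abs v) p).trans (h1.trans (le_of_eq ?_))
  simp

/-- An adapted process with finite moments, for every model. -/
structure IsProcess (Z : ∀ M : Model.{u} d D T L R, ℕ → M.S → EuclideanSpace ℝ (Fin d)) :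
    Prop where
  adapted : ∀ M n, Measurable[M.𝒢 n] (Z M n)
  moments : ∀ M n i, HasMoments M.P (fun s => Z M n s i)

variable {Z : ∀ M : Model.{u} d D T L R, ℕ → M.S → EuclideanSpace ℝ (Fin d)}

lemma IsProcess.measurable (hZ : IsProcess Z) (M : Model.{u} d D T L R) (n : ℕ) :
    Measurable (Z M n) := (hZ.adapted M n).mono (M.𝒢_le n) le_rfl

lemma IsProcess.moments_norm (hZ : IsProcess Z) (M : Model.{u} d D T L R) (n : ℕ) :
    HasMoments M.P (fun s => ‖Z M n s‖) :=
  hasMoments_norm (hZ.measurable M n) (hZ.moments M n)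

/-- `U` is of order `r ^ l (‖Z‖ + r ^ k)` in every `L^q`, uniformly over all models and `n ≤ N`. -/
structure IsRelBigO (k l : ℕ)
    (Z : ∀ M : Model.{u} d D T L R, ℕ → M.S → EuclideanSpace ℝ (Fin d))
    (U : ∀ M : Model.{u} d D T L R, ℕ → M.S → ℝ) : Prop where
  moments : ∀ M, ∀ n ≤ M.N, HasMoments M.P (U M n)
  bound : ∀ q : ℕ, ∃ K : ℝ, 0 ≤ K ∧ ∀ M : Model.{u} d D T L R, ∀ n ≤ M.N,
    ∫ s, |U M n s| ^ q ∂M.P ≤ K * (M.r ^ l) ^ q * (∫ s, ‖Z M n s‖ ^ q ∂M.P + (M.r ^ k) ^ q)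

namespace IsRelBigO

variable {k l : ℕ} {U V : ∀ M : Model.{u} d D T L R, ℕ → M.S → ℝ}

lemma of_isBigO (hU : IsBigO (k + l) U) : IsRelBigO k l Z U := by
  refine ⟨hU.moments, fun q => ?_⟩
  obtain ⟨K, hK, hb⟩ := hU.bound q
  refine ⟨K, hK, fun M n hn => (hb M n hn).trans ?_⟩
  have hr := M.r_pos
  have : 0 ≤ ∫ s, ‖Z M n s‖ ^ q ∂M.P := integral_nonneg fun s => by positivity
  calc K * (M.r ^ (k + l)) ^ q = K * (M.r ^ l) ^ q * (M.r ^ k) ^ q := by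
        rw [add_comm, pow_add, mul_pow, mul_assoc]
    _ ≤ _ := by gcongr; linarith

lemma isBigO (hU : IsRelBigO k l Z U) (hZ : IsBigO k (fun M n s => ‖Z M n s‖)) :
    IsBigO (k + l) U := by
  refine ⟨hU.moments, fun q => ?_⟩
  obtain ⟨K, hK, hb⟩ := hU.bound q
  obtain ⟨K', hK', hb'⟩ := hZ.bound q
  refine ⟨K * (K' + 1), by positivity, fun M n hn => (hb M n hn).trans ?_⟩
  have hr := M.r_pos
  have h := hb' M n hn
  simp only [abs_norm] at h
  calc K * (M.r ^ l) ^ q * (∫ s, ‖Z M n s‖ ^ q ∂M.P + (M.r ^ k) ^ q)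
      ≤ K * (M.r ^ l) ^ q * (K' * (M.r ^ k) ^ q + (M.r ^ k) ^ q) := by gcongr
    _ = _ := by rw [add_comm k, pow_add, mul_pow]; ring

lemma add (hU : IsRelBigO k l Z U) (hV : IsRelBigO k l Z V) :
    IsRelBigO k l Z (fun M n s => U M n s + V M n s) := by
  refine ⟨fun M n hn => (hU.moments M n hn).add (hV.moments M n hn), fun q => ?_⟩
  obtain ⟨K, hK, hb⟩ := hU.bound q
  obtain ⟨K', hK', hb'⟩ := hV.bound q
  refine ⟨2 ^ q * (K + K'), by positivity, fun M n hn => ?_⟩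
  have i1 := (hU.moments M n hn).integrable_pow q
  have i2 := (hV.moments M n hn).integrable_pow q
  calc ∫ s, |U M n s + V M n s| ^ q ∂M.P
      ≤ ∫ s, 2 ^ q * (|U M n s| ^ q + |V M n s| ^ q) ∂M.P :=
        integral_mono_of_nonneg (.of_forall fun s => by positivity) ((i1.add i2).const_mul _)
          (.of_forall fun s => abs_add_pow_le _ _ q)
    _ = 2 ^ q * (∫ s, |U M n s| ^ q ∂M.P + ∫ s, |V M n s| ^ q ∂M.P) := by
        rw [integral_const_mul, integral_add i1 i2]
    _ ≤ 2 ^ q * (_ + _) := mul_le_mul_of_nonneg_left (add_le_add (hb M n hn) (hb' M n hn))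
        (by positivity)
    _ = _ := by ring

/-- The noise of the current step is independent of `Z`, so that no moments of `Z` are lost. -/
lemma of_le (hZ : IsProcess Z) (hU : ∀ M : Model.{u} d D T L R, ∀ n, Measurable (U M n)) (c : ℝ)
    (e : ℕ) (h : ∀ (M : Model.{u} d D T L R) n s,
      |U M n s| ≤ c * M.r ^ l * ((‖Z M n s‖ + M.r ^ k) * M.amp n s ^ e)) :
    IsRelBigO k l Z U := by
  have hB : ∀ (M : Model.{u} d D T L R) n,
      HasMoments M.P (fun s => (‖Z M n s‖ + M.r ^ k) * M.amp n s ^ e) := fun M n =>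
    ((hZ.moments_norm M n).add (.const _)).mul ((M.moments_amp n).pow e)
  have h' : ∀ (M : Model.{u} d D T L R) n s,
      |U M n s| ≤ |c| * M.r ^ l * ((‖Z M n s‖ + M.r ^ k) * M.amp n s ^ e) := fun M n s => by
    have hr := M.r_pos
    have ha := M.one_le_amp n s
    refine (h M n s).trans ?_
    gcongr
    exact le_abs_self c
  refine ⟨fun M n hn => .of_le (hU M n) ((hB M n).const_mul (|c| * M.r ^ l)) fun s =>
    (h' M n s).trans (le_abs_self _), fun q => ?_⟩
  obtain ⟨K, hK, hb⟩ := (isBigO_amp (d := d) (D := D) (T := T) (L := L) (R := R)).bound (e * q)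
  refine ⟨|c| ^ q * (2 ^ q * K), by positivity, fun M n hn => ?_⟩
  have hr := M.r_pos
  have hamp : ∫ s, (M.amp n s ^ e) ^ q ∂M.P ≤ K := by
    have := hb M n hn
    simp only [pow_zero, one_pow, mul_one] at this
    refine (le_of_eq ?_).trans this
    congr 1 with s
    rw [abs_of_nonneg (by linarith [M.one_le_amp n s]), pow_mul]
  have hind : IndepFun (fun s => (‖Z M n s‖ + M.r ^ k) ^ q) (fun s => (M.amp n s ^ e) ^ q) M.P := by
    have := (M.indepFun_amp n (Z := fun s => ‖Z M n s‖) (measurable_norm.comp (hZ.adapted M n))).symm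
    exact this.comp (φ := fun x => (x + M.r ^ k) ^ q) (ψ := fun x => (x ^ e) ^ q)
      (by fun_prop) (by fun_prop)
  have i1 : Integrable (fun s => ‖Z M n s‖ ^ q) M.P := by
    simpa using (hZ.moments_norm M n).integrable_pow q
  have hZ1 : ∫ s, (‖Z M n s‖ + M.r ^ k) ^ q ∂M.P
      ≤ 2 ^ q * (∫ s, ‖Z M n s‖ ^ q ∂M.P + (M.r ^ k) ^ q) := by
    calc _ ≤ ∫ s, 2 ^ q * (‖Z M n s‖ ^ q + (M.r ^ k) ^ q) ∂M.P := by
          refine integral_mono_of_nonneg (.of_forall fun s => by positivity)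
            ((i1.add (integrable_const _)).const_mul _) (.of_forall fun s => ?_)
          have := abs_add_pow_le (‖Z M n s‖) (M.r ^ k) q
          rwa [abs_norm, abs_of_pos (by positivity : 0 < M.r ^ k),
            abs_of_nonneg (by positivity : 0 ≤ ‖Z M n s‖ + M.r ^ k)] at this
      _ = _ := by
          rw [integral_const_mul, integral_add i1 (integrable_const _)]
          simp
  have hfac : ∫ s, ((‖Z M n s‖ + M.r ^ k) * M.amp n s ^ e) ^ q ∂M.P
      = (∫ s, (‖Z M n s‖ + M.r ^ k) ^ q ∂M.P) * ∫ s, (M.amp n s ^ e) ^ q ∂M.P := by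
    simp only [mul_pow _ (M.amp n _ ^ e)]
    refine hind.integral_fun_mul_eq_mul_integral ?_ ?_
    · exact ((((hZ.measurable M n).norm).add_const _).pow_const q).aestronglyMeasurable
    · exact (((M.moments_amp n).measurable.pow_const e).pow_const q).aestronglyMeasurable
  calc ∫ s, |U M n s| ^ q ∂M.P
      ≤ ∫ s, (|c| * M.r ^ l) ^ q * ((‖Z M n s‖ + M.r ^ k) * M.amp n s ^ e) ^ q ∂M.P := by
        refine integral_mono_of_nonneg (.of_forall fun s => by positivity) ?_
          (.of_forall fun s => ?_)
        · refine Integrable.const_mul ?_ _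
          refine ((hB M n).integrable_pow q).congr (.of_forall fun s => ?_)
          have := M.one_le_amp n s
          simp only
          rw [abs_of_nonneg (by positivity)]
        · simp only [← mul_pow]
          exact pow_le_pow_left₀ (abs_nonneg _) (h' M n s) q
    _ = (|c| * M.r ^ l) ^ q * ((∫ s, (‖Z M n s‖ + M.r ^ k) ^ q ∂M.P)
          * ∫ s, (M.amp n s ^ e) ^ q ∂M.P) := by rw [integral_const_mul, hfac]
    _ ≤ (|c| * M.r ^ l) ^ q * ((2 ^ q * (∫ s, ‖Z M n s‖ ^ q ∂M.P + (M.r ^ k) ^ q)) * K) := by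
        have h0 : 0 ≤ ∫ s, (M.amp n s ^ e) ^ q ∂M.P := integral_nonneg fun s => by
          have := M.one_le_amp n s
          positivity
        have h1 : 0 ≤ ∫ s, ‖Z M n s‖ ^ q ∂M.P := integral_nonneg fun s => by positivity
        gcongr
    _ = _ := by rw [mul_pow]; ring

end IsRelBigO

/-- Moment stability: a process that starts at size `r ^ k` and whose increments split into a drift
of size `r² (‖Z‖ + r ^ k)` and a centred part of size `r (‖Z‖ + r ^ k)` remains of size `r ^ k` for
the `N ∼ r⁻²` steps. -/
theorem isBigO_norm_of_step {k : ℕ} (hZ : IsProcess Z)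
    {U V : Fin d → ∀ M : Model.{u} d D T L R, ℕ → M.S → ℝ} {K₀ : ℝ}
    (h0 : ∀ (M : Model.{u} d D T L R) s, ‖Z M 0 s‖ ≤ K₀ * M.r ^ k)
    (hstep : ∀ (M : Model.{u} d D T L R) n s i, Z M (n + 1) s i = Z M n s i + U i M n s + V i M n s)
    (hU : ∀ i, IsRelBigO k 2 Z (U i)) (hV : ∀ i, IsRelBigO k 1 Z (V i))
    (hVc : ∀ i (M : Model.{u} d D T L R) n, n ≤ M.N → Centered (M.𝒢 n) M.P (V i M n)) :
    IsBigO k (fun M n s => ‖Z M n s‖) := by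
  refine .of_even (fun M n _ => hZ.moments_norm M n) fun q => ?_
  set p := 2 * (q + 1) with hp
  have hpe : Even p := even_two_mul _
  have hp0 : p ≠ 0 := by omega
  choose KU hKU0 hKU using fun i => (hU i).bound p
  choose KV hKV0 hKV using fun i => (hV i).bound p
  set c : ℝ := ((d : ℝ) + 1) ^ (p - 1) with hc
  have hc0 : 0 ≤ c := by positivity
  set A : ℝ := ∑ i, (KU i * T ^ p + KV i * √T ^ p) with hA
  set γ := stepConst (p - 1) with hγ
  have hγ0 : 0 ≤ γ := stepConst_nonneg _
  have hnorm := fun v : EuclideanSpace ℝ (Fin d) => norm_pow_le v hp0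
  refine ⟨c * (Real.exp (γ * (1 + A * c)) * (d * |K₀| ^ p + γ * |A|)), by positivity,
    fun M n hn => ?_⟩
  have hr := M.r_pos
  have hT := M.T_nonneg
  have hN := M.N_pos
  have hA0 : 0 ≤ A := Finset.sum_nonneg fun i _ => by
    have := hKU0 i
    have := hKV0 i
    positivity
  set e : ℕ → ℝ := fun n => ∑ i, ∫ s, |Z M n s i| ^ p ∂M.P with he
  have he0 : ∀ n, 0 ≤ e n := fun n =>
    Finset.sum_nonneg fun i _ => integral_nonneg fun s => by positivity
  have hne : ∀ n, ∫ s, ‖Z M n s‖ ^ p ∂M.P ≤ c * e n := fun n => by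
    have hi : ∀ i ∈ Finset.univ, Integrable (fun s => |Z M n s i| ^ p) M.P :=
      fun i _ => (hZ.moments M n i).integrable_pow p
    simp only [he]
    rw [← integral_finsetSum _ hi, ← integral_const_mul]
    exact integral_mono_of_nonneg (.of_forall fun s => by positivity)
      ((integrable_finsetSum _ hi).const_mul _) (.of_forall fun s => hnorm _)
  have hrec : ∀ n < M.N, e (n + 1) ≤ e n + γ * (1 + A * c) * (1 / M.N) * e n
      + 1 / M.N * (γ * (A * (M.r ^ k) ^ p)) := by
    intro n hn
    have h1 : ∀ i, ∫ s, |Z M (n + 1) s i| ^ p ∂M.P ≤ ∫ s, |Z M n s i| ^ p ∂M.P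
        + γ * (1 / M.N) * (∫ s, |Z M n s i| ^ p ∂M.P
          + (KU i * T ^ p + KV i * √T ^ p) * (c * e n + (M.r ^ k) ^ p)) := fun i => by
      simp only [hstep]
      refine (integral_abs_add_add_pow_le hpe hp0 M.one_le_N (hZ.moments M n i)
        (((EuclideanSpace.proj (𝕜 := ℝ) i).continuous.measurable).comp (hZ.adapted M n))
        ((hU i).moments M n hn.le) (hVc i M n hn.le)).trans ?_
      have b1 := hKU i M n hn.le
      have b2 := hKV i M n hn.le
      have := hKU0 i
      have := hKV0 i
      have e1 : (M.N : ℝ) ^ p * ∫ s, |U i M n s| ^ p ∂M.P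
          ≤ KU i * T ^ p * (c * e n + (M.r ^ k) ^ p) := by
        calc _ ≤ (M.N : ℝ) ^ p * (KU i * (M.r ^ 2) ^ p * (c * e n + (M.r ^ k) ^ p)) := by
              gcongr
              exact b1.trans (by gcongr; exact hne n)
          _ = KU i * (M.N * M.r ^ 2) ^ p * (c * e n + (M.r ^ k) ^ p) := by rw [mul_pow]; ring
          _ = _ := by rw [M.N_mul_r_sq]
      have e2 : √(M.N : ℝ) ^ p * ∫ s, |V i M n s| ^ p ∂M.P
          ≤ KV i * √T ^ p * (c * e n + (M.r ^ k) ^ p) := by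
        calc _ ≤ √(M.N : ℝ) ^ p * (KV i * (M.r ^ 1) ^ p * (c * e n + (M.r ^ k) ^ p)) := by
              gcongr
              exact b2.trans (by gcongr; exact hne n)
          _ = KV i * (√M.N * M.r) ^ p * (c * e n + (M.r ^ k) ^ p) := by
              rw [mul_pow, pow_one]; ring
          _ = _ := by rw [M.sqrt_N_mul_r]
      rw [add_assoc (∫ s, |Z M n s i| ^ p ∂M.P) _ (√(M.N : ℝ) ^ p * _)]
      gcongr
      linarith
    calc e (n + 1) ≤ ∑ i, (∫ s, |Z M n s i| ^ p ∂M.P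
        + γ * (1 / M.N) * (∫ s, |Z M n s i| ^ p ∂M.P
          + (KU i * T ^ p + KV i * √T ^ p) * (c * e n + (M.r ^ k) ^ p))) :=
          Finset.sum_le_sum fun i _ => h1 i
      _ = e n + γ * (1 / M.N) * (e n + A * (c * e n + (M.r ^ k) ^ p)) := by
          rw [Finset.sum_add_distrib, ← Finset.mul_sum, Finset.sum_add_distrib, ← Finset.sum_mul]
      _ = _ := by ring
  have hinit : e 0 ≤ d * |K₀| ^ p * (M.r ^ k) ^ p := by
    calc e 0 ≤ ∑ _i : Fin d, (|K₀| * M.r ^ k) ^ p := by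
          refine Finset.sum_le_sum fun i _ => ?_
          calc ∫ s, |Z M 0 s i| ^ p ∂M.P ≤ ∫ _s, (|K₀| * M.r ^ k) ^ p ∂M.P := by
                refine integral_mono_of_nonneg (.of_forall fun s => by positivity)
                  (integrable_const _) (.of_forall fun s => ?_)
                refine pow_le_pow_left₀ (abs_nonneg _) ((abs_apply_le_norm _ _).trans
                  ((h0 M s).trans ?_)) p
                gcongr
                exact le_abs_self _
            _ = _ := by simp
      _ = _ := by simp [mul_pow]; ring
  have hg := discrete_gronwall_of_le (by positivity) (by positivity) (by positivity) (he0 0)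
    hrec n hn
  have hnN : (n : ℝ) * (1 / M.N) ≤ 1 := by
    rw [mul_one_div, div_le_one hN]
    exact_mod_cast hn
  simp only [abs_norm]
  calc ∫ s, ‖Z M n s‖ ^ p ∂M.P ≤ c * e n := hne n
    _ ≤ c * (Real.exp (γ * (1 + A * c) * (1 / M.N) * n)
        * (e 0 + n * (1 / M.N) * (γ * (A * (M.r ^ k) ^ p)))) := by gcongr
    _ ≤ c * (Real.exp (γ * (1 + A * c)) * (d * |K₀| ^ p * (M.r ^ k) ^ p
        + 1 * (γ * (|A| * (M.r ^ k) ^ p)))) := by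
        have hexp : γ * (1 + A * c) * (1 / M.N) * n ≤ γ * (1 + A * c) := by
          rw [mul_assoc (γ * (1 + A * c)), mul_comm (1 / (M.N : ℝ))]
          exact mul_le_of_le_one_right (by positivity) hnN
        have hAA : γ * (A * (M.r ^ k) ^ p) ≤ γ * (|A| * (M.r ^ k) ^ p) := by
          gcongr
          exact le_abs_self A
        have h2 : n * (1 / M.N) * (γ * (A * (M.r ^ k) ^ p)) ≤ 1 * (γ * (|A| * (M.r ^ k) ^ p)) :=
          mul_le_mul hnN hAA (by positivity) zero_le_one
        gcongr
    _ = _ := by ring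

end Stability

/-! ### Regularity of the coefficients -/

section Coefficients

variable {d D : ℕ} {L R : ℝ} {f : EuclideanSpace ℝ (Fin d) → EuclideanSpace ℝ (Fin d)}
  {g : EuclideanSpace ℝ (Fin d) → Matrix (Fin d) (Fin D) ℝ}

namespace BoundedDerivatives

lemma contDiff_f_apply (hb : BoundedDerivatives L f g) (i : Fin d) :
    ContDiff ℝ 2 (fun x => f x i) := contDiff_euclidean.1 hb.contDiff_f i

lemma contDiff_milsteinTensor (hb : BoundedDerivatives L f g) (i : Fin d) (j k : Fin D) :
    ContDiff ℝ 1 (milsteinTensor g i j k) := by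
  refine contDiff_const.mul (ContDiff.sum fun l _ => ?_)
  refine ((hb.contDiff_g l k).of_le (by norm_num)).mul ?_
  exact ((hb.contDiff_g i j).fderiv_right (m := 1) (by norm_num)).clm_apply contDiff_const

lemma abs_f_sub_le (hb : BoundedDerivatives L f g) (hL : 0 ≤ L) (i : Fin d)
    (x y : EuclideanSpace ℝ (Fin d)) : |f x i - f y i| ≤ d * L * ‖x - y‖ :=
  abs_sub_le_of_partialDeriv ((hb.contDiff_f_apply i).differentiable (by norm_num)) hL
    (hb.deriv_f i) x y

lemma abs_g_sub_le (hb : BoundedDerivatives L f g) (hL : 0 ≤ L) (i : Fin d) (j : Fin D)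
    (x y : EuclideanSpace ℝ (Fin d)) : |g x i j - g y i j| ≤ d * L * ‖x - y‖ :=
  abs_sub_le_of_partialDeriv (φ := fun x => g x i j)
    ((hb.contDiff_g i j).differentiable (by norm_num)) hL (hb.deriv_g i j) x y

lemma abs_milsteinTensor_sub_le (hb : BoundedDerivatives L f g) (hL : 0 ≤ L) (i : Fin d)
    (j k : Fin D) (x y : EuclideanSpace ℝ (Fin d)) :
    |milsteinTensor g i j k x - milsteinTensor g i j k y| ≤ d * L * ‖x - y‖ :=
  abs_sub_le_of_partialDeriv ((hb.contDiff_milsteinTensor i j k).differentiable (by norm_num)) hL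
    (hb.deriv_h i j k) x y

lemma continuous_f_apply (hb : BoundedDerivatives L f g) (i : Fin d) :
    Continuous (fun x => f x i) := (hb.contDiff_f_apply i).continuous

lemma continuous_g_apply (hb : BoundedDerivatives L f g) (i : Fin d) (j : Fin D) :
    Continuous (fun x => g x i j) := (hb.contDiff_g i j).continuous

lemma continuous_milsteinTensor (hb : BoundedDerivatives L f g) (i : Fin d) (j k : Fin D) :
    Continuous (milsteinTensor g i j k) := (hb.contDiff_milsteinTensor i j k).continuous

lemma continuous_milsteinStep (hb : BoundedDerivatives L f g) (C : Matrix (Fin D) (Fin D) ℝ)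
    (δ : ℝ) : Continuous (fun z : EuclideanSpace ℝ (Fin d) × EuclideanSpace ℝ (Fin D) =>
      milsteinStep f g C δ z.1 z.2) := by
  have h1 := fun i => (hb.continuous_f_apply i).comp
    (continuous_fst (X := EuclideanSpace ℝ (Fin d)) (Y := EuclideanSpace ℝ (Fin D)))
  have h2 := fun i j => (hb.continuous_g_apply i j).comp
    (continuous_fst (X := EuclideanSpace ℝ (Fin d)) (Y := EuclideanSpace ℝ (Fin D)))
  have h3 := fun i j k => (hb.continuous_milsteinTensor i j k).comp
    (continuous_fst (X := EuclideanSpace ℝ (Fin d)) (Y := EuclideanSpace ℝ (Fin D)))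
  simp only [Function.comp_def] at h1 h2 h3
  refine (PiLp.continuous_toLp 2 _).comp (continuous_pi fun i => ?_)
  have h1i := h1 i
  refine ((Continuous.add (by fun_prop) (h1i.mul continuous_const)).add
    (continuous_finsetSum _ fun j _ => ?_)).add
    (continuous_finsetSum _ fun j _ => continuous_finsetSum _ fun k _ => ?_)
  · exact (h2 i j).mul (by fun_prop)
  · exact (h3 i j k).mul (by fun_prop)

end BoundedDerivatives

/-- The stochastic part of a step: a linear and a quadratic form of the Brownian increment `v`,
the latter compensated by its mean. -/
def noiseForm (C : Matrix (Fin D) (Fin D) ℝ) (δ : ℝ) (G : Fin D → ℝ) (H : Fin D → Fin D → ℝ)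
    (v : Fin D → ℝ) : ℝ :=
  ∑ j, G j * v j + ∑ j, ∑ k, H j k * (v j * v k - C j k * δ)

lemma milsteinStep_apply (C : Matrix (Fin D) (Fin D) ℝ) (δ : ℝ) (x : EuclideanSpace ℝ (Fin d))
    (v : EuclideanSpace ℝ (Fin D)) (i : Fin d) :
    milsteinStep f g C δ x v i = x i + f x i * δ
      + noiseForm C δ (fun j => g x i j) (fun j k => milsteinTensor g i j k x) v := by
  simp [milsteinStep, noiseForm, add_assoc]

lemma noiseForm_sub (C : Matrix (Fin D) (Fin D) ℝ) (δ : ℝ) (G G' : Fin D → ℝ)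
    (H H' : Fin D → Fin D → ℝ) (v : Fin D → ℝ) :
    noiseForm C δ (fun j => G j - G' j) (fun j k => H j k - H' j k) v
      = noiseForm C δ G H v - noiseForm C δ G' H' v := by
  simp only [noiseForm, sub_mul, Finset.sum_sub_distrib]
  ring

lemma noiseForm_half_add (C : Matrix (Fin D) (Fin D) ℝ) (δ : ℝ) (G G' : Fin D → ℝ)
    (H H' : Fin D → Fin D → ℝ) (v : Fin D → ℝ) :
    noiseForm C δ (fun j => (G j + G' j) / 2) (fun j k => (H j k + H' j k) / 2) v
      = (noiseForm C δ G H v + noiseForm C δ G' H' v) / 2 := by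
  simp only [noiseForm, add_div, add_mul, Finset.sum_add_distrib, div_mul_eq_mul_div,
    ← Finset.sum_div]
  ring

lemma abs_noiseForm_le {C : Matrix (Fin D) (Fin D) ℝ} (hC : ∀ j k, |C j k| ≤ 1) {δ r A c : ℝ}
    {G : Fin D → ℝ} {H : Fin D → Fin D → ℝ} {v : Fin D → ℝ} (hδ0 : 0 ≤ δ) (hδ : δ ≤ r ^ 2)
    (hr : 0 ≤ r) (hA : 1 ≤ A) (hc : 0 ≤ c) (hG : ∀ j, |G j| ≤ c) (hH : ∀ j k, |H j k| ≤ c)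
    (hv : ∀ j, |v j| ≤ r * A) :
    |noiseForm C δ G H v| ≤ c * (D * r * A + 2 * D ^ 2 * r ^ 2 * A ^ 2) := by
  have h1 : |∑ j, G j * v j| ≤ c * (D * r * A) := by
    calc |∑ j, G j * v j| ≤ ∑ j, |G j * v j| := Finset.abs_sum_le_sum_abs _ _
      _ ≤ ∑ _j : Fin D, c * (r * A) := by
          refine Finset.sum_le_sum fun j _ => ?_
          rw [abs_mul]
          exact mul_le_mul (hG j) (hv j) (abs_nonneg _) hc
      _ = _ := by simp; ring
  have h2 : ∀ j k, |H j k * (v j * v k - C j k * δ)| ≤ c * (2 * r ^ 2 * A ^ 2) := fun j k => by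
    rw [abs_mul]
    refine mul_le_mul (hH j k) ?_ (abs_nonneg _) hc
    have e1 : |v j * v k| ≤ (r * A) * (r * A) := by
      rw [abs_mul]
      exact mul_le_mul (hv j) (hv k) (abs_nonneg _) (by positivity)
    have e2 : |C j k * δ| ≤ 1 * (r ^ 2 * A ^ 2) := by
      rw [abs_mul, abs_of_nonneg hδ0]
      refine mul_le_mul (hC j k) (hδ.trans ?_) hδ0 zero_le_one
      exact le_mul_of_one_le_right (by positivity) (one_le_pow₀ hA)
    have e3 := abs_sub (v j * v k) (C j k * δ)
    nlinarith
  have h3 : |∑ j, ∑ k, H j k * (v j * v k - C j k * δ)| ≤ c * (2 * D ^ 2 * r ^ 2 * A ^ 2) := by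
    calc _ ≤ ∑ j, ∑ k, |H j k * (v j * v k - C j k * δ)| :=
          (Finset.abs_sum_le_sum_abs _ _).trans
            (Finset.sum_le_sum fun j _ => Finset.abs_sum_le_sum_abs _ _)
      _ ≤ ∑ _j : Fin D, ∑ _k : Fin D, c * (2 * r ^ 2 * A ^ 2) :=
          Finset.sum_le_sum fun j _ => Finset.sum_le_sum fun k _ => h2 j k
      _ = _ := by simp; ring
  calc _ ≤ _ := abs_add_le _ _
    _ ≤ _ := add_le_add h1 h3
    _ = _ := by ring

lemma HasMoments.noiseForm {S : Type*} {mS : MeasurableSpace S} {P : Measure S}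
    [IsProbabilityMeasure P] (C : Matrix (Fin D) (Fin D) ℝ) (δ : ℝ) {G : S → Fin D → ℝ}
    {H : S → Fin D → Fin D → ℝ} {v : S → Fin D → ℝ} (hG : ∀ j, HasMoments P (fun s => G s j))
    (hH : ∀ j k, HasMoments P (fun s => H s j k)) (hv : ∀ j, HasMoments P (fun s => v s j)) :
    HasMoments P (fun s => noiseForm C δ (G s) (H s) (v s)) :=
  (HasMoments.sum fun j _ => (hG j).mul (hv j)).add (.sum fun j _ => .sum fun k _ =>
    (hH j k).mul (((hv j).mul (hv k)).sub (.const _)))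

/-- The stochastic part of a step is centred if its coefficients are known at the beginning. -/
lemma Centered.noiseForm {S : Type*} {m mS : MeasurableSpace S} {P : Measure S}
    [IsProbabilityMeasure P] {C : Matrix (Fin D) (Fin D) ℝ} {δ : ℝ} {G : S → Fin D → ℝ}
    {H : S → Fin D → Fin D → ℝ} {v : S → Fin D → ℝ} (hGm : ∀ j, Measurable[m] (fun s => G s j))
    (hHm : ∀ j k, Measurable[m] (fun s => H s j k)) (hG : ∀ j, HasMoments P (fun s => G s j))
    (hH : ∀ j k, HasMoments P (fun s => H s j k)) (hv : ∀ j, Centered m P (fun s => v s j))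
    (hvv : ∀ j k, Centered m P (fun s => v s j * v s k - C j k * δ)) :
    Centered m P (fun s => noiseForm C δ (G s) (H s) (v s)) :=
  (Centered.sum fun j _ => (hv j).mul_left (hGm j) (hG j)).add (.sum fun j _ => .sum fun k _ =>
    (hvv j k).mul_left (hHm j k) (hH j k))

lemma IsBigO.noiseForm {T : ℝ} {l : ℕ} {δ : Model.{u} d D T L R → ℝ}
    {G : Fin D → ∀ M : Model.{u} d D T L R, ℕ → M.S → ℝ}
    {H : Fin D → Fin D → ∀ M : Model.{u} d D T L R, ℕ → M.S → ℝ}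
    {v : Fin D → ∀ M : Model.{u} d D T L R, ℕ → M.S → ℝ}
    (hδ : ∀ M, |δ M| ≤ M.h) (hG : ∀ j, IsBigO (l + 1) (G j)) (hH : ∀ j k, IsBigO l (H j k))
    (hv : ∀ j, IsBigO 1 (v j)) :
    IsBigO (l + 2) (fun M n s => AntitheticMilstein.noiseForm M.C (δ M) (fun j => G j M n s)
      (fun j k => H j k M n s) (fun j => v j M n s)) := by
  refine IsBigO.add (.sum fun j _ => (hG j).mul (hv j)) (.sum fun j _ => .sum fun k _ =>
    (hH j k).mul (((hv j).mul (hv k)).sub (.const (fun M _ => M.C j k * δ M) 1 fun M n _ => ?_)))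
  have := M.h_pos
  rw [abs_mul, M.r_sq]
  exact mul_le_mul (M.abs_C j k) (hδ M) (abs_nonneg _) zero_le_one

end Coefficients

/-! ### The coefficients along a process -/

namespace Model

variable {d D : ℕ} {T L R : ℝ}

/-- The Milstein tensor of a model. -/
def tensor (M : Model.{u} d D T L R) (i : Fin d) (j k : Fin D) (x : EuclideanSpace ℝ (Fin d)) : ℝ :=
  milsteinTensor M.g i j k x

/-- The stochastic part of the `i`-th coordinate of a Milstein step. -/
def noise (M : Model.{u} d D T L R) (δ : ℝ) (i : Fin d) (x : EuclideanSpace ℝ (Fin d))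
    (v : EuclideanSpace ℝ (Fin D)) : ℝ :=
  noiseForm M.C δ (fun j => M.g x i j) (fun j k => M.tensor i j k x) v

/-- A truncated Milstein step of a model. -/
def mstep (M : Model.{u} d D T L R) (δ : ℝ) (x : EuclideanSpace ℝ (Fin d))
    (v : EuclideanSpace ℝ (Fin D)) : EuclideanSpace ℝ (Fin d) :=
  milsteinStep M.f M.g M.C δ x v

lemma mstep_apply (M : Model.{u} d D T L R) (δ : ℝ) (x : EuclideanSpace ℝ (Fin d))
    (v : EuclideanSpace ℝ (Fin D)) (i : Fin d) :
    M.mstep δ x v i = x i + M.f x i * δ + M.noise δ i x v := milsteinStep_apply _ _ _ _ _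

lemma measurable_mstep (M : Model.{u} d D T L R) (δ : ℝ) {S : Type*} {m : MeasurableSpace S}
    {x : S → EuclideanSpace ℝ (Fin d)} {v : S → EuclideanSpace ℝ (Fin D)} (hx : Measurable x)
    (hv : Measurable v) : Measurable (fun s => M.mstep δ (x s) (v s)) :=
  (M.bounded.continuous_milsteinStep M.C δ).measurable.comp (hx.prodMk hv)

lemma measurable_f (M : Model.{u} d D T L R) (i : Fin d) : Measurable (fun x => M.f x i) :=
  (M.bounded.continuous_f_apply i).measurable

lemma measurable_g (M : Model.{u} d D T L R) (i : Fin d) (j : Fin D) :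
    Measurable (fun x => M.g x i j) :=
  (M.bounded.continuous_g_apply i j).measurable

lemma measurable_tensor (M : Model.{u} d D T L R) (i : Fin d) (j k : Fin D) :
    Measurable (M.tensor i j k) :=
  (M.bounded.continuous_milsteinTensor i j k).measurable

lemma abs_f_sub_le (M : Model.{u} d D T L R) (i : Fin d) (x y : EuclideanSpace ℝ (Fin d)) :
    |M.f x i - M.f y i| ≤ d * L * ‖x - y‖ := M.bounded.abs_f_sub_le M.L_nonneg i x y

lemma abs_g_sub_le (M : Model.{u} d D T L R) (i : Fin d) (j : Fin D)
    (x y : EuclideanSpace ℝ (Fin d)) : |M.g x i j - M.g y i j| ≤ d * L * ‖x - y‖ :=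
  M.bounded.abs_g_sub_le M.L_nonneg i j x y

lemma abs_tensor_sub_le (M : Model.{u} d D T L R) (i : Fin d) (j k : Fin D)
    (x y : EuclideanSpace ℝ (Fin d)) : |M.tensor i j k x - M.tensor i j k y| ≤ d * L * ‖x - y‖ :=
  M.bounded.abs_milsteinTensor_sub_le M.L_nonneg i j k x y

/-- A common linear growth constant of `f`, `g` and the Milstein tensor. -/
def growth (d : ℕ) (L R : ℝ) : ℝ := R + d * L + d * R * L

lemma growth_nonneg (M : Model.{u} d D T L R) : 0 ≤ growth d L R := by
  have := M.L_nonneg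
  have := M.R_nonneg
  unfold growth
  positivity

lemma le_growth (M : Model.{u} d D T L R) {φ : EuclideanSpace ℝ (Fin d) → ℝ}
    (h : ∀ x y, |φ x - φ y| ≤ d * L * ‖x - y‖) (h0 : |φ 0| ≤ R + d * R * L)
    (x : EuclideanSpace ℝ (Fin d)) : |φ x| ≤ growth d L R * (1 + ‖x‖) := by
  have h1 := h x 0
  rw [sub_zero] at h1
  have h2 : |φ x| ≤ |φ 0| + |φ x - φ 0| := by
    have := abs_add_le (φ 0) (φ x - φ 0)
    simpa using this
  have := M.L_nonneg
  have := M.R_nonneg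
  have h3 : 0 ≤ (R + d * R * L) * ‖x‖ + d * L := by positivity
  unfold growth
  nlinarith

lemma abs_f_le (M : Model.{u} d D T L R) (i : Fin d) (x : EuclideanSpace ℝ (Fin d)) :
    |M.f x i| ≤ growth d L R * (1 + ‖x‖) := by
  have := M.L_nonneg
  have := M.R_nonneg
  have h0 : 0 ≤ d * R * L := by positivity
  exact M.le_growth (φ := fun x => M.f x i) (M.abs_f_sub_le i)
    (by linarith [(abs_apply_le_norm (M.f 0) i).trans M.norm_f]) x

lemma abs_g_le (M : Model.{u} d D T L R) (i : Fin d) (j : Fin D) (x : EuclideanSpace ℝ (Fin d)) :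
    |M.g x i j| ≤ growth d L R * (1 + ‖x‖) := by
  have := M.L_nonneg
  have := M.R_nonneg
  have h0 : 0 ≤ d * R * L := by positivity
  exact M.le_growth (φ := fun x => M.g x i j) (M.abs_g_sub_le i j)
    (by linarith [M.abs_g i j]) x

lemma abs_tensor_le (M : Model.{u} d D T L R) (i : Fin d) (j k : Fin D)
    (x : EuclideanSpace ℝ (Fin d)) : |M.tensor i j k x| ≤ growth d L R * (1 + ‖x‖) := by
  have := M.L_nonneg
  have hR := M.R_nonneg
  refine M.le_growth (M.abs_tensor_sub_le i j k) ?_ x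
  have h1 : |∑ l, M.g 0 l k * partialDeriv l (fun y => M.g y i j) 0| ≤ d * (R * L) := by
    calc _ ≤ ∑ l, |M.g 0 l k * partialDeriv l (fun y => M.g y i j) 0| :=
          Finset.abs_sum_le_sum_abs _ _
      _ ≤ ∑ _l : Fin d, R * L := by
          refine Finset.sum_le_sum fun l _ => ?_
          rw [abs_mul]
          exact mul_le_mul (M.abs_g l k) (M.bounded.deriv_g i j l 0) (abs_nonneg _) hR
      _ = _ := by simp
  have h2 : 0 ≤ d * R * L := by positivity
  rw [tensor, milsteinTensor, abs_mul, abs_of_pos (by norm_num : (0 : ℝ) < 1 / 2)]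
  nlinarith

end Model

section AlongProcess

variable {d D : ℕ} {T L R : ℝ}

/-- Linear growth preserves the finiteness of moments. -/
lemma hasMoments_comp {S : Type*} {mS : MeasurableSpace S} {P : Measure S} [IsProbabilityMeasure P]
    {φ : EuclideanSpace ℝ (Fin d) → ℝ} (hφ : Measurable φ) {c : ℝ}
    (h : ∀ x, |φ x| ≤ c * (1 + ‖x‖)) {X : S → EuclideanSpace ℝ (Fin d)} (hX : Measurable X)
    (hXm : ∀ i, HasMoments P (fun s => X s i)) : HasMoments P (fun s => φ (X s)) :=
  .of_le (hφ.comp hX) (((HasMoments.const 1).add (hasMoments_norm hX hXm)).const_mul c) fun _ =>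
    (h _).trans (le_abs_self _)

lemma Model.hasMoments_noise (M : Model.{u} d D T L R) (δ : ℝ) (i : Fin d)
    {X : M.S → EuclideanSpace ℝ (Fin d)} {v : M.S → EuclideanSpace ℝ (Fin D)} (hX : Measurable X)
    (hXm : ∀ i, HasMoments M.P (fun s => X s i)) (hv : ∀ j, HasMoments M.P (fun s => v s j)) :
    HasMoments M.P (fun s => M.noise δ i (X s) (v s)) :=
  .noiseForm M.C δ (fun j => hasMoments_comp (M.measurable_g i j) (M.abs_g_le i j) hX hXm)
    (fun j k => hasMoments_comp (M.measurable_tensor i j k) (M.abs_tensor_le i j k) hX hXm) hv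

lemma Model.hasMoments_mstep (M : Model.{u} d D T L R) (δ : ℝ) (i : Fin d)
    {X : M.S → EuclideanSpace ℝ (Fin d)} {v : M.S → EuclideanSpace ℝ (Fin D)} (hX : Measurable X)
    (hXm : ∀ i, HasMoments M.P (fun s => X s i)) (hv : ∀ j, HasMoments M.P (fun s => v s j)) :
    HasMoments M.P (fun s => M.mstep δ (X s) (v s) i) := by
  simp only [M.mstep_apply]
  refine ((hXm i).add ?_).add (M.hasMoments_noise δ i hX hXm hv)
  simp only [mul_comm _ δ]
  exact (hasMoments_comp (M.measurable_f i) (M.abs_f_le i) hX hXm).const_mul δ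

namespace Model

/-- The coordinates of the increment over the first half of a step are centred given the past and
the increment over the second half. -/
lemma centered_a (M : Model.{u} d D T L R) (n : ℕ) (j : Fin D) :
    Centered (M.𝒢 n ⊔ MeasurableSpace.comap (M.b n) inferInstance) M.P (fun s => M.a n s j) :=
  .of_indep (M.indep_a n) (M.moments_a n j)
    ((EuclideanSpace.proj (𝕜 := ℝ) j).continuous.measurable.comp (comap_measurable _))
    (M.mean_a n j)

lemma centered_a_mul_a (M : Model.{u} d D T L R) (n : ℕ) (j k : Fin D) :
    Centered (M.𝒢 n ⊔ MeasurableSpace.comap (M.b n) inferInstance) M.P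
      (fun s => M.a n s j * M.a n s k - M.C j k * (M.h / 2)) := by
  have hm := (M.moments_a n j).mul (M.moments_a n k)
  have h : ∀ j : Fin D, Measurable (fun v : EuclideanSpace ℝ (Fin D) => v j) := fun j =>
    (EuclideanSpace.proj (𝕜 := ℝ) j).continuous.measurable
  refine .of_indep (M.indep_a n) (hm.sub (.const _)) ?_ ?_
  · exact (((h j).mul (h k)).sub_const (M.C j k * (M.h / 2))).comp (comap_measurable _)
  · rw [integral_sub hm.integrable (integrable_const _), M.cov_a n j k]
    simp

lemma centered_b (M : Model.{u} d D T L R) (n : ℕ) (j : Fin D) :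
    Centered (M.𝒢 n ⊔ MeasurableSpace.comap (M.a n) inferInstance) M.P (fun s => M.b n s j) :=
  M.swap.centered_a n j

lemma centered_b_mul_b (M : Model.{u} d D T L R) (n : ℕ) (j k : Fin D) :
    Centered (M.𝒢 n ⊔ MeasurableSpace.comap (M.a n) inferInstance) M.P
      (fun s => M.b n s j * M.b n s k - M.C j k * (M.h / 2)) :=
  M.swap.centered_a_mul_a n j k

lemma centered_b_mul_a (M : Model.{u} d D T L R) (n : ℕ) (j k : Fin D) :
    Centered (M.𝒢 n) M.P (fun s => M.b n s j * M.a n s k) := by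
  refine ((M.centered_a n k).mul_left ?_ (M.moments_b n j)).mono le_sup_left
  exact ((EuclideanSpace.proj (𝕜 := ℝ) j).continuous.measurable.comp
    (comap_measurable _)).mono le_sup_right le_rfl

lemma centered_a_mul_b (M : Model.{u} d D T L R) (n : ℕ) (j k : Fin D) :
    Centered (M.𝒢 n) M.P (fun s => M.a n s j * M.b n s k) :=
  M.swap.centered_b_mul_a n j k

lemma centered_add (M : Model.{u} d D T L R) (n : ℕ) (j : Fin D) :
    Centered (M.𝒢 n) M.P (fun s => (M.a n s + M.b n s) j) :=
  ((M.centered_a n j).mono le_sup_left).add ((M.centered_b n j).mono le_sup_left)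

lemma centered_add_mul_add (M : Model.{u} d D T L R) (n : ℕ) (j k : Fin D) :
    Centered (M.𝒢 n) M.P
      (fun s => (M.a n s + M.b n s) j * (M.a n s + M.b n s) k - M.C j k * M.h) := by
  have h := ((((M.centered_a_mul_a n j k).mono le_sup_left).add
    ((M.centered_b_mul_b n j k).mono le_sup_left)).add (M.centered_a_mul_b n j k)).add
    (M.centered_b_mul_a n j k)
  convert h using 2 with s
  simp only [PiLp.add_apply]
  ring

end Model

variable {X Y : ∀ M : Model.{u} d D T L R, ℕ → M.S → EuclideanSpace ℝ (Fin d)}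

lemma Model.abs_add_apply_le (M : Model.{u} d D T L R) (n : ℕ) (s : M.S) (j : Fin D) :
    |(M.a n s + M.b n s) j| ≤ M.r * M.amp n s :=
  (abs_add_le _ _).trans (M.abs_add_abs_le n s j)

lemma Model.moments_add (M : Model.{u} d D T L R) (n : ℕ) (j : Fin D) :
    HasMoments M.P (fun s => (M.a n s + M.b n s) j) := (M.moments_a n j).add (M.moments_b n j)

lemma isBigO_add_apply (j : Fin D) :
    IsBigO 1 (fun (M : Model.{u} d D T L R) n s => (M.a n s + M.b n s) j) :=
  (isBigO_a j).add (isBigO_b j)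

/-- The noise of a coarse step is centred. -/
lemma IsProcess.centered_noise (hX : IsProcess X) (M : Model.{u} d D T L R) (n : ℕ) (i : Fin d) :
    Centered (M.𝒢 n) M.P (fun s => M.noise M.h i (X M n s) (M.a n s + M.b n s)) :=
  .noiseForm (fun j => (M.measurable_g i j).comp (hX.adapted M n))
    (fun j k => (M.measurable_tensor i j k).comp (hX.adapted M n))
    (fun j => hasMoments_comp (M.measurable_g i j) (M.abs_g_le i j) (hX.measurable M n)
      (hX.moments M n))
    (fun j k => hasMoments_comp (M.measurable_tensor i j k) (M.abs_tensor_le i j k)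
      (hX.measurable M n) (hX.moments M n))
    (M.centered_add n) (M.centered_add_mul_add n)

lemma IsProcess.sub (hX : IsProcess X) (hY : IsProcess Y) :
    IsProcess (fun M n s => X M n s - Y M n s) :=
  ⟨fun M n => (hX.adapted M n).sub (hY.adapted M n),
    fun M n i => (hX.moments M n i).sub (hY.moments M n i)⟩

/-- The noise of a coarse step is Lipschitz in the state, uniformly in all `L^q`. -/
lemma IsProcess.isRelBigO_noise_sub (hX : IsProcess X) (hY : IsProcess Y) (k : ℕ) (i : Fin d) :
    IsRelBigO k 1 (fun M n s => X M n s - Y M n s)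
      (fun M n s => M.noise M.h i (X M n s) (M.a n s + M.b n s)
        - M.noise M.h i (Y M n s) (M.a n s + M.b n s)) := by
  refine .of_le (hX.sub hY) (fun M n =>
    ((hX.centered_noise M n i).sub (hY.centered_noise M n i)).moments.measurable)
    (d * L * (D + 2 * D ^ 2 * √T)) 2 fun M n s => ?_
  have hr := M.r_pos
  have hL := M.L_nonneg
  have hA := M.one_le_amp n s
  have hb := abs_noiseForm_le (r := M.r) (A := M.amp n s) (δ := M.h) (c := d * L * ‖X M n s - Y M n s‖)
    (G := fun j => M.g (X M n s) i j - M.g (Y M n s) i j)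
    (H := fun j k => M.tensor i j k (X M n s) - M.tensor i j k (Y M n s))
    (v := (M.a n s + M.b n s)) M.abs_C M.h_pos.le (le_of_eq M.r_sq.symm) hr.le hA (by positivity)
    (fun j => M.abs_g_sub_le i j _ _) (fun j k => M.abs_tensor_sub_le i j k _ _)
    (M.abs_add_apply_le n s)
  rw [noiseForm_sub] at hb
  refine hb.trans ?_
  calc d * L * ‖X M n s - Y M n s‖ * (D * M.r * M.amp n s + 2 * D ^ 2 * M.r ^ 2 * M.amp n s ^ 2)
      ≤ d * L * ‖X M n s - Y M n s‖ * (D * M.r * M.amp n s ^ 2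
        + 2 * D ^ 2 * (M.r * √T) * M.amp n s ^ 2) := by
        have h1 : M.amp n s ≤ M.amp n s ^ 2 := le_self_pow₀ hA (by norm_num)
        have h2 : M.r ^ 2 ≤ M.r * √T := by rw [sq]; gcongr; exact M.r_le
        gcongr
    _ = d * L * (D + 2 * D ^ 2 * √T) * M.r ^ 1 * (‖X M n s - Y M n s‖ * M.amp n s ^ 2) := by ring
    _ ≤ _ := by
        gcongr
        linarith [pow_pos hr k]

lemma IsProcess.isRelBigO_drift_sub (hX : IsProcess X) (hY : IsProcess Y) (k : ℕ) (i : Fin d) :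
    IsRelBigO k 2 (fun M n s => X M n s - Y M n s)
      (fun M n s => (M.f (X M n s) i - M.f (Y M n s) i) * M.h) := by
  refine .of_le (hX.sub hY) (fun M n => (((M.measurable_f i).comp (hX.measurable M n)).sub
    ((M.measurable_f i).comp (hY.measurable M n))).mul_const _) (d * L) 0 fun M n s => ?_
  have hh := M.h_pos
  have hL := M.L_nonneg
  rw [abs_mul, abs_of_pos hh, M.r_sq, pow_zero, mul_one]
  calc _ ≤ d * L * ‖X M n s - Y M n s‖ * M.h := by gcongr; exact M.abs_f_sub_le i _ _
    _ = d * L * M.h * ‖X M n s - Y M n s‖ := by ring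
    _ ≤ _ := by
      gcongr
      linarith [pow_pos M.r_pos k]

end AlongProcess

/-! ### The paths and the boundedness of their moments -/

variable {d D : ℕ} {T L R : ℝ}

namespace Model

/-- The fine path at the coarse times. The antithetic path is the fine path of `M.swap`. -/
def fine (M : Model.{u} d D T L R) : ℕ → M.S → EuclideanSpace ℝ (Fin d)
  | 0, _ => M.x₀
  | n + 1, s => M.mstep (M.h / 2) (M.mstep (M.h / 2) (M.fine n s) (M.a n s)) (M.b n s)

/-- The fine path in the middle of a coarse step. -/
def mid (M : Model.{u} d D T L R) (n : ℕ) (s : M.S) : EuclideanSpace ℝ (Fin d) :=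
  M.mstep (M.h / 2) (M.fine n s) (M.a n s)

/-- The coarse path. -/
def coarse (M : Model.{u} d D T L R) : ℕ → M.S → EuclideanSpace ℝ (Fin d)
  | 0, _ => M.x₀
  | n + 1, s => M.mstep M.h (M.coarse n s) (M.a n s + M.b n s)

lemma fine_succ (M : Model.{u} d D T L R) (n : ℕ) (s : M.S) :
    M.fine (n + 1) s = M.mstep (M.h / 2) (M.mid n s) (M.b n s) := rfl

end Model

lemma isProcess_fine : IsProcess (fun M : Model.{u} d D T L R => M.fine) := by
  have hm : ∀ (M : Model.{u} d D T L R) n, Measurable[M.𝒢 n] (M.fine n) := fun M n => by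
    induction n with
    | zero => exact measurable_const
    | succ n ih =>
      exact M.measurable_mstep _ (M.measurable_mstep _ (ih.mono (M.𝒢_succ n) le_rfl)
        (M.measurable_a n)) (M.measurable_b n)
  refine ⟨hm, fun M n => ?_⟩
  induction n with
  | zero => exact fun i => .const (M.x₀ i)
  | succ n ih =>
    have h1 : Measurable (M.fine n) := (hm M n).mono (M.𝒢_le n) le_rfl
    have ha : Measurable (M.a n) := (M.measurable_a n).mono (M.𝒢_le _) le_rfl
    exact fun i => M.hasMoments_mstep _ i (M.measurable_mstep _ h1 ha)
      (fun i => M.hasMoments_mstep _ i h1 ih (M.moments_a n)) (M.moments_b n)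

lemma isProcess_coarse : IsProcess (fun M : Model.{u} d D T L R => M.coarse) := by
  have hm : ∀ (M : Model.{u} d D T L R) n, Measurable[M.𝒢 n] (M.coarse n) := fun M n => by
    induction n with
    | zero => exact measurable_const
    | succ n ih =>
      exact M.measurable_mstep _ (ih.mono (M.𝒢_succ n) le_rfl)
        ((M.measurable_a n).add (M.measurable_b n))
  refine ⟨hm, fun M n => ?_⟩
  induction n with
  | zero => exact fun i => .const (M.x₀ i)
  | succ n ih =>
    exact fun i => M.hasMoments_mstep _ i ((hm M n).mono (M.𝒢_le n) le_rfl) ih (M.moments_add n)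

lemma IsProcess.swap {X : ∀ M : Model.{u} d D T L R, ℕ → M.S → EuclideanSpace ℝ (Fin d)}
    (hX : IsProcess X) : IsProcess (fun M n (s : M.S) => X M.swap n s) :=
  ⟨fun M n => hX.adapted M.swap n, fun M n i => hX.moments M.swap n i⟩

namespace Model

lemma measurable_mid (M : Model.{u} d D T L R) (n : ℕ) :
    Measurable[M.𝒢 n ⊔ MeasurableSpace.comap (M.a n) inferInstance] (M.mid n) :=
  M.measurable_mstep _ ((isProcess_fine.adapted M n).mono le_sup_left le_rfl)
    ((comap_measurable _).mono le_sup_right le_rfl)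

lemma sup_comap_a_le (M : Model.{u} d D T L R) (n : ℕ) :
    M.𝒢 n ⊔ MeasurableSpace.comap (M.a n) inferInstance ≤ M.mS :=
  sup_le (M.𝒢_le n) (M.comap_a_le n)

lemma measurable_mid' (M : Model.{u} d D T L R) (n : ℕ) : Measurable (M.mid n) :=
  (M.measurable_mid n).mono (M.sup_comap_a_le n) le_rfl

lemma moments_mid (M : Model.{u} d D T L R) (n : ℕ) (i : Fin d) :
    HasMoments M.P (fun s => M.mid n s i) :=
  M.hasMoments_mstep _ i (isProcess_fine.measurable M n) (isProcess_fine.moments M n)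
    (M.moments_a n)

/-- The growth constant of the noise of a step. -/
def noiseGrowth (d D : ℕ) (T L R : ℝ) : ℝ := growth d L R * (D + 2 * D ^ 2 * √T)

lemma noiseGrowth_nonneg (M : Model.{u} d D T L R) : 0 ≤ noiseGrowth d D T L R :=
  mul_nonneg M.growth_nonneg (by positivity)

lemma abs_noise_le (M : Model.{u} d D T L R) {δ : ℝ} (hδ0 : 0 ≤ δ) (hδ : δ ≤ M.h) (i : Fin d)
    (x : EuclideanSpace ℝ (Fin d)) {v : EuclideanSpace ℝ (Fin D)} {A : ℝ} (hA : 1 ≤ A)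
    (hv : ∀ j, |v j| ≤ M.r * A) :
    |M.noise δ i x v| ≤ noiseGrowth d D T L R * M.r * ((1 + ‖x‖) * A ^ 2) := by
  have hr := M.r_pos
  have hG := M.growth_nonneg
  refine (abs_noiseForm_le (r := M.r) (c := growth d L R * (1 + ‖x‖)) M.abs_C hδ0
    (hδ.trans M.r_sq.ge) hr.le hA (by positivity) (fun j => M.abs_g_le i j x)
    (fun j k => M.abs_tensor_le i j k x) hv).trans ?_
  have h1 : A ≤ A ^ 2 := le_self_pow₀ hA (by norm_num)
  have h2 : M.r ^ 2 ≤ M.r * √T := by rw [sq]; gcongr; exact M.r_le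
  calc growth d L R * (1 + ‖x‖) * (D * M.r * A + 2 * D ^ 2 * M.r ^ 2 * A ^ 2)
      ≤ growth d L R * (1 + ‖x‖) * (D * M.r * A ^ 2 + 2 * D ^ 2 * (M.r * √T) * A ^ 2) := by
        gcongr
    _ = _ := by unfold noiseGrowth; ring

/-- The growth constant of a half step. -/
def midGrowth (d D : ℕ) (T L R : ℝ) : ℝ :=
  1 + d * (growth d L R * T + noiseGrowth d D T L R * √T)

lemma midGrowth_nonneg (M : Model.{u} d D T L R) : 0 ≤ midGrowth d D T L R := by
  have := M.growth_nonneg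
  have := M.noiseGrowth_nonneg
  have := M.T_nonneg
  unfold midGrowth
  positivity

lemma one_add_norm_mid_le (M : Model.{u} d D T L R) (n : ℕ) (s : M.S) :
    1 + ‖M.mid n s‖ ≤ midGrowth d D T L R * ((1 + ‖M.fine n s‖) * M.amp n s ^ 2) := by
  have hA := M.one_le_amp n s
  have hG := M.growth_nonneg
  have hB := M.noiseGrowth_nonneg
  have hh := M.h_pos
  have hr := M.r_pos
  set x := M.fine n s
  set A := M.amp n s
  have hA2 : 1 ≤ A ^ 2 := one_le_pow₀ hA
  have hcoord : ∀ i, |M.mid n s i - x i|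
      ≤ (growth d L R * T + noiseGrowth d D T L R * √T) * ((1 + ‖x‖) * A ^ 2) := fun i => by
    have e : M.mid n s i - x i = M.f x i * (M.h / 2) + M.noise (M.h / 2) i x (M.a n s) := by
      rw [mid, mstep_apply]; ring
    rw [e]
    have h1 : |M.f x i * (M.h / 2)| ≤ growth d L R * T * ((1 + ‖x‖) * A ^ 2) := by
      rw [abs_mul, abs_of_pos (by positivity : 0 < M.h / 2)]
      calc _ ≤ growth d L R * (1 + ‖x‖) * T :=
            mul_le_mul (M.abs_f_le i x) (by linarith [M.h_le]) (by positivity) (by positivity)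
        _ = growth d L R * T * ((1 + ‖x‖) * 1) := by ring
        _ ≤ _ := by
            have := M.T_nonneg
            gcongr
    have h2 := M.abs_noise_le (δ := M.h / 2) (by positivity) (by linarith) i x hA (M.abs_a_le n s)
    have h3 : noiseGrowth d D T L R * M.r * ((1 + ‖x‖) * A ^ 2)
        ≤ noiseGrowth d D T L R * √T * ((1 + ‖x‖) * A ^ 2) := by
      gcongr
      exact M.r_le
    calc _ ≤ _ := abs_add_le _ _
      _ ≤ _ := add_le_add h1 (h2.trans h3)
      _ = _ := by ring
  have hnorm : ‖M.mid n s - x‖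
      ≤ d * ((growth d L R * T + noiseGrowth d D T L R * √T) * ((1 + ‖x‖) * A ^ 2)) := by
    calc ‖M.mid n s - x‖ ≤ ∑ i, |(M.mid n s - x) i| := norm_le_sum_abs _
      _ ≤ ∑ _i : Fin d, _ := Finset.sum_le_sum fun i _ => hcoord i
      _ = _ := by simp
  have htri : ‖M.mid n s‖ ≤ ‖x‖ + ‖M.mid n s - x‖ := by
    have := norm_add_le x (M.mid n s - x)
    simpa using this
  have h4 : 1 + ‖x‖ ≤ (1 + ‖x‖) * A ^ 2 := le_mul_of_one_le_right (by positivity) hA2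
  unfold midGrowth
  linarith

end Model

/-- The moments of the fine path are bounded. -/
theorem isBigO_norm_fine : IsBigO 0 (fun (M : Model.{u} d D T L R) n s => ‖M.fine n s‖) := by
  refine isBigO_norm_of_step isProcess_fine
    (U := fun i M n s => M.f (M.fine n s) i * (M.h / 2) + M.f (M.mid n s) i * (M.h / 2))
    (V := fun i M n s => M.noise (M.h / 2) i (M.fine n s) (M.a n s)
      + M.noise (M.h / 2) i (M.mid n s) (M.b n s)) (K₀ := R)
    (fun M s => by simpa [Model.fine] using M.norm_x₀) (fun M n s i => ?_) (fun i => ?_) (fun i => ?_)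
    (fun i M n _ => ?_)
  · rw [M.fine_succ, M.mstep_apply]
    conv_lhs => rw [Model.mid, M.mstep_apply, ← Model.mid]
    ring
  · refine .of_le isProcess_fine (fun M n => ?_)
      (Model.growth d L R * (1 + Model.midGrowth d D T L R)) 2 fun M n s => ?_
    · exact (((M.measurable_f i).comp (isProcess_fine.measurable M n)).mul_const _).add
        (((M.measurable_f i).comp (M.measurable_mid' n)).mul_const _)
    · have hA := M.one_le_amp n s
      have hG := M.growth_nonneg
      have hE := M.midGrowth_nonneg
      have hh := M.h_pos
      set x := M.fine n s
      have hA2 : 1 ≤ M.amp n s ^ 2 := one_le_pow₀ hA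
      have h0 : 1 + ‖x‖ ≤ (1 + ‖x‖) * M.amp n s ^ 2 := le_mul_of_one_le_right (by positivity) hA2
      have hx : |M.f x i| ≤ Model.growth d L R * ((1 + ‖x‖) * M.amp n s ^ 2) :=
        (M.abs_f_le i x).trans (by gcongr)
      have hy : |M.f (M.mid n s) i| ≤ Model.growth d L R * (Model.midGrowth d D T L R *
          ((1 + ‖x‖) * M.amp n s ^ 2)) :=
        (M.abs_f_le i _).trans (by gcongr; exact M.one_add_norm_mid_le n s)
      rw [← add_mul, abs_mul, abs_of_pos (by positivity : 0 < M.h / 2), M.r_sq, pow_zero]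
      calc _ ≤ (Model.growth d L R * ((1 + ‖x‖) * M.amp n s ^ 2) + Model.growth d L R *
            (Model.midGrowth d D T L R * ((1 + ‖x‖) * M.amp n s ^ 2))) * M.h :=
            mul_le_mul ((abs_add_le _ _).trans (add_le_add hx hy)) (by linarith) (by positivity)
              (by positivity)
        _ = _ := by ring
  · refine .of_le isProcess_fine (fun M n => ?_)
      (Model.noiseGrowth d D T L R * (1 + Model.midGrowth d D T L R)) 4 fun M n s => ?_
    · exact ((M.hasMoments_noise _ i (isProcess_fine.measurable M n) (isProcess_fine.moments M n)
        (M.moments_a n)).add (M.hasMoments_noise _ i (M.measurable_mid' n) (M.moments_mid n)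
          (M.moments_b n))).measurable
    · have hA := M.one_le_amp n s
      have hB := M.noiseGrowth_nonneg
      have hE := M.midGrowth_nonneg
      have hh := M.h_pos
      have hr := M.r_pos
      set x := M.fine n s
      have h24 : M.amp n s ^ 2 ≤ M.amp n s ^ 4 := pow_le_pow_right₀ hA (by norm_num)
      have hx := M.abs_noise_le (δ := M.h / 2) (by positivity) (by linarith) i x hA
        (M.abs_a_le n s)
      have hy := M.abs_noise_le (δ := M.h / 2) (by positivity) (by linarith) i (M.mid n s) hA
        (M.abs_b_le n s)
      rw [pow_zero, pow_one]
      calc _ ≤ _ := abs_add_le _ _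
        _ ≤ Model.noiseGrowth d D T L R * M.r * ((1 + ‖x‖) * M.amp n s ^ 4)
            + Model.noiseGrowth d D T L R * M.r * (Model.midGrowth d D T L R *
              ((1 + ‖x‖) * M.amp n s ^ 2) * M.amp n s ^ 2) := by
            refine add_le_add (hx.trans ?_) (hy.trans ?_)
            · gcongr
            · gcongr
              exact M.one_add_norm_mid_le n s
        _ = _ := by ring
  · refine Centered.add (Centered.mono (m' := M.𝒢 n ⊔ MeasurableSpace.comap (M.b n) inferInstance)
      ?_ le_sup_left) (Centered.mono (m' := M.𝒢 n ⊔ MeasurableSpace.comap (M.a n) inferInstance)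
      ?_ le_sup_left)
    · have hx := (isProcess_fine.adapted M n).mono (le_sup_left : _ ≤
        M.𝒢 n ⊔ MeasurableSpace.comap (M.b n) inferInstance) le_rfl
      exact .noiseForm (fun j => (M.measurable_g i j).comp hx)
        (fun j k => (M.measurable_tensor i j k).comp hx)
        (fun j => hasMoments_comp (M.measurable_g i j) (M.abs_g_le i j)
          (isProcess_fine.measurable M n) (isProcess_fine.moments M n))
        (fun j k => hasMoments_comp (M.measurable_tensor i j k) (M.abs_tensor_le i j k)
          (isProcess_fine.measurable M n) (isProcess_fine.moments M n))
        (M.centered_a n) (M.centered_a_mul_a n)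
    · exact .noiseForm (fun j => (M.measurable_g i j).comp (M.measurable_mid n))
        (fun j k => (M.measurable_tensor i j k).comp (M.measurable_mid n))
        (fun j => hasMoments_comp (M.measurable_g i j) (M.abs_g_le i j)
          (M.measurable_mid' n) (M.moments_mid n))
        (fun j k => hasMoments_comp (M.measurable_tensor i j k) (M.abs_tensor_le i j k)
          (M.measurable_mid' n) (M.moments_mid n))
        (M.centered_b n) (M.centered_b_mul_b n)

/-! ### Expansion of a fine step about the coarse step -/

lemma isBigO_norm_of_apply {k : ℕ}
    {X : ∀ M : Model.{u} d D T L R, ℕ → M.S → EuclideanSpace ℝ (Fin d)}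
    (hX : ∀ M n, Measurable (X M n)) (h : ∀ i, IsBigO k (fun M n s => X M n s i)) :
    IsBigO k (fun M n s => ‖X M n s‖) :=
  .of_le (fun M n _ => (hX M n).norm) (.sum fun i (_ : i ∈ Finset.univ) => (h i).abs) 1
    fun M n s _ => by
      rw [one_mul, abs_norm]
      exact (norm_le_sum_abs _).trans (le_abs_self _)

/-- A function of linear growth along a process with bounded moments. -/
lemma isBigO_comp {φ : Model.{u} d D T L R → EuclideanSpace ℝ (Fin d) → ℝ}
    {X : ∀ M : Model.{u} d D T L R, ℕ → M.S → EuclideanSpace ℝ (Fin d)}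
    (hX : ∀ M n, Measurable (X M n)) (hX0 : IsBigO 0 (fun M n s => ‖X M n s‖))
    (hφ : ∀ M, Measurable (φ M)) {c : ℝ} (h : ∀ M x, |φ M x| ≤ c * (1 + ‖x‖)) :
    IsBigO 0 (fun M n s => φ M (X M n s)) :=
  .of_le (fun M n _ => (hφ M).comp (hX M n))
    ((IsBigO.const (fun _ _ => (1 : ℝ)) 1 fun M n _ => by simp).add hX0) c fun M n s _ => by
      refine (h M _).trans (le_of_eq ?_)
      rw [abs_of_nonneg (by positivity)]

/-- A Lipschitz function along two processes. -/
lemma isBigO_comp_sub {k : ℕ} {φ : Model.{u} d D T L R → EuclideanSpace ℝ (Fin d) → ℝ}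
    {X Y : ∀ M : Model.{u} d D T L R, ℕ → M.S → EuclideanSpace ℝ (Fin d)}
    (hX : ∀ M n, Measurable (X M n)) (hY : ∀ M n, Measurable (Y M n))
    (hXY : IsBigO k (fun M n s => ‖X M n s - Y M n s‖))
    (hφ : ∀ M, Measurable (φ M)) {c : ℝ} (h : ∀ M x y, |φ M x - φ M y| ≤ c * ‖x - y‖) :
    IsBigO k (fun M n s => φ M (X M n s) - φ M (Y M n s)) :=
  .of_le (fun M n _ => ((hφ M).comp (hX M n)).sub ((hφ M).comp (hY M n))) hXY c fun M n s _ => by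
    rw [abs_norm]
    exact h M _ _

lemma measurable_comp_sub_comp {S : Type*} {m : MeasurableSpace S}
    {φ : EuclideanSpace ℝ (Fin d) → ℝ} (hφ : Measurable φ) {X Y : S → EuclideanSpace ℝ (Fin d)}
    (hX : Measurable X) (hY : Measurable Y) : Measurable (fun s => φ (X s) - φ (Y s)) :=
  (hφ.comp hX).sub (hφ.comp hY)

lemma measurable_partialDeriv {φ : EuclideanSpace ℝ (Fin d) → ℝ} (hφ : ContDiff ℝ 2 φ)
    (l : Fin d) : Measurable (partialDeriv l φ) :=
  (((hφ.fderiv_right (m := 1) (by norm_num)).continuous).clm_apply continuous_const).measurable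

/-- The remainder at `y` of the expansion of `φ` about `x` to first order in an approximation `ℓ` of
the displacement `y - x`. -/
def expansionRem (φ : EuclideanSpace ℝ (Fin d) → ℝ) (x y : EuclideanSpace ℝ (Fin d))
    (ℓ : Fin d → ℝ) : ℝ :=
  φ y - φ x - ∑ l, partialDeriv l φ x * ℓ l

lemma measurable_expansionRem {φ : EuclideanSpace ℝ (Fin d) → ℝ} (hφ : ContDiff ℝ 2 φ)
    {S : Type*} {m : MeasurableSpace S} {x y : S → EuclideanSpace ℝ (Fin d)} {ℓ : S → Fin d → ℝ}
    (hx : Measurable x) (hy : Measurable y) (hℓ : ∀ l, Measurable (fun s => ℓ s l)) :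
    Measurable (fun s => expansionRem φ (x s) (y s) (ℓ s)) :=
  ((hφ.continuous.measurable.comp hy).sub (hφ.continuous.measurable.comp hx)).sub
    (Finset.measurable_fun_sum _ fun l _ => ((measurable_partialDeriv hφ l).comp hx).mul (hℓ l))

namespace Model

/-- The leading part of the displacement over the first half of a step. -/
def lin (M : Model.{u} d D T L R) (n : ℕ) (s : M.S) (l : Fin d) : ℝ :=
  ∑ k, M.g (M.fine n s) l k * M.a n s k

/-- The second order remainder of `φ` over the first half of a step. -/
def rem (M : Model.{u} d D T L R) (φ : EuclideanSpace ℝ (Fin d) → ℝ) (n : ℕ) (s : M.S) : ℝ :=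
  expansionRem φ (M.fine n s) (M.mid n s) (M.lin n s)

/-- The centred part of the remainder of a fine step. The part that comes from the drift is linear in
the increment over the first half; the noise over the second half enters with the change of its
coefficients over the first half. -/
def martRem (M : Model.{u} d D T L R) (i : Fin d) (n : ℕ) (s : M.S) : ℝ :=
  M.h / 2 * ∑ l, partialDeriv l (fun x => M.f x i) (M.fine n s) * M.lin n s l
    + noiseForm M.C (M.h / 2) (fun j => M.rem (fun x => M.g x i j) n s)
      (fun j k => M.tensor i j k (M.mid n s) - M.tensor i j k (M.fine n s)) (M.b n s)

/-- The drift part of the remainder of a fine step. -/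
def driftRem (M : Model.{u} d D T L R) (i : Fin d) (n : ℕ) (s : M.S) : ℝ :=
  M.h / 2 * M.rem (fun x => M.f x i) n s

/-- The difference to leading order between a fine and a coarse step. It is the
contribution of the discarded Lévy area over the step, and is antisymmetric under the exchange of
the increments over the two halves. -/
def exchange (M : Model.{u} d D T L R) (i : Fin d) (n : ℕ) (s : M.S) : ℝ :=
  ∑ j, ∑ k, M.tensor i j k (M.fine n s) * (M.b n s j * M.a n s k - M.a n s j * M.b n s k)

/-- The defining property of the Milstein tensor. -/
lemma sum_partialDeriv_mul_lin (M : Model.{u} d D T L R) (i : Fin d) (j : Fin D) (n : ℕ)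
    (s : M.S) : ∑ l, partialDeriv l (fun x => M.g x i j) (M.fine n s) * M.lin n s l
      = 2 * ∑ k, M.tensor i j k (M.fine n s) * M.a n s k := by
  simp only [lin, tensor, milsteinTensor, Finset.mul_sum, Finset.sum_mul]
  rw [Finset.sum_comm]
  refine Finset.sum_congr rfl fun k _ => Finset.sum_congr rfl fun l _ => ?_
  ring

lemma noise_add (M : Model.{u} d D T L R) (i : Fin d) (x : EuclideanSpace ℝ (Fin d))
    (v w : EuclideanSpace ℝ (Fin D)) :
    M.noise M.h i x (v + w) = M.noise (M.h / 2) i x v + M.noise (M.h / 2) i x w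
      + ∑ j, ∑ k, M.tensor i j k x * (v j * w k + w j * v k) := by
  have h' : ∀ j, M.g x i j * (v j + w j) = M.g x i j * v j + M.g x i j * w j := fun j =>
    mul_add _ _ _
  have h : ∀ j k, M.tensor i j k x * ((v j + w j) * (v k + w k) - M.C j k * M.h)
      = M.tensor i j k x * (v j * v k - M.C j k * (M.h / 2))
        + M.tensor i j k x * (w j * w k - M.C j k * (M.h / 2))
        + M.tensor i j k x * (v j * w k + w j * v k) := fun j k => by ring
  simp only [noise, noiseForm, PiLp.add_apply, h, h', Finset.sum_add_distrib]
  ring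

/-- A fine step is the coarse step with the same total increment, up to the exchange term and
remainders of higher order. -/
theorem fine_succ_apply (M : Model.{u} d D T L R) (n : ℕ) (s : M.S) (i : Fin d) :
    M.fine (n + 1) s i = M.fine n s i + M.f (M.fine n s) i * M.h
      + M.noise M.h i (M.fine n s) (M.a n s + M.b n s)
      + M.exchange i n s + M.martRem i n s + M.driftRem i n s := by
  set x := M.fine n s with hx
  set y := M.mid n s with hy
  have h1 : M.fine (n + 1) s i = x i + M.f x i * (M.h / 2) + M.noise (M.h / 2) i x (M.a n s)
      + M.f y i * (M.h / 2) + M.noise (M.h / 2) i y (M.b n s) := by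
    rw [M.fine_succ, M.mstep_apply, ← hy]
    conv_lhs => rw [hy, Model.mid, M.mstep_apply, ← hx, ← Model.mid, ← hy]
  have h2 : M.noise (M.h / 2) i y (M.b n s) = M.noise (M.h / 2) i x (M.b n s)
      + noiseForm M.C (M.h / 2) (fun j => M.rem (fun x => M.g x i j) n s)
        (fun j k => M.tensor i j k y - M.tensor i j k x) (M.b n s)
      + 2 * ∑ j, ∑ k, M.tensor i j k x * (M.b n s j * M.a n s k) := by
    have e : ∀ j, M.rem (fun x => M.g x i j) n s
        = M.g y i j - M.g x i j - 2 * ∑ k, M.tensor i j k x * M.a n s k := fun j => by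
      rw [rem, expansionRem, M.sum_partialDeriv_mul_lin]
    have e' : ∀ j, (∑ k, M.tensor i j k x * M.a n s k) * M.b n s j
        = ∑ k, M.tensor i j k x * (M.b n s j * M.a n s k) := fun j => by
      rw [Finset.sum_mul]
      exact Finset.sum_congr rfl fun k _ => by ring
    simp only [noise, noiseForm, e, sub_mul, Finset.sum_sub_distrib, mul_assoc (2 : ℝ), e',
      ← Finset.mul_sum]
    ring
  have h3 : M.driftRem i n s = M.h / 2 * (M.f y i - M.f x i)
      - M.h / 2 * ∑ l, partialDeriv l (fun x => M.f x i) x * M.lin n s l := by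
    rw [driftRem, rem, expansionRem]; ring
  have h4 : M.exchange i n s = ∑ j, ∑ k, M.tensor i j k x * (M.b n s j * M.a n s k)
      - ∑ j, ∑ k, M.tensor i j k x * (M.a n s j * M.b n s k) := by
    simp only [exchange, mul_sub, Finset.sum_sub_distrib, ← hx]
  have h5 : ∑ j, ∑ k, M.tensor i j k x * (M.a n s j * M.b n s k + M.b n s j * M.a n s k)
      = ∑ j, ∑ k, M.tensor i j k x * (M.a n s j * M.b n s k)
        + ∑ j, ∑ k, M.tensor i j k x * (M.b n s j * M.a n s k) := by
    simp only [mul_add, Finset.sum_add_distrib]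
  rw [h1, h2, M.noise_add, h3, h4, h5, martRem, ← hx, ← hy]
  ring

lemma measurable_lin (M : Model.{u} d D T L R) (n : ℕ) (l : Fin d) :
    Measurable[M.𝒢 n ⊔ MeasurableSpace.comap (M.a n) inferInstance] (fun s => M.lin n s l) :=
  Finset.measurable_fun_sum _ fun k _ =>
    (((M.measurable_g l k).comp (isProcess_fine.adapted M n)).mono le_sup_left le_rfl).mul
      (((EuclideanSpace.proj (𝕜 := ℝ) k).continuous.measurable.comp
        (comap_measurable (M.a n))).mono le_sup_right le_rfl)

lemma measurable_rem (M : Model.{u} d D T L R) {φ : EuclideanSpace ℝ (Fin d) → ℝ}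
    (hφ : ContDiff ℝ 2 φ) (n : ℕ) :
    Measurable[M.𝒢 n ⊔ MeasurableSpace.comap (M.a n) inferInstance] (M.rem φ n) :=
  measurable_expansionRem hφ ((isProcess_fine.adapted M n).mono le_sup_left le_rfl)
    (M.measurable_mid n) (M.measurable_lin n)

end Model

lemma isBigO_f_fine (i : Fin d) :
    IsBigO 0 (fun (M : Model.{u} d D T L R) n s => M.f (M.fine n s) i) :=
  isBigO_comp (φ := fun M x => M.f x i) isProcess_fine.measurable isBigO_norm_fine
    (fun M => M.measurable_f i) (fun M => M.abs_f_le i)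

lemma isBigO_g_fine (i : Fin d) (j : Fin D) :
    IsBigO 0 (fun (M : Model.{u} d D T L R) n s => M.g (M.fine n s) i j) :=
  isBigO_comp (φ := fun M x => M.g x i j) isProcess_fine.measurable isBigO_norm_fine
    (fun M => M.measurable_g i j) (fun M => M.abs_g_le i j)

lemma isBigO_tensor_fine (i : Fin d) (j k : Fin D) :
    IsBigO 0 (fun (M : Model.{u} d D T L R) n s => M.tensor i j k (M.fine n s)) :=
  isBigO_comp (φ := fun M x => M.tensor i j k x) isProcess_fine.measurable isBigO_norm_fine
    (fun M => M.measurable_tensor i j k) (fun M => M.abs_tensor_le i j k)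

lemma isBigO_lin (l : Fin d) : IsBigO 1 (fun (M : Model.{u} d D T L R) n s => M.lin n s l) :=
  .sum fun k _ => by simpa using (isBigO_g_fine l k).mul (isBigO_a k)

lemma isBigO_mid_sub_fine_sub_lin (i : Fin d) :
    IsBigO 2 (fun (M : Model.{u} d D T L R) n s => M.mid n s i - M.fine n s i - M.lin n s i) := by
  have h1 : IsBigO 2 (fun (M : Model.{u} d D T L R) n s => M.f (M.fine n s) i * (1 / 2 * M.h)) := by
    simpa using (isBigO_f_fine i).mul (IsBigO.step.const_mul (1 / 2))
  have h2 := IsBigO.noiseForm (l := 0) (δ := fun M : Model.{u} d D T L R => M.h / 2)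
    (G := fun _ _ _ _ => 0) (H := fun j k M n s => M.tensor i j k (M.fine n s))
    (v := fun j M n s => M.a n s j)
    (fun M => by rw [abs_of_pos (by linarith [M.h_pos])]; linarith [M.h_pos])
    (fun j => .zero) (isBigO_tensor_fine i) isBigO_a
  convert h1.add h2 using 4 with M n s
  rw [Model.mid, M.mstep_apply, Model.lin]
  simp only [Model.noise, noiseForm, zero_mul, Finset.sum_const_zero]
  ring

lemma isBigO_norm_mid_sub_fine :
    IsBigO 1 (fun (M : Model.{u} d D T L R) n s => ‖M.mid n s - M.fine n s‖) := by
  refine isBigO_norm_of_apply (fun M n => (M.measurable_mid' n).sub (isProcess_fine.measurable M n))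
    fun i => ?_
  convert ((isBigO_mid_sub_fine_sub_lin i).weaken (l := 1) (by norm_num)).add (isBigO_lin i)
    using 4 with M n s
  simp

/-- Second order remainders are of second order in the size of the noise. -/
lemma isBigO_rem {φ : Model.{u} d D T L R → EuclideanSpace ℝ (Fin d) → ℝ}
    (hφ : ∀ M, ContDiff ℝ 2 (φ M)) (h1 : ∀ M l x, |partialDeriv l (φ M) x| ≤ L)
    (h2 : ∀ M k l x, |partialDeriv k (partialDeriv l (φ M)) x| ≤ L) :
    IsBigO 2 (fun (M : Model.{u} d D T L R) n s => M.rem (φ M) n s) := by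
  have hp : ∀ l, IsBigO 0 (fun (M : Model.{u} d D T L R) n s =>
      partialDeriv l (φ M) (M.fine n s)) := fun l =>
    isBigO_comp (φ := fun M x => partialDeriv l (φ M) x) (c := L) isProcess_fine.measurable
      isBigO_norm_fine (fun M => measurable_partialDeriv (hφ M) l) fun M x => by
        refine (h1 M l x).trans ?_
        have := M.L_nonneg
        nlinarith [norm_nonneg x]
  have hlin : IsBigO 2 (fun (M : Model.{u} d D T L R) n s => ∑ l,
      partialDeriv l (φ M) (M.fine n s) * (M.mid n s l - M.fine n s l - M.lin n s l)) :=
    .sum fun l _ => by simpa using (hp l).mul (isBigO_mid_sub_fine_sub_lin l)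
  have htay : IsBigO 2 (fun (M : Model.{u} d D T L R) n s =>
      expansionRem (φ M) (M.fine n s) (M.mid n s) (fun l => M.mid n s l - M.fine n s l)) := by
    refine .of_le (fun M n _ => ?_) (isBigO_norm_mid_sub_fine.mul isBigO_norm_mid_sub_fine)
      (d ^ 2 * L) fun M n s _ => ?_
    · exact measurable_expansionRem (hφ M) (isProcess_fine.measurable M n) (M.measurable_mid' n)
        fun l => ((M.moments_mid n l).sub (isProcess_fine.moments M n l)).measurable
    · rw [abs_of_nonneg (mul_nonneg (norm_nonneg _) (norm_nonneg _)), ← sq]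
      exact abs_taylor_remainder_le (hφ M) M.L_nonneg (h2 M) _ _
  convert htay.add hlin using 4 with M n s
  simp only [Model.rem, expansionRem, mul_sub, Finset.sum_sub_distrib]
  ring

lemma isBigO_rem_f (i : Fin d) :
    IsBigO 2 (fun (M : Model.{u} d D T L R) n s => M.rem (fun x => M.f x i) n s) :=
  isBigO_rem (φ := fun M x => M.f x i) (fun M => M.bounded.contDiff_f_apply i)
    (fun M => M.bounded.deriv_f i) (fun M => M.bounded.deriv2_f i)

lemma isBigO_rem_g (i : Fin d) (j : Fin D) :
    IsBigO 2 (fun (M : Model.{u} d D T L R) n s => M.rem (fun x => M.g x i j) n s) :=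
  isBigO_rem (φ := fun M x => M.g x i j) (fun M => M.bounded.contDiff_g i j)
    (fun M => M.bounded.deriv_g i j) (fun M => M.bounded.deriv2_g i j)

lemma isBigO_driftRem (i : Fin d) :
    IsBigO 4 (fun (M : Model.{u} d D T L R) n s => M.driftRem i n s) := by
  have h := (IsBigO.step.const_mul (1 / 2)).mul (isBigO_rem_f.{u} (d := d) (D := D) (T := T)
    (L := L) (R := R) i)
  convert h using 4 with M n s
  rw [Model.driftRem]
  ring

lemma isBigO_martRem (i : Fin d) :
    IsBigO 3 (fun (M : Model.{u} d D T L R) n s => M.martRem i n s) := by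
  have hp : ∀ l, IsBigO 0 (fun (M : Model.{u} d D T L R) n s =>
      partialDeriv l (fun x => M.f x i) (M.fine n s)) := fun l =>
    isBigO_comp (φ := fun M x => partialDeriv l (fun x => M.f x i) x) (c := L)
      isProcess_fine.measurable isBigO_norm_fine
      (fun M => measurable_partialDeriv (M.bounded.contDiff_f_apply i) l) fun M x => by
        refine (M.bounded.deriv_f i l x).trans ?_
        have := M.L_nonneg
        nlinarith [norm_nonneg x]
  have h1 : IsBigO 1 (fun (M : Model.{u} d D T L R) n s =>
      ∑ l, partialDeriv l (fun x => M.f x i) (M.fine n s) * M.lin n s l) :=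
    .sum fun l _ => by simpa using (hp l).mul (isBigO_lin l)
  have h2 := (IsBigO.step.const_mul (1 / 2)).mul h1
  have h3 := IsBigO.noiseForm (l := 1) (δ := fun M : Model.{u} d D T L R => M.h / 2)
    (G := fun j M n s => M.rem (fun x => M.g x i j) n s)
    (H := fun j k M n s => M.tensor i j k (M.mid n s) - M.tensor i j k (M.fine n s))
    (v := fun j M n s => M.b n s j)
    (fun M => by rw [abs_of_pos (by linarith [M.h_pos])]; linarith [M.h_pos])
    (isBigO_rem_g i) (fun j k => isBigO_comp_sub (φ := fun M x => M.tensor i j k x)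
      (fun M n => M.measurable_mid' n) isProcess_fine.measurable isBigO_norm_mid_sub_fine
      (fun M => M.measurable_tensor i j k) (fun M => M.abs_tensor_sub_le i j k)) isBigO_b
  convert h2.add h3 using 4 with M n s
  rw [Model.martRem]
  ring

lemma isBigO_exchange (i : Fin d) :
    IsBigO 2 (fun (M : Model.{u} d D T L R) n s => M.exchange i n s) :=
  .sum fun j _ => .sum fun k _ => by
    simpa using (isBigO_tensor_fine i j k).mul
      (((isBigO_b j).mul (isBigO_a k)).sub ((isBigO_a j).mul (isBigO_b k)))

lemma Model.centered_exchange (M : Model.{u} d D T L R) (i : Fin d) (n : ℕ) :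
    Centered (M.𝒢 n) M.P (M.exchange i n) :=
  .sum fun j _ => .sum fun k _ => ((M.centered_b_mul_a n j k).sub (M.centered_a_mul_b n j k)).mul_left
    ((M.measurable_tensor i j k).comp (isProcess_fine.adapted M n))
    (hasMoments_comp (M.measurable_tensor i j k) (M.abs_tensor_le i j k)
      (isProcess_fine.measurable M n) (isProcess_fine.moments M n))

lemma Model.centered_martRem (M : Model.{u} d D T L R) (i : Fin d) (n : ℕ) (hn : n ≤ M.N) :
    Centered (M.𝒢 n) M.P (M.martRem i n) := by
  have hx := isProcess_fine.adapted M n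
  have hp : ∀ l, HasMoments M.P (fun s => partialDeriv l (fun x => M.f x i) (M.fine n s)) :=
    fun l => .of_le ((measurable_partialDeriv (M.bounded.contDiff_f_apply i) l).comp
      (isProcess_fine.measurable M n)) (.const L) fun s =>
        (M.bounded.deriv_f i l _).trans (le_abs_self _)
  have hg : ∀ l k, HasMoments M.P (fun s => M.g (M.fine n s) l k) := fun l k =>
    hasMoments_comp (M.measurable_g l k) (M.abs_g_le l k) (isProcess_fine.measurable M n)
      (isProcess_fine.moments M n)
  refine Centered.add (Centered.const_mul _ (.sum fun l _ => Centered.mul_left (.sum fun k _ =>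
    Centered.mul_left ((M.centered_a n k).mono le_sup_left) ?_ (hg l k)) ?_ (hp l)))
    (Centered.mono (m' := M.𝒢 n ⊔ MeasurableSpace.comap (M.a n) inferInstance) ?_ le_sup_left)
  · exact (M.measurable_g l k).comp hx
  · exact (measurable_partialDeriv (M.bounded.contDiff_f_apply i) l).comp hx
  · have ht : ∀ j k, HasMoments M.P
        (fun s => M.tensor i j k (M.mid n s) - M.tensor i j k (M.fine n s)) := fun j k =>
      (hasMoments_comp (M.measurable_tensor i j k) (M.abs_tensor_le i j k)
        (M.measurable_mid' n) (M.moments_mid n)).sub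
      (hasMoments_comp (M.measurable_tensor i j k) (M.abs_tensor_le i j k)
        (isProcess_fine.measurable M n) (isProcess_fine.moments M n))
    exact .noiseForm (fun j => M.measurable_rem (M.bounded.contDiff_g i j) n)
      (fun j k => measurable_comp_sub_comp (M.measurable_tensor i j k) (M.measurable_mid n)
        (hx.mono le_sup_left le_rfl))
      (fun j => (isBigO_rem_g i j).moments M n hn) ht (M.centered_b n) (M.centered_b_mul_b n)

/-! ### The antithetic pair and the error of its average -/

namespace Model

/-- The antithetic path. -/
def anti (M : Model.{u} d D T L R) (n : ℕ) (s : M.S) : EuclideanSpace ℝ (Fin d) := M.swap.fine n s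

/-- The average of the fine and the antithetic path. -/
def avg (M : Model.{u} d D T L R) (n : ℕ) (s : M.S) : EuclideanSpace ℝ (Fin d) :=
  (1 / 2 : ℝ) • (M.fine n s + M.anti n s)

/-- The difference between the averaged and the coarse path. -/
def err (M : Model.{u} d D T L R) (n : ℕ) (s : M.S) : EuclideanSpace ℝ (Fin d) :=
  M.avg n s - M.coarse n s

lemma anti_succ_apply (M : Model.{u} d D T L R) (n : ℕ) (s : M.S) (i : Fin d) :
    M.anti (n + 1) s i = M.anti n s i + M.f (M.anti n s) i * M.h
      + M.noise M.h i (M.anti n s) (M.a n s + M.b n s)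
      + M.swap.exchange i n s + M.swap.martRem i n s + M.swap.driftRem i n s := by
  rw [add_comm (M.a n s)]
  exact M.swap.fine_succ_apply n s i

lemma coarse_succ_apply (M : Model.{u} d D T L R) (n : ℕ) (s : M.S) (i : Fin d) :
    M.coarse (n + 1) s i = M.coarse n s i + M.f (M.coarse n s) i * M.h
      + M.noise M.h i (M.coarse n s) (M.a n s + M.b n s) :=
  M.mstep_apply _ _ _ _

end Model

lemma isProcess_anti : IsProcess (fun M : Model.{u} d D T L R => M.anti) := isProcess_fine.swap

lemma isProcess_avg : IsProcess (fun M : Model.{u} d D T L R => M.avg) := by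
  refine ⟨fun M n => ?_, fun M n i => ?_⟩
  · exact ((isProcess_fine.adapted M n).add (isProcess_anti.adapted M n)).const_smul (1 / 2 : ℝ)
  · exact ((isProcess_fine.moments M n i).add (isProcess_anti.moments M n i)).const_mul (1 / 2)

lemma isProcess_err : IsProcess (fun M : Model.{u} d D T L R => M.err) :=
  isProcess_avg.sub isProcess_coarse

/-- The fine and the antithetic path differ by the order of the noise of a single step. -/
theorem isBigO_norm_fine_sub_anti :
    IsBigO 1 (fun (M : Model.{u} d D T L R) n s => ‖M.fine n s - M.anti n s‖) := by
  refine isBigO_norm_of_step (isProcess_fine.sub isProcess_anti) (K₀ := 0)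
    (U := fun i M n s => (M.f (M.fine n s) i - M.f (M.anti n s) i) * M.h
      + (M.driftRem i n s - M.swap.driftRem i n s))
    (V := fun i M n s => (M.noise M.h i (M.fine n s) (M.a n s + M.b n s)
        - M.noise M.h i (M.anti n s) (M.a n s + M.b n s))
      + ((M.exchange i n s - M.swap.exchange i n s) + (M.martRem i n s - M.swap.martRem i n s)))
    (fun M s => ?_) (fun M n s i => ?_) (fun i => ?_) (fun i => ?_) (fun i M n hn => ?_)
  · simp [Model.fine, Model.anti, Model.swap]
  · simp only [PiLp.sub_apply, M.fine_succ_apply, M.anti_succ_apply]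
    ring
  · exact (isProcess_fine.isRelBigO_drift_sub isProcess_anti 1 i).add
      (.of_isBigO (((isBigO_driftRem i).sub (isBigO_driftRem i).swap).weaken (by norm_num)))
  · exact (isProcess_fine.isRelBigO_noise_sub isProcess_anti 1 i).add
      (.of_isBigO (((isBigO_exchange i).sub (isBigO_exchange i).swap).add
        (((isBigO_martRem i).sub (isBigO_martRem i).swap).weaken (by norm_num))))
  · exact ((isProcess_fine.centered_noise M n i).sub (isProcess_anti.centered_noise M n i)).add
      (((M.centered_exchange i n).sub (M.swap.centered_exchange i n)).add
        ((M.centered_martRem i n hn).sub (M.swap.centered_martRem i n hn)))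

namespace Model

/-- The drift increment of the error that does not come from the Lipschitz dependence on it. -/
def errDrift (M : Model.{u} d D T L R) (i : Fin d) (n : ℕ) (s : M.S) : ℝ :=
  ((M.f (M.fine n s) i + M.f (M.anti n s) i) / 2 - M.f (M.avg n s) i) * M.h
    + (M.driftRem i n s + M.swap.driftRem i n s) / 2

/-- The centred increment of the error that does not come from the Lipschitz dependence on it. -/
def errMart (M : Model.{u} d D T L R) (i : Fin d) (n : ℕ) (s : M.S) : ℝ :=
  ((M.noise M.h i (M.fine n s) (M.a n s + M.b n s)
      + M.noise M.h i (M.anti n s) (M.a n s + M.b n s)) / 2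
      - M.noise M.h i (M.avg n s) (M.a n s + M.b n s))
    + (M.exchange i n s + M.swap.exchange i n s) / 2
    + (M.martRem i n s + M.swap.martRem i n s) / 2

/-- The drift increment of the error. -/
def errU (M : Model.{u} d D T L R) (i : Fin d) (n : ℕ) (s : M.S) : ℝ :=
  (M.f (M.avg n s) i - M.f (M.coarse n s) i) * M.h + M.errDrift i n s

/-- The centred increment of the error. -/
def errV (M : Model.{u} d D T L R) (i : Fin d) (n : ℕ) (s : M.S) : ℝ :=
  (M.noise M.h i (M.avg n s) (M.a n s + M.b n s)
    - M.noise M.h i (M.coarse n s) (M.a n s + M.b n s)) + M.errMart i n s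

lemma err_succ_apply (M : Model.{u} d D T L R) (n : ℕ) (s : M.S) (i : Fin d) :
    M.err (n + 1) s i = M.err n s i + M.errU i n s + M.errV i n s := by
  have h : ∀ n, M.avg n s i = (M.fine n s i + M.anti n s i) / 2 := fun n => by
    simp [avg]; ring
  simp only [err, PiLp.sub_apply, h, M.fine_succ_apply, M.anti_succ_apply, M.coarse_succ_apply,
    errU, errV, errDrift, errMart]
  ring

lemma centered_errV (M : Model.{u} d D T L R) (i : Fin d) (n : ℕ) (hn : n ≤ M.N) :
    Centered (M.𝒢 n) M.P (M.errV i n) := by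
  have h : ∀ {V : M.S → ℝ}, Centered (M.𝒢 n) M.P V → Centered (M.𝒢 n) M.P (fun s => V s / 2) :=
    fun hV => by simpa only [div_eq_inv_mul] using hV.const_mul 2⁻¹
  exact ((isProcess_avg.centered_noise M n i).sub (isProcess_coarse.centered_noise M n i)).add
    ((((h ((isProcess_fine.centered_noise M n i).add (isProcess_anti.centered_noise M n i))).sub
      (isProcess_avg.centered_noise M n i)).add
      (h ((M.centered_exchange i n).add (M.swap.centered_exchange i n)))).add
      (h ((M.centered_martRem i n hn).add (M.swap.centered_martRem i n hn))))

end Model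

lemma IsBigO.half {k : ℕ} {Z : ∀ M : Model.{u} d D T L R, ℕ → M.S → ℝ} (hZ : IsBigO k Z) :
    IsBigO k (fun M n s => Z M n s / 2) := by
  simpa only [div_eq_inv_mul] using hZ.const_mul 2⁻¹

/-- Averaging a function with bounded second derivatives over the antithetic pair. -/
lemma isBigO_midpoint_error {φ : Model.{u} d D T L R → EuclideanSpace ℝ (Fin d) → ℝ}
    (hφ : ∀ M, ContDiff ℝ 2 (φ M))
    (h2 : ∀ M k l x, |partialDeriv k (partialDeriv l (φ M)) x| ≤ L) :
    IsBigO 2 (fun (M : Model.{u} d D T L R) n s =>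
      (φ M (M.fine n s) + φ M (M.anti n s)) / 2 - φ M (M.avg n s)) := by
  refine .of_le (fun M n _ => ?_) (isBigO_norm_fine_sub_anti.mul isBigO_norm_fine_sub_anti)
    (d ^ 2 * L) fun M n s _ => ?_
  · have hm := (hφ M).continuous.measurable
    exact (((hm.comp (isProcess_fine.measurable M n)).add
      (hm.comp (isProcess_anti.measurable M n))).div_const 2).sub
      (hm.comp (isProcess_avg.measurable M n))
  · rw [abs_of_nonneg (mul_nonneg (norm_nonneg _) (norm_nonneg _)), ← sq]
    exact abs_midpoint_error_le (hφ M) M.L_nonneg (h2 M) _ _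

/-- Averaging the Milstein tensor, which is only Lipschitz, over the antithetic pair. -/
lemma isBigO_tensor_midpoint_error (i : Fin d) (j k : Fin D) :
    IsBigO 1 (fun (M : Model.{u} d D T L R) n s =>
      (M.tensor i j k (M.fine n s) + M.tensor i j k (M.anti n s)) / 2
        - M.tensor i j k (M.avg n s)) := by
  have hm := fun M : Model.{u} d D T L R => M.measurable_tensor i j k
  refine .of_le (fun M n _ => ?_) isBigO_norm_fine_sub_anti (d * L) fun M n s _ => ?_
  · exact ((((hm M).comp (isProcess_fine.measurable M n)).add
      ((hm M).comp (isProcess_anti.measurable M n))).div_const 2).sub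
      ((hm M).comp (isProcess_avg.measurable M n))
  · have e1 : M.fine n s - M.avg n s = (1 / 2 : ℝ) • (M.fine n s - M.anti n s) := by
      rw [Model.avg]; module
    have e2 : M.anti n s - M.avg n s = -((1 / 2 : ℝ) • (M.fine n s - M.anti n s)) := by
      rw [Model.avg]; module
    have n1 : ‖M.fine n s - M.avg n s‖ = 1 / 2 * ‖M.fine n s - M.anti n s‖ := by
      rw [e1, norm_smul]; norm_num
    have n2 : ‖M.anti n s - M.avg n s‖ = 1 / 2 * ‖M.fine n s - M.anti n s‖ := by
      rw [e2, norm_neg, norm_smul]; norm_num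
    have h1 := M.abs_tensor_sub_le i j k (M.fine n s) (M.avg n s)
    have h2 := M.abs_tensor_sub_le i j k (M.anti n s) (M.avg n s)
    rw [n1, abs_le] at h1
    rw [n2, abs_le] at h2
    rw [abs_norm, abs_le]
    have h0 : 0 ≤ d * L * ‖M.fine n s - M.anti n s‖ := by
      have := M.L_nonneg
      positivity
    constructor <;> nlinarith

lemma isBigO_errDrift (i : Fin d) :
    IsBigO 4 (fun (M : Model.{u} d D T L R) n s => M.errDrift i n s) :=
  ((isBigO_midpoint_error (φ := fun M x => M.f x i) (fun M => M.bounded.contDiff_f_apply i)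
    (fun M => M.bounded.deriv2_f i)).mul IsBigO.step).add
    ((isBigO_driftRem i).add (isBigO_driftRem i).swap).half

/-- The exchange terms of the two paths cancel up to the distance between the paths. -/
lemma isBigO_exchange_add_swap (i : Fin d) :
    IsBigO 3 (fun (M : Model.{u} d D T L R) n s => M.exchange i n s + M.swap.exchange i n s) := by
  have h : IsBigO 3 (fun (M : Model.{u} d D T L R) n s => ∑ j, ∑ k,
      (M.tensor i j k (M.fine n s) - M.tensor i j k (M.anti n s))
        * (M.b n s j * M.a n s k - M.a n s j * M.b n s k)) :=
    .sum fun j _ => .sum fun k _ => (isBigO_comp_sub (φ := fun M x => M.tensor i j k x)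
      isProcess_fine.measurable isProcess_anti.measurable isBigO_norm_fine_sub_anti
      (fun M => M.measurable_tensor i j k) (fun M => M.abs_tensor_sub_le i j k)).mul
      (((isBigO_b j).mul (isBigO_a k)).sub ((isBigO_a j).mul (isBigO_b k)))
  convert h using 4 with M n s
  have e : M.swap.exchange i n s = ∑ j, ∑ k, M.tensor i j k (M.anti n s)
      * (M.a n s j * M.b n s k - M.b n s j * M.a n s k) := rfl
  rw [e, Model.exchange, ← Finset.sum_add_distrib]
  refine Finset.sum_congr rfl fun j _ => ?_
  rw [← Finset.sum_add_distrib]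
  refine Finset.sum_congr rfl fun k _ => ?_
  ring

lemma isBigO_errMart (i : Fin d) :
    IsBigO 3 (fun (M : Model.{u} d D T L R) n s => M.errMart i n s) := by
  refine IsBigO.add (IsBigO.add ?_ (isBigO_exchange_add_swap i).half)
    ((isBigO_martRem i).add (isBigO_martRem i).swap).half
  have h := IsBigO.noiseForm (l := 1) (δ := fun M : Model.{u} d D T L R => M.h)
    (G := fun j M n s => (M.g (M.fine n s) i j + M.g (M.anti n s) i j) / 2 - M.g (M.avg n s) i j)
    (H := fun j k M n s => (M.tensor i j k (M.fine n s) + M.tensor i j k (M.anti n s)) / 2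
        - M.tensor i j k (M.avg n s))
    (v := fun j M n s => (M.a n s + M.b n s) j)
    (fun M => by rw [abs_of_pos M.h_pos])
    (fun j => isBigO_midpoint_error (φ := fun M x => M.g x i j)
      (fun M => M.bounded.contDiff_g i j) (fun M => M.bounded.deriv2_g i j))
    (isBigO_tensor_midpoint_error i) isBigO_add_apply
  simp only [noiseForm_sub, noiseForm_half_add] at h
  exact h

lemma isRelBigO_errU (i : Fin d) : IsRelBigO 2 2 (fun M : Model.{u} d D T L R => M.err)
    (fun M n s => M.errU i n s) :=
  (isProcess_avg.isRelBigO_drift_sub isProcess_coarse 2 i).add (.of_isBigO (isBigO_errDrift i))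

lemma isRelBigO_errV (i : Fin d) : IsRelBigO 2 1 (fun M : Model.{u} d D T L R => M.err)
    (fun M n s => M.errV i n s) :=
  (isProcess_avg.isRelBigO_noise_sub isProcess_coarse 2 i).add (.of_isBigO (isBigO_errMart i))

lemma Model.err_zero (M : Model.{u} d D T L R) (s : M.S) : M.err 0 s = 0 := by
  have h : M.err 0 s = (1 / 2 : ℝ) • (M.x₀ + M.x₀) - M.x₀ := rfl
  rw [h]
  module

theorem isBigO_norm_err : IsBigO 2 (fun (M : Model.{u} d D T L R) n s => ‖M.err n s‖) :=
  isBigO_norm_of_step isProcess_err (K₀ := 0) (fun M s => by simp [M.err_zero])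
    (fun M n s i => M.err_succ_apply n s i) isRelBigO_errU isRelBigO_errV
    (fun i M n hn => M.centered_errV i n hn)

lemma isBigO_errU (i : Fin d) : IsBigO 4 (fun (M : Model.{u} d D T L R) n s => M.errU i n s) :=
  (isRelBigO_errU i).isBigO isBigO_norm_err

lemma isBigO_errV (i : Fin d) : IsBigO 3 (fun (M : Model.{u} d D T L R) n s => M.errV i n s) :=
  (isRelBigO_errV i).isBigO isBigO_norm_err

/-- The increments of the error over `[m, n]` have the size `r²` of the error itself times the
square root of the elapsed time, as for a Brownian motion. The exponent `q` of the elapsed time is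
lowered to `3`, which is what the maximal inequality needs. -/
theorem exists_integral_err_increment_le (i : Fin d) {q : ℕ} (hq : 3 ≤ q) :
    ∃ K : ℝ, 0 ≤ K ∧ ∀ M : Model.{u} d D T L R, ∀ m n, m ≤ n → n ≤ M.N →
      ∫ s, |M.err n s i - M.err m s i| ^ (2 * q) ∂M.P
        ≤ K * (M.r ^ 2) ^ (2 * q) * (((n : ℝ) - m) / M.N) ^ 3 := by
  obtain ⟨KU, hKU, hU⟩ := (isBigO_errU.{u} (d := d) (D := D) (T := T) (L := L) (R := R) i).bound
    (2 * q)
  obtain ⟨KV, hKV, hV⟩ := (isBigO_errV.{u} (d := d) (D := D) (T := T) (L := L) (R := R) i).bound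
    (2 * q)
  set γ := stepConst (2 * q - 1)
  have hγ : 0 ≤ γ := stepConst_nonneg _
  refine ⟨Real.exp γ * γ * (|T| ^ (2 * q) * KU + |T| ^ q * KV), by positivity,
    fun M m n hmn hn => ?_⟩
  have hr := M.r_pos
  have hT := M.T_nonneg
  have hN := M.N_pos
  obtain ⟨J, rfl⟩ := Nat.exists_eq_add_of_le hmn
  rcases Nat.eq_zero_or_pos J with rfl | hJ
  · simp [show q ≠ 0 by omega]
  have h := integral_abs_sum_pow_le (P := M.P) (fun k => M.𝒢 (m + k)) (p := 2 * q) (J := J)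
    (W := fun k s => M.err (m + k) s i - M.err m s i) (U := fun k => M.errU i (m + k))
    (V := fun k => M.errV i (m + k)) (α := KU * (M.r ^ 4) ^ (2 * q))
    (β := KV * (M.r ^ 3) ^ (2 * q)) (even_two_mul q) (by omega) hJ (by positivity) (by positivity)
    (fun k _ => (isProcess_err.moments M _ i).sub (isProcess_err.moments M _ i))
    (fun k _ => ((EuclideanSpace.proj (𝕜 := ℝ) i).continuous.measurable.comp
      (isProcess_err.adapted M _)).sub ((EuclideanSpace.proj (𝕜 := ℝ) i).continuous.measurable.comp
      ((isProcess_err.adapted M m).mono (M.𝒢_mono (Nat.le_add_right m k)) le_rfl)))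
    (fun s => by simp)
    (fun k _ s => by
      have := M.err_succ_apply (m + k) s i
      rw [← add_assoc, this]
      ring)
    (fun k hk => (isBigO_errU i).moments M _ (by omega))
    (fun k hk => M.centered_errV i _ (by omega))
    (fun k hk => hU M _ (by omega)) (fun k hk => hV M _ (by omega))
  refine h.trans ?_
  set τ : ℝ := (J : ℝ) / M.N with hτ
  have hτ0 : 0 ≤ τ := by positivity
  have hτ1 : τ ≤ 1 := by
    rw [hτ, div_le_one hN]
    exact_mod_cast (by omega : J ≤ M.N)
  have hJr : (J : ℝ) * M.r ^ 2 = T * τ := by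
    have : M.r ^ 2 = T / M.N := by rw [eq_div_iff hN.ne', mul_comm, M.N_mul_r_sq]
    rw [this, hτ]
    ring
  have hsub : (((m + J : ℕ) : ℝ) - m) / M.N = τ := by rw [hτ]; push_cast; ring_nf
  have e1 : (J : ℝ) ^ (2 * q) * (KU * (M.r ^ 4) ^ (2 * q))
      = (T * τ) ^ (2 * q) * KU * (M.r ^ 2) ^ (2 * q) := by
    rw [← hJr, show M.r ^ 4 = M.r ^ 2 * M.r ^ 2 by ring, mul_pow, mul_pow]; ring
  have e2 : √(J : ℝ) ^ (2 * q) * (KV * (M.r ^ 3) ^ (2 * q))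
      = (T * τ) ^ q * KV * (M.r ^ 2) ^ (2 * q) := by
    rw [← hJr, pow_mul √(J : ℝ), Real.sq_sqrt (Nat.cast_nonneg J), mul_pow]
    ring
  have hp1 : τ ^ (2 * q) ≤ τ ^ 3 := pow_le_pow_of_le_one hτ0 hτ1 (by omega)
  have hp2 : τ ^ q ≤ τ ^ 3 := pow_le_pow_of_le_one hτ0 hτ1 hq
  rw [e1, e2, hsub, abs_of_nonneg hT, mul_pow, mul_pow]
  calc Real.exp γ * γ * (T ^ (2 * q) * τ ^ (2 * q) * KU * (M.r ^ 2) ^ (2 * q)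
        + T ^ q * τ ^ q * KV * (M.r ^ 2) ^ (2 * q))
      ≤ Real.exp γ * γ * (T ^ (2 * q) * τ ^ 3 * KU * (M.r ^ 2) ^ (2 * q)
        + T ^ q * τ ^ 3 * KV * (M.r ^ 2) ^ (2 * q)) := by gcongr
    _ = _ := by ring

/-- The maximal error is of the order of the time step in all `L^p` with even `p ≥ 6`. -/
theorem exists_integrable_err_envelope (d D : ℕ) (T L R : ℝ) {q : ℕ} (hq : 3 ≤ q) :
    ∃ K : ℝ, 0 ≤ K ∧ ∀ M : Model.{u} d D T L R, ∃ Q : M.S → ℝ, Integrable Q M.P ∧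
      (∀ s, ∀ n ≤ M.N, ‖M.err n s‖ ^ (2 * q) ≤ Q s) ∧ ∫ s, Q s ∂M.P ≤ K * M.h ^ (2 * q) := by
  choose K hK hinc using fun i : Fin d =>
    exists_integral_err_increment_le.{u} (D := D) (T := T) (L := L) (R := R) i hq
  have hc := chainConst_nonneg (2 * q)
  have hK' : ∀ i, 0 ≤ chainConst (2 * q) * K i := fun i => mul_nonneg hc (hK i)
  refine ⟨((d : ℝ) + 1) ^ (2 * q - 1) * ∑ i, chainConst (2 * q) * K i,
    mul_nonneg (by positivity) (Finset.sum_nonneg fun i _ => hK' i), fun M => ?_⟩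
  have hh := M.h_pos
  choose Q hQi hQ hQK using fun i : Fin d =>
    exists_integrable_envelope (P := M.P) (p := 2 * q) (N := M.N) (by omega) M.one_le_N
      (X := fun n s => M.err n s i) (B := K i * (M.r ^ 2) ^ (2 * q))
      (fun n _ => isProcess_err.moments M n i) (fun s => by simp [M.err_zero])
      (by have := hK i; positivity) (hinc i M)
  refine ⟨fun s => ((d : ℝ) + 1) ^ (2 * q - 1) * ∑ i, Q i s,
    (integrable_finsetSum _ fun i _ => hQi i).const_mul _, fun s n hn => ?_, ?_⟩
  · refine (norm_pow_le _ (by omega)).trans ?_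
    exact mul_le_mul_of_nonneg_left (Finset.sum_le_sum fun i _ => hQ i s n hn) (by positivity)
  · rw [integral_const_mul, integral_finsetSum _ fun i _ => hQi i, mul_assoc, Finset.sum_mul]
    refine mul_le_mul_of_nonneg_left (Finset.sum_le_sum fun i _ => ?_) (by positivity)
    refine (hQK i).trans (le_of_eq ?_)
    rw [M.r_sq]
    ring

/-! ### Brownian increments -/

section Brownian

variable {S : Type u} {mS : MeasurableSpace S} {P : Measure S}

/-- If `m₁`, `m₂` are independent and `m₃` is independent of both jointly, then `m₁` is independent
of `m₂` and `m₃` jointly. -/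
lemma indep_sup_right_of_indep [IsProbabilityMeasure P] {m₁ m₂ m₃ : MeasurableSpace S}
    (h₁ : m₁ ≤ mS) (h₂ : m₂ ≤ mS) (h₃ : m₃ ≤ mS) (h₁₂ : Indep m₁ m₂ P)
    (h : Indep m₃ (m₁ ⊔ m₂) P) : Indep m₁ (m₂ ⊔ m₃) P := by
  have hgen : m₂ ⊔ m₃ = MeasurableSpace.generateFrom
      {u | ∃ s t, MeasurableSet[m₂] s ∧ MeasurableSet[m₃] t ∧ u = s ∩ t} := by
    apply le_antisymm
    · refine sup_le (fun s hs => ?_) (fun t ht => ?_)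
      · exact MeasurableSpace.measurableSet_generateFrom ⟨s, Set.univ, hs, .univ, by simp⟩
      · exact MeasurableSpace.measurableSet_generateFrom ⟨Set.univ, t, .univ, ht, by simp⟩
    · refine MeasurableSpace.generateFrom_le ?_
      rintro _ ⟨s, t, hs, ht, rfl⟩
      exact ((le_sup_left : m₂ ≤ m₂ ⊔ m₃) s hs).inter ((le_sup_right : m₃ ≤ m₂ ⊔ m₃) t ht)
  refine IndepSets.indep h₁ (sup_le h₂ h₃) (@MeasurableSpace.isPiSystem_measurableSet S m₁) ?_
    (@MeasurableSpace.generateFrom_measurableSet S m₁).symm hgen ?_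
  · rintro _ ⟨s, t, hs, ht, rfl⟩ _ ⟨s', t', hs', ht', rfl⟩ _
    exact ⟨s ∩ s', t ∩ t', hs.inter hs', ht.inter ht', Set.inter_inter_inter_comm _ _ _ _⟩
  · rw [IndepSets_iff]
    rintro r _ hr ⟨s, t, hs, ht, rfl⟩
    have hr : MeasurableSet[m₁] r := hr
    rw [Indep_iff] at h₁₂ h
    have hrs : MeasurableSet[m₁ ⊔ m₂] (r ∩ s) :=
      ((le_sup_left : m₁ ≤ m₁ ⊔ m₂) r hr).inter ((le_sup_right : m₂ ≤ m₁ ⊔ m₂) s hs)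
    rw [← Set.inter_assoc, Set.inter_comm _ t, h t (r ∩ s) ht hrs, h₁₂ r s hr hs,
      Set.inter_comm s t, h t s ht ((le_sup_right : m₂ ≤ m₁ ⊔ m₂) s hs)]
    ring

/-- `v` is a measurable centred Gaussian vector with covariance matrix `c C`. -/
structure IsGaussianIncrement (P : Measure S) (C : Matrix (Fin D) (Fin D) ℝ) (c : ℝ≥0)
    (v : S → EuclideanSpace ℝ (Fin D)) : Prop where
  measurable : Measurable v
  law : HasLaw v (multivariateGaussian 0 ((c : ℝ) • C)) P

namespace IsGaussianIncrement

variable {C : Matrix (Fin D) (Fin D) ℝ} {c : ℝ≥0} {v : S → EuclideanSpace ℝ (Fin D)}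

lemma hasLaw_apply (hv : IsGaussianIncrement P C c v) (hC : IsCorrelationMatrix C) (j : Fin D) :
    HasLaw (fun s => v s j) (gaussianReal 0 c) P := by
  have hpos : ((c : ℝ) • C).PosSemidef := hC.posSemidef.smul c.2
  have h := (measurePreserving_eval_multivariateGaussian (μ := 0) hpos (i := j)).fun_comp_hasLaw
    hv.law
  simpa [hC.diag j] using h

lemma gaussianReal_eq_map (c : ℝ≥0) :
    gaussianReal 0 c = (gaussianReal 0 1).map (√(c : ℝ) * ·) := by
  rw [gaussianReal_map_const_mul]
  congr 1
  · simp
  · ext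
    simp

lemma hasMoments (hv : IsGaussianIncrement P C c v) (hC : IsCorrelationMatrix C) (j : Fin D) :
    HasMoments P (fun s => v s j) := by
  refine ⟨(EuclideanSpace.proj (𝕜 := ℝ) j).continuous.measurable.comp hv.measurable, fun q => ?_⟩
  have hl := hv.hasLaw_apply hC j
  have h := (memLp_id_gaussianReal (μ := 0) (v := c) q).integrable_norm_pow'
  have h2 : Integrable (fun x : ℝ => |x| ^ q) (P.map fun s => v s j) := by
    rw [hl.map_eq]
    simpa using h
  exact h2.comp_aemeasurable hl.aemeasurable

lemma integral_abs_pow (hv : IsGaussianIncrement P C c v) (hC : IsCorrelationMatrix C) (j : Fin D)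
    (q : ℕ) : ∫ s, |v s j| ^ q ∂P = normalMoment q * √(c : ℝ) ^ q := by
  have hl := hv.hasLaw_apply hC j
  have h1 : ∫ s, |v s j| ^ q ∂P = ∫ x, |x| ^ q ∂(gaussianReal 0 c) :=
    hl.integral_comp (f := fun x => |x| ^ q) (by fun_prop)
  rw [h1, gaussianReal_eq_map, integral_map (by fun_prop) (by fun_prop)]
  simp only [abs_mul, mul_pow, integral_const_mul, abs_of_nonneg (Real.sqrt_nonneg _)]
  rw [normalMoment, mul_comm]

lemma integral_apply (hv : IsGaussianIncrement P C c v) (hC : IsCorrelationMatrix C) (j : Fin D) :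
    ∫ s, v s j ∂P = 0 := by
  rw [(hv.hasLaw_apply hC j).integral_eq]
  simp

lemma integral_mul [IsProbabilityMeasure P] (hv : IsGaussianIncrement P C c v)
    (hC : IsCorrelationMatrix C) (j k : Fin D) : ∫ s, v s j * v s k ∂P = C j k * c := by
  have hpos : ((c : ℝ) • C).PosSemidef := hC.posSemidef.smul c.2
  have hm : ∀ j : Fin D, Measurable (fun x : EuclideanSpace ℝ (Fin D) => x j) := fun j =>
    (EuclideanSpace.proj (𝕜 := ℝ) j).continuous.measurable
  have h := hv.law.covariance_fun_comp (f := fun x => x j) (g := fun x => x k)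
    (hm j).aemeasurable (hm k).aemeasurable
  rw [covariance_eval_multivariateGaussian hpos, covariance, hv.integral_apply hC,
    hv.integral_apply hC] at h
  simpa [mul_comm] using h

end IsGaussianIncrement

lemma IsCorrelationMatrix.abs_le_one {C : Matrix (Fin D) (Fin D) ℝ}
    (hC : IsCorrelationMatrix C) (j k : Fin D) : |C j k| ≤ 1 := by
  have h := (hC.posSemidef.submatrix ![j, k]).det_nonneg
  have hs : C k j = C j k := by simpa using hC.posSemidef.isHermitian.apply j k
  simp only [Matrix.det_fin_two, Matrix.submatrix_apply, Matrix.cons_val_zero,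
    Matrix.cons_val_one, hC.diag, hs] at h
  exact abs_le_one_iff_mul_self_le_one.2 (by linarith)

end Brownian

namespace BoundedDerivatives

lemma mono {f : EuclideanSpace ℝ (Fin d) → EuclideanSpace ℝ (Fin d)}
    {g : EuclideanSpace ℝ (Fin d) → Matrix (Fin d) (Fin D) ℝ} {L' : ℝ}
    (hb : BoundedDerivatives L f g) (h : L ≤ L') : BoundedDerivatives L' f g where
  contDiff_f := hb.contDiff_f
  contDiff_g := hb.contDiff_g
  deriv_f i l x := (hb.deriv_f i l x).trans h
  deriv_g i j l x := (hb.deriv_g i j l x).trans h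
  deriv_h i j k l x := (hb.deriv_h i j k l x).trans h
  deriv2_f i k l x := (hb.deriv2_f i k l x).trans h
  deriv2_g i j k l x := (hb.deriv2_g i j k l x).trans h

end BoundedDerivatives

section Paths

variable {S : Type u} {mS : MeasurableSpace S} {P : Measure S} {ℱ : Filtration ℝ≥0 mS}
  {w : ℝ≥0 → S → EuclideanSpace ℝ (Fin D)} {C : Matrix (Fin D) (Fin D) ℝ}

lemma increment_add_increment (W : ℝ≥0 → EuclideanSpace ℝ (Fin D)) (δ : ℝ≥0) (n : ℕ) :
    increment W (δ / 2) (2 * n) + increment W (δ / 2) (2 * n + 1) = increment W δ n := by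
  have h1 : ((2 * n : ℕ) : ℝ≥0) * (δ / 2) = n * δ := by push_cast; field_simp
  have h2 : (((2 * n + 1 : ℕ) : ℝ≥0) + 1) * (δ / 2) = (n + 1) * δ := by
    push_cast; field_simp; ring
  have h3 : ((2 * n + 1 : ℕ) : ℝ≥0) = ((2 * n : ℕ) : ℝ≥0) + 1 := by push_cast; ring
  rw [increment, increment, increment, h1, h2, h3]
  abel

namespace IsBrownianMotion

lemma measurable_increment (hw : IsBrownianMotion w C ℱ P) (δ : ℝ≥0) (m : ℕ) {t : ℝ≥0}
    (ht : (m + 1) * δ ≤ t) : Measurable[ℱ t] (fun s => increment (fun t => w t s) δ m) :=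
  ((hw.adapted _).mono (ℱ.mono ht) le_rfl).sub
    ((hw.adapted _).mono (ℱ.mono (le_trans (by gcongr; simp) ht)) le_rfl)

lemma isGaussianIncrement (hw : IsBrownianMotion w C ℱ P) (δ : ℝ≥0) (m : ℕ) :
    IsGaussianIncrement P C δ (fun s => increment (fun t => w t s) δ m) := by
  refine ⟨(hw.measurable_increment δ m le_rfl).mono (ℱ.le _) le_rfl, ?_⟩
  have h := hw.law (m * δ) ((m + 1) * δ) (by gcongr; simp)
  rwa [add_mul, one_mul, add_tsub_cancel_left, ← one_mul δ, ← mul_assoc, ← add_mul, mul_one,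
    one_mul] at h

lemma indep_increment (hw : IsBrownianMotion w C ℱ P) (δ : ℝ≥0) (m : ℕ) :
    Indep (MeasurableSpace.comap (fun s => increment (fun t => w t s) δ m) inferInstance)
      (ℱ (m * δ)) P :=
  hw.indep (m * δ) ((m + 1) * δ) (by gcongr; simp)

variable [IsProbabilityMeasure P]
  {f : EuclideanSpace ℝ (Fin d) → EuclideanSpace ℝ (Fin d)}
  {g : EuclideanSpace ℝ (Fin d) → Matrix (Fin d) (Fin D) ℝ} {x₀ : EuclideanSpace ℝ (Fin d)}

/-- The discrete model given by a Brownian motion, with time step `T / N`. -/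
def model (hw : IsBrownianMotion w C ℱ P) (hC : IsCorrelationMatrix C)
    (hb : BoundedDerivatives L f g) (hx₀ : ‖x₀‖ ≤ R) (hf : ‖f 0‖ ≤ R) (hg : ∀ i j, |g 0 i j| ≤ R)
    {T : ℝ≥0} (hT : 0 < T) {N : ℕ} (hN : 1 ≤ N) : Model.{u} d D T |L| |R| :=
  have hN0 : (0 : ℝ≥0) < N := by exact_mod_cast hN
  have hΔ : 0 < T / N := div_pos hT hN0
  have ha := fun n => hw.isGaussianIncrement (T / N / 2) (2 * n)
  have hb' := fun n => hw.isGaussianIncrement (T / N / 2) (2 * n + 1)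
  have h0 : ∀ n : ℕ, (n : ℝ≥0) * (T / N) = (2 * n : ℕ) * (T / N / 2) := fun n => by
    push_cast; field_simp
  have hmid : ∀ n : ℕ, (((2 * n : ℕ) : ℝ≥0) + 1) * (T / N / 2)
      = ((2 * n + 1 : ℕ) : ℝ≥0) * (T / N / 2) := fun n => by push_cast; ring
  have hend : ∀ n : ℕ, (((2 * n + 1 : ℕ) : ℝ≥0) + 1) * (T / N / 2)
      = ((n + 1 : ℕ) : ℝ≥0) * (T / N) := fun n => by push_cast; field_simp; ring
  have hle : ∀ n : ℕ, ((2 * n : ℕ) : ℝ≥0) * (T / N / 2)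
      ≤ ((2 * n + 1 : ℕ) : ℝ≥0) * (T / N / 2) := fun n => by gcongr; omega
  have hle' : ∀ n : ℕ, ((2 * n + 1 : ℕ) : ℝ≥0) * (T / N / 2)
      ≤ ((n + 1 : ℕ) : ℝ≥0) * (T / N) := fun n => by
    rw [← hend]; gcongr; simp
  have hma : ∀ n : ℕ, Measurable[ℱ (((2 * n + 1 : ℕ) : ℝ≥0) * (T / N / 2))]
      (fun s => increment (fun t => w t s) (T / N / 2) (2 * n)) := fun n =>
    hw.measurable_increment _ _ (hmid n).le
  -- The increments over the two halves and the past are independent of each other.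
  have hi1 : ∀ n : ℕ, Indep (ℱ (n * (T / N))) (MeasurableSpace.comap
      (fun s => increment (fun t => w t s) (T / N / 2) (2 * n)) inferInstance) P := fun n => by
    rw [h0]; exact (hw.indep_increment (T / N / 2) (2 * n)).symm
  have hi2 : ∀ n : ℕ, Indep (MeasurableSpace.comap
      (fun s => increment (fun t => w t s) (T / N / 2) (2 * n + 1)) inferInstance)
      (ℱ (n * (T / N)) ⊔ MeasurableSpace.comap
        (fun s => increment (fun t => w t s) (T / N / 2) (2 * n)) inferInstance) P := fun n =>
    indep_of_indep_of_le_right (hw.indep_increment (T / N / 2) (2 * n + 1))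
      (sup_le (ℱ.mono ((h0 n).le.trans (hle n))) (hma n).comap_le)
  have hsqrt : √((T / N / 2 : ℝ≥0) : ℝ) ≤ √((T / N : ℝ≥0) : ℝ) :=
    Real.sqrt_le_sqrt (by exact_mod_cast half_le_self zero_le)
  have hmom : ∀ q, 0 ≤ normalMoment q := fun q => integral_nonneg fun x => by positivity
  { f := f
    g := g
    x₀ := x₀
    C := C
    L_nonneg := abs_nonneg L
    R_nonneg := abs_nonneg R
    bounded := hb.mono (le_abs_self L)
    norm_x₀ := hx₀.trans (le_abs_self R)
    norm_f := hf.trans (le_abs_self R)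
    abs_g := fun i j => (hg i j).trans (le_abs_self R)
    abs_C := hC.abs_le_one
    S := S
    mS := mS
    P := P
    prob := inferInstance
    𝒢 := fun n => ℱ (n * (T / N))
    𝒢_le := fun n => ℱ.le _
    𝒢_succ := fun n => ℱ.mono (by gcongr; simp)
    N := N
    one_le_N := hN
    h := ((T / N : ℝ≥0) : ℝ)
    h_pos := by exact_mod_cast hΔ
    N_mul_h := by
      have : (N : ℝ≥0) * (T / N) = T := by field_simp
      exact_mod_cast this
    a := fun n s => increment (fun t => w t s) (T / N / 2) (2 * n)
    b := fun n s => increment (fun t => w t s) (T / N / 2) (2 * n + 1)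
    measurable_a := fun n => (hma n).mono (ℱ.mono (hle' n)) le_rfl
    measurable_b := fun n => hw.measurable_increment _ _ (hend n).le
    indep_a := fun n => indep_sup_right_of_indep (ha n).measurable.comap_le (ℱ.le _)
      (hb' n).measurable.comap_le (hi1 n).symm (by rw [sup_comm]; exact hi2 n)
    indep_b := hi2
    indep_ab := fun n => (indep_sup_right_of_indep (ℱ.le _) (ha n).measurable.comap_le
      (hb' n).measurable.comap_le (hi1 n) (hi2 n)).symm
    moments_a := fun n j => (ha n).hasMoments hC j
    moments_b := fun n j => (hb' n).hasMoments hC j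
    moment_a_le := fun n j q => by
      rw [(ha n).integral_abs_pow hC j q]
      have := hmom q
      gcongr
    moment_b_le := fun n j q => by
      rw [(hb' n).integral_abs_pow hC j q]
      have := hmom q
      gcongr
    mean_a := fun n j => (ha n).integral_apply hC j
    mean_b := fun n j => (hb' n).integral_apply hC j
    cov_a := fun n j k => by rw [(ha n).integral_mul hC j k]; push_cast; rfl
    cov_b := fun n j k => by rw [(hb' n).integral_mul hC j k]; push_cast; rfl }

end IsBrownianMotion

namespace IsBrownianMotion

variable [IsProbabilityMeasure P]
  {f : EuclideanSpace ℝ (Fin d) → EuclideanSpace ℝ (Fin d)}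
  {g : EuclideanSpace ℝ (Fin d) → Matrix (Fin d) (Fin D) ℝ} {x₀ : EuclideanSpace ℝ (Fin d)}
  (hw : IsBrownianMotion w C ℱ P) (hC : IsCorrelationMatrix C)
  (hb : BoundedDerivatives L f g) (hx₀ : ‖x₀‖ ≤ R) (hf : ‖f 0‖ ≤ R) (hg : ∀ i j, |g 0 i j| ≤ R)
  {T : ℝ≥0} (hT : 0 < T) {N : ℕ} (hN : 1 ≤ N)

lemma coarse_model (n : ℕ) (s : S) : (hw.model hC hb hx₀ hf hg hT hN).coarse n s
    = coarsePath f g C x₀ (T / N) (fun t => w t s) n := by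
  induction n with
  | zero => rfl
  | succ n ih =>
    rw [coarsePath, ← ih, ← increment_add_increment]
    rfl

lemma fine_model (n : ℕ) (s : S) : (hw.model hC hb hx₀ hf hg hT hN).fine n s
    = finePath f g C x₀ (T / N) (fun t => w t s) n := by
  induction n with
  | zero => rfl
  | succ n ih =>
    rw [finePath, ← ih]
    rfl

lemma anti_model (n : ℕ) (s : S) : (hw.model hC hb hx₀ hf hg hT hN).anti n s
    = antitheticPath f g C x₀ (T / N) (fun t => w t s) n := by
  induction n with
  | zero => rfl
  | succ n ih =>
    rw [antitheticPath, ← ih]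
    rfl

lemma err_model (n : ℕ) (s : S) : (hw.model hC hb hx₀ hf hg hT hN).err n s
    = averagePath f g C x₀ (T / N) (fun t => w t s) n
      - coarsePath f g C x₀ (T / N) (fun t => w t s) n := by
  have h : (hw.model hC hb hx₀ hf hg hT hN).err n s
      = (hw.model hC hb hx₀ hf hg hT hN).avg n s
        - (hw.model hC hb hx₀ hf hg hT hN).coarse n s := rfl
  rw [h, coarse_model, averagePath, ← fine_model hw hC hb hx₀ hf hg hT hN,
    ← anti_model hw hC hb hx₀ hf hg hT hN]
  rfl

end IsBrownianMotion

end Paths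

/-- Lower moments are controlled by higher ones, with the correct scaling in `h`. -/
lemma rpow_le_rpow_mul_one_add {t h p : ℝ} {m : ℕ} (ht : 0 ≤ t) (hh : 0 < h) (hp : 0 ≤ p)
    (hpm : p ≤ m) : t ^ p ≤ h ^ p * (1 + t ^ m / h ^ m) := by
  have h0 : 0 ≤ t / h := by positivity
  have key : (t / h) ^ p ≤ 1 + (t / h) ^ m := by
    rcases le_total (t / h) 1 with h1 | h1
    · exact (Real.rpow_le_one h0 h1 hp).trans (le_add_of_nonneg_right (by positivity))
    · rw [← Real.rpow_natCast]
      exact (Real.rpow_le_rpow_of_exponent_le h1 hpm).trans (le_add_of_nonneg_left zero_le_one)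
  rw [Real.div_rpow ht hh.le, div_pow, div_le_iff₀ (by positivity)] at key
  linarith

end AntitheticMilstein

theorem theorem4p10 (d D : ℕ) (p : ℝ) (hp : 2 ≤ p) (T : ℝ≥0) (hT : 0 < T) (L R : ℝ) :
    ∃ K : ℝ,
      ∀ (f : EuclideanSpace ℝ (Fin d) → EuclideanSpace ℝ (Fin d))
        (g : EuclideanSpace ℝ (Fin d) → Matrix (Fin d) (Fin D) ℝ)
        (x₀ : EuclideanSpace ℝ (Fin d)) (C : Matrix (Fin D) (Fin D) ℝ),
        AntitheticMilstein.BoundedDerivatives L f g →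
        ‖x₀‖ ≤ R → ‖f 0‖ ≤ R → (∀ i j, |g 0 i j| ≤ R) →
        AntitheticMilstein.IsCorrelationMatrix C →
        ∀ {S : Type*} [mS : MeasurableSpace S] (P : Measure S) [IsProbabilityMeasure P]
          (ℱ : Filtration ℝ≥0 mS) (w : ℝ≥0 → S → EuclideanSpace ℝ (Fin D)),
          AntitheticMilstein.IsBrownianMotion w C ℱ P →
          ∀ N : ℕ, 1 ≤ N →
            Integrable
              (fun s => AntitheticMilstein.maxError f g C x₀ (T / N) N p (fun t => w t s)) P ∧
            ∫ s, AntitheticMilstein.maxError f g C x₀ (T / N) N p (fun t => w t s) ∂P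
              ≤ K * ((T / N : ℝ≥0) : ℝ) ^ p := by
  -- `exists_integrable_err_envelope` is for even integer exponents `2 * q ≥ 6`.
  set q : ℕ := max 3 ⌈p⌉₊ with hq
  have hq3 : 3 ≤ q := le_max_left _ _
  have hpq : p ≤ (2 * q : ℕ) := by
    have h1 : p ≤ ⌈p⌉₊ := Nat.le_ceil p
    have h2 : ⌈p⌉₊ ≤ 2 * q := (le_max_right 3 _).trans (by omega)
    exact h1.trans (by exact_mod_cast h2)
  obtain ⟨K, hK, hmodel⟩ :=
    AntitheticMilstein.exists_integrable_err_envelope d D (T : ℝ) |L| |R| hq3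
  refine ⟨1 + K, fun f g x₀ C hb hx₀ hf hg hC S mS P _ ℱ w hw N hN => ?_⟩
  set e : ℕ → S → EuclideanSpace ℝ (Fin d) := fun n s =>
    AntitheticMilstein.averagePath f g C x₀ (T / N) (fun t => w t s) n
      - AntitheticMilstein.coarsePath f g C x₀ (T / N) (fun t => w t s) n with he
  have herr : (hw.model hC hb hx₀ hf hg hT hN).err = e :=
    funext₂ (hw.err_model hC hb hx₀ hf hg hT hN)
  have hemeas : ∀ n, Measurable (e n) := fun n => herr ▸
    AntitheticMilstein.isProcess_err.measurable (hw.model hC hb hx₀ hf hg hT hN) n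
  obtain ⟨Q, hQi, hQ, hQK⟩ : ∃ Q : S → ℝ, Integrable Q P ∧
      (∀ s, ∀ n ≤ N, ‖e n s‖ ^ (2 * q) ≤ Q s) ∧
        ∫ s, Q s ∂P ≤ K * ((T / N : ℝ≥0) : ℝ) ^ (2 * q) :=
    herr ▸ hmodel (hw.model hC hb hx₀ hf hg hT hN)
  set h : ℝ := ((T / N : ℝ≥0) : ℝ) with hh
  have hh0 : 0 < h := (hw.model hC hb hx₀ hf hg hT hN).h_pos
  set B : S → ℝ := fun s => h ^ p * (1 + Q s / h ^ (2 * q)) with hB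
  have hBi : Integrable B P := ((integrable_const 1).add (hQi.div_const _)).const_mul _
  have hbound : ∀ s, AntitheticMilstein.maxError f g C x₀ (T / N) N p (fun t => w t s) ≤ B s := by
    intro s
    refine Finset.sup'_le _ _ fun n hn => ?_
    have hn : n ≤ N := by simpa [Nat.lt_succ_iff] using hn
    refine (AntitheticMilstein.rpow_le_rpow_mul_one_add (norm_nonneg _) hh0 (by linarith)
      hpq).trans ?_
    have := hQ s n hn
    simp only [hB]
    gcongr
  have hnonneg : ∀ s,
      0 ≤ AntitheticMilstein.maxError f g C x₀ (T / N) N p (fun t => w t s) := fun s =>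
    le_trans (by positivity) (Finset.le_sup' (fun n =>
      ‖AntitheticMilstein.averagePath f g C x₀ (T / N) (fun t => w t s) n
        - AntitheticMilstein.coarsePath f g C x₀ (T / N) (fun t => w t s) n‖ ^ p)
      (Finset.mem_range.2 (Nat.succ_pos N)))
  have hmeas : Measurable
      (fun s => AntitheticMilstein.maxError f g C x₀ (T / N) N p (fun t => w t s)) := by
    refine Finset.measurable_range_sup'' fun n _ => ?_
    exact (hemeas n).norm.pow_const p
  refine ⟨hBi.mono' hmeas.aestronglyMeasurable (.of_forall fun s => ?_), ?_⟩
  · rw [Real.norm_of_nonneg (hnonneg s)]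
    exact hbound s
  · calc ∫ s, AntitheticMilstein.maxError f g C x₀ (T / N) N p (fun t => w t s) ∂P
        ≤ ∫ s, B s ∂P := integral_mono_of_nonneg (.of_forall hnonneg) hBi (.of_forall hbound)
      _ = h ^ p * (1 + (∫ s, Q s ∂P) / h ^ (2 * q)) := by
          rw [hB, integral_const_mul, integral_add (integrable_const 1) (hQi.div_const _),
            integral_div]
          simp
      _ ≤ h ^ p * (1 + K * h ^ (2 * q) / h ^ (2 * q)) := by
          gcongr
      _ = (1 + K) * h ^ p := by
          field_simp

end
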